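/- For finite directed graphs $H$ and $G$ let $\operatorname{Sub}(H,G)$ be the number of (not necessarily induced) subgraphs of $G$ that are isomorphic to $H$; an undirected graph is regarded as the directed graph that has both orientations of each edge. Let $\operatorname{pw} H$ be the pathwidth of $H$. Graphs are given by adjacency lists, in any order, on the vertex sets $\{0,\dots,k-1\}$ and $\{0,\dots,n-1\}$, and numbers are integers that may occupy several machine words. There are a randomized algorithm (one fixed program of a word RAM with fair random bits) and a constant $C$ such that the following holds for every directed graph $H$ without loops with $k$ vertices, every directed graph $G$ with $n\ge 1$ vertices, every rational $\varepsilon>0$, and every word length $w$ such that $n$ and the numerator and the denominator of $\varepsilon$ (in lowest terms) are less than $2^w$. Given $H$, $G$, $\varepsilon$, the algorithm outputs an integer $\tilde N$ such that, with probability at least $99\%$, $$(1-\varepsilon)\cdot\operatorname{Sub}(H,G)\le\tilde N\le(1+\varepsilon)\cdot\operatorname{Sub}(H,G),$$ and for all outcomes of the random bits it stops within time $$\max(1,\varepsilon^{-2})\cdot 4^k\cdot n^{\operatorname{pw}H+1}\cdot C(k+1)^C .$$ Here time is counted in operations on $w$-bit words: reading an integer or using it as an address costs the number of its words, an arithmetic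 operation or comparison costs the product of the numbers of words of its operands, and drawing a random bit costs one unit. -/

import Mathlib

namespace SubgraphCounting

/-! ### Graphs: subgraphs and pathwidth -/

/-- A (not necessarily induced, not necessarily spanning) subgraph of the directed graph `G`: a set of
vertices together with a set of edges of `G` between these vertices. -/
structure DiSubgraph {V : Type*} (G : Digraph V) where
  verts : Set V
  Adj : V → V → Prop
  adj_sub : ∀ {u v : V}, Adj u v → G.Adj u v
  fst_mem : ∀ {u v : V}, Adj u v → u ∈ verts
  snd_mem : ∀ {u v : V}, Adj u v → v ∈ verts

/-- A subgraph as a directed graph on its own vertex set. -/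
def DiSubgraph.coe {V : Type*} {G : Digraph V} (S : DiSubgraph G) : Digraph S.verts where
  Adj u v := S.Adj u v

/-- `Sub(H, G)`: the number of subgraphs of `G` that are isomorphic to `H`. -/
noncomputable def subCount {V W : Type*} (H : Digraph V) (G : Digraph W) : ℕ :=
  Nat.card {S : DiSubgraph G // Nonempty (RelIso H.Adj S.coe.Adj)}

/-- A path decomposition of `H`: a tree decomposition whose tree is the path `0, 1, …, len`. Every
vertex of `H` lies in some bag, the positions of the bags that contain it form an interval, and
every edge of `H` lies within some bag. -/
structure PathDecomposition {V : Type*} (H : Digraph V) where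
  len : ℕ
  bag : Fin (len + 1) → Finset V
  vertex_mem : ∀ v : V, ∃ i, v ∈ bag i
  interval : ∀ (v : V) (i j l : Fin (len + 1)), i ≤ j → j ≤ l → v ∈ bag i → v ∈ bag l → v ∈ bag j
  edge_mem : ∀ u v : V, H.Adj u v → ∃ i, u ∈ bag i ∧ v ∈ bag i

/-- The pathwidth of `H`: the least `p` such that `H` has a path decomposition all of whose bags have
at most `p + 1` elements. -/
noncomputable def pathwidth {V : Type*} (H : Digraph V) : ℕ :=
  sInf {p : ℕ | ∃ D : PathDecomposition H, ∀ i, (D.bag i).card ≤ p + 1}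

/-- `L` is an adjacency-list representation of `G`: for every vertex `v`, `L v` lists the out-neighbours
of `v`, in any order, without repetition. -/
def IsAdjList {n : ℕ} (G : Digraph (Fin n)) (L : Fin n → List (Fin n)) : Prop :=
  ∀ v : Fin n, (L v).Nodup ∧ ∀ u : Fin n, u ∈ L v ↔ G.Adj v u

/-! ### A randomized word RAM

Programs are finite texts in a structured imperative language over integer registers and
integer arrays with random access. An integer may occupy several `w`-bit machine words,
and an operation is charged for all words that take part in it. -/

/-- Binary operations. Comparisons return `1` or `0`. -/
inductive Op where
  | add | sub | mul | div | mod | lt | eq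

/-- The value of a binary operation (`div` and `mod` are Euclidean division with remainder). -/
def Op.eval : Op → ℤ → ℤ → ℤ
  | .add, a, b => a + b
  | .sub, a, b => a - b
  | .mul, a, b => a * b
  | .div, a, b => a / b
  | .mod, a, b => a % b
  | .lt, a, b => if a < b then 1 else 0
  | .eq, a, b => if a = b then 1 else 0

/-- Expressions: constants, registers, array cells, binary operations. -/
inductive Expr where
  | const (c : ℤ)
  | reg (x : ℕ)
  | cell (a : ℕ) (i : Expr)
  | bin (op : Op) (e f : Expr)

/-- Statements (programs). `flip x` puts a fair random bit into the register `x`. -/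
inductive Stmt where
  | skip
  | assign (x : ℕ) (e : Expr)
  | store (a : ℕ) (i e : Expr)
  | flip (x : ℕ)
  | seq (s t : Stmt)
  | ite (b : Expr) (s t : Stmt)
  | while (b : Expr) (s : Stmt)

/-- A state of the machine: the registers, the arrays (array `a` has the cells `mem a 0, mem a 1, …`), and
the number of random bits used so far. -/
structure State where
  reg : ℕ → ℤ
  mem : ℕ → ℕ → ℤ
  used : ℕ

/-- The number of `w`-bit words charged for the integer `z`. -/
def words (w : ℕ) (z : ℤ) : ℕ := Nat.size z.natAbs / w + 1

/-- The value of an expression. -/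
def Expr.eval (σ : State) : Expr → ℤ
  | .const c => c
  | .reg x => σ.reg x
  | .cell a i => σ.mem a (i.eval σ).toNat
  | .bin o e f => o.eval (e.eval σ) (f.eval σ)

/-- The time to evaluate an expression with `w`-bit words. Reading an integer costs its number of words,
an array access costs in addition the number of words of the address, and a binary operation costs
the product of the numbers of words of its operands (schoolbook arithmetic). -/
def Expr.cost (w : ℕ) (σ : State) : Expr → ℕ
  | .const c => words w c
  | .reg x => words w (σ.reg x)
  | .cell a i => i.cost w σ + words w (i.eval σ) + words w (σ.mem a (i.eval σ).toNat)
  | .bin _ e f => e.cost w σ + f.cost w σ + words w (e.eval σ) * words w (f.eval σ)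

/-- `σ` with the register `x` set to `z`. -/
def State.setReg (σ : State) (x : ℕ) (z : ℤ) : State :=
  { σ with reg := Function.update σ.reg x z }

/-- `σ` with the cell `i` of the array `a` set to `z`. -/
def State.setCell (σ : State) (a i : ℕ) (z : ℤ) : State :=
  { σ with mem := Function.update σ.mem a (Function.update (σ.mem a) i z) }

/-- `σ` after the random bit `b` has been put into the register `x`. -/
def State.flip (σ : State) (x : ℕ) (b : Bool) : State :=
  { σ.setReg x (if b then 1 else 0) with used := σ.used + 1 }

/-- `Exec w ω s σ τ t`: with `w`-bit words and with the sequence `ω` of random bits, the statement `s`,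
started in the state `σ`, terminates in the state `τ` after time `t`. -/
inductive Exec (w : ℕ) (ω : ℕ → Bool) : Stmt → State → State → ℕ → Prop where
  | skip (σ : State) : Exec w ω .skip σ σ 1
  | assign (σ : State) (x : ℕ) (e : Expr) :
      Exec w ω (.assign x e) σ (σ.setReg x (e.eval σ)) (1 + e.cost w σ)
  | store (σ : State) (a : ℕ) (i e : Expr) :
      Exec w ω (.store a i e) σ (σ.setCell a (i.eval σ).toNat (e.eval σ))
        (1 + i.cost w σ + e.cost w σ)
  | flip (σ : State) (x : ℕ) : Exec w ω (.flip x) σ (σ.flip x (ω σ.used)) 1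
  | seq {σ τ ρ : State} {s s' : Stmt} {t t' : ℕ} :
      Exec w ω s σ τ t → Exec w ω s' τ ρ t' → Exec w ω (.seq s s') σ ρ (t + t')
  | iteTrue {σ τ : State} {b : Expr} {s s' : Stmt} {t : ℕ} :
      b.eval σ ≠ 0 → Exec w ω s σ τ t → Exec w ω (.ite b s s') σ τ (1 + b.cost w σ + t)
  | iteFalse {σ τ : State} {b : Expr} {s s' : Stmt} {t : ℕ} :
      b.eval σ = 0 → Exec w ω s' σ τ t → Exec w ω (.ite b s s') σ τ (1 + b.cost w σ + t)
  | whileTrue {σ τ ρ : State} {b : Expr} {s : Stmt} {t t' : ℕ} :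
      b.eval σ ≠ 0 → Exec w ω s σ τ t → Exec w ω (.while b s) τ ρ t' →
      Exec w ω (.while b s) σ ρ (1 + b.cost w σ + t + t')
  | whileFalse {σ : State} {b : Expr} {s : Stmt} :
      b.eval σ = 0 → Exec w ω (.while b s) σ σ (1 + b.cost w σ)

/-- The array of the lengths of the adjacency lists. -/
def degArray {n : ℕ} (L : Fin n → List (Fin n)) (i : ℕ) : ℤ :=
  if h : i < n then ((L ⟨i, h⟩).length : ℤ) else 0

/-- The array of the entries of the adjacency lists: entry number `j < n` of the list of the vertex `v`
is in the cell `v * n + j`. -/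
def nbrArray {n : ℕ} (L : Fin n → List (Fin n)) (i : ℕ) : ℤ :=
  if h : i / n < n then ((((L ⟨i / n, h⟩).map Fin.val).getD (i % n) 0 : ℕ) : ℤ) else 0

/-- The initial state: registers `0, 1, 2, 3` hold `n`, `k`, and the numerator and the denominator of `ε`;
arrays `0, 1` hold the adjacency lists of `G`, and arrays `2, 3` those of `H`. All other registers
and cells hold `0`. -/
def inputState {k n : ℕ} (LH : Fin k → List (Fin k)) (LG : Fin n → List (Fin n)) (ε : ℚ) :
    State where
  reg
    | 0 => n
    | 1 => k
    | 2 => ε.num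
    | 3 => ε.den
    | _ => 0
  mem
    | 0 => degArray LG
    | 1 => nbrArray LG
    | 2 => degArray LH
    | 3 => nbrArray LH
    | _ => fun _ => 0
  used := 0

/-- With `w`-bit words and random bits `ω`, the program `P`, started in the state `σ`, stops after time
exactly `t` and outputs the integer `N` (in register `0`). -/
def Outputs (P : Stmt) (w : ℕ) (ω : ℕ → Bool) (σ : State) (N : ℤ) (t : ℕ) : Prop :=
  ∃ τ : State, Exec w ω P σ τ t ∧ τ.reg 0 = N

/-- The law of a sequence of independent fair random bits. -/
noncomputable def coinMeasure : MeasureTheory.Measure (ℕ → Bool) :=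
  MeasureTheory.Measure.infinitePi fun _ : ℕ => (PMF.uniformOfFintype Bool).toMeasure

end SubgraphCounting

set_option linter.unusedSectionVars false

namespace SubgraphCounting

-- Give every vertex of `G` a random row of `k` signs. For a homomorphism `f` from `H` to `G`, take
-- the square of the determinant of the rows of the images. It vanishes if `f` is not injective,
-- since a row is repeated, and it has mean `k!` if `f` is injective. So the sum over all
-- homomorphisms, `detSum`, has mean `k!` times the number of injective homomorphisms, which is `k!
-- * |Aut H| * Sub(H, G)` (`card_injHom`).
--
-- The variance is controlled by the fourth moment of the determinant, at most `k! * (k + 2)! / 2`.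
-- To see this, build the determinant as an exterior product, one random row at a time. If `E` is
-- the product so far, of degree `m`, the squared norm of the next product is a quadratic form in
-- signs, whose matrix is the Gram matrix of the `e_a ∧ E`. Its trace is `(k - m) * |E|^2`, and the
-- anticommutation relations show that its operator norm is at most `|E|^2`. Hence a row multiplies
-- the second moment of the squared norm by at most `(k - m) * (k - m + 2)` (`sum_inn_wedge_sq_le`).
-- By Cauchy-Schwarz the relative second moment of the whole sum is at most `(k + 1) * (k + 2) / 2`,
-- whatever the correlations between different homomorphisms (`sum_detSum_sq_le`). Chebyshev's
-- inequality for about `200 * (k + 1) * (k + 2) / ε^2` independent trials gives relative error `ε /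
-- 2` with probability 99% (`detSum_concentration`), and rounding to the nearest integer at most
-- doubles the error (`abs_round_sub_le`).
--
-- For a single matrix, `detSum` comes from a dynamic program over the vertices of `H`
-- (`table_succ`, `table_last`). After `i` vertices a partial map matters only through its values on
-- the boundary, the placed vertices with a neighbour still to come. The two factors of the squared
-- determinant are expanded row by row, so a state also holds two sets of used columns, which is
-- where `4^k` comes from. In an ordering taken from an optimal path decomposition all boundaries
-- have at most `pw H` vertices (`reach_pathwidth`), so one vertex costs about `n^(pw H + 1) * 4^k *
-- k^2` steps. Such an ordering is found by recursion over the subsets of the vertices of `H`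
-- (`width_eq_max`). The order of the automorphism group comes from the same dynamic program, with
-- `H` as its own target and the identity matrix for the signs (`detSum_single`).
--
-- All of this is carried out by an explicit program, verified with a Hoare logic that counts steps
-- (`WP`). Every stored number has `O(w * (k + 1)^2)` bits, hence `O((k + 1)^2)` words, so that a
-- single step costs a polynomial in `k` independent of `w` (`unitCost_sizeBound_le`).

infixr:60 " ;; " => Stmt.seq

/-! ### Notation for expressions and rules for evaluation -/

instance : Add Expr := ⟨.bin .add⟩
instance : Sub Expr := ⟨.bin .sub⟩
instance : Mul Expr := ⟨.bin .mul⟩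
instance : Div Expr := ⟨.bin .div⟩
instance : Mod Expr := ⟨.bin .mod⟩

/-- The comparison `e < f` as an expression. -/
def Expr.lt (e f : Expr) : Expr := .bin .lt e f

/-- The comparison `e = f` as an expression. -/
def Expr.eq (e f : Expr) : Expr := .bin .eq e f

section EvalLemmas
variable (σ : State) (e f : Expr)
@[simp] theorem Expr.eval_add : (e + f).eval σ = e.eval σ + f.eval σ := rfl
@[simp] theorem Expr.eval_sub : (e - f).eval σ = e.eval σ - f.eval σ := rfl
@[simp] theorem Expr.eval_mul : (e * f).eval σ = e.eval σ * f.eval σ := rfl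
@[simp] theorem Expr.eval_div : (e / f).eval σ = e.eval σ / f.eval σ := rfl
@[simp] theorem Expr.eval_mod : (e % f).eval σ = e.eval σ % f.eval σ := rfl
@[simp] theorem Expr.eval_lt : (e.lt f).eval σ = if e.eval σ < f.eval σ then 1 else 0 := rfl
@[simp] theorem Expr.eval_eq : (e.eq f).eval σ = if e.eval σ = f.eval σ then 1 else 0 := rfl
@[simp] theorem Expr.eval_const (c : ℤ) : (Expr.const c).eval σ = c := rfl
@[simp] theorem Expr.eval_reg (x : ℕ) : (Expr.reg x).eval σ = σ.reg x := rfl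
@[simp] theorem Expr.eval_cell (a : ℕ) (i : Expr) :
    (Expr.cell a i).eval σ = σ.mem a (i.eval σ).toNat := rfl
end EvalLemmas

section StateLemmas
variable (σ : State)
@[simp] theorem State.setReg_reg (x y : ℕ) (z : ℤ) :
    (σ.setReg x z).reg y = if y = x then z else σ.reg y := by
  simp [State.setReg, Function.update_apply]
@[simp] theorem State.setReg_mem (x : ℕ) (z : ℤ) : (σ.setReg x z).mem = σ.mem := rfl
@[simp] theorem State.setReg_used (x : ℕ) (z : ℤ) : (σ.setReg x z).used = σ.used := rfl
@[simp] theorem State.setCell_reg (a i : ℕ) (z : ℤ) : (σ.setCell a i z).reg = σ.reg := rfl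
@[simp] theorem State.setCell_used (a i : ℕ) (z : ℤ) : (σ.setCell a i z).used = σ.used := rfl
@[simp] theorem State.setCell_mem (a i b : ℕ) (z : ℤ) :
    (σ.setCell a i z).mem b = if b = a then Function.update (σ.mem a) i z else σ.mem b := by
  simp [State.setCell, Function.update_apply]
@[simp] theorem State.flip_reg (x y : ℕ) (b : Bool) :
    (σ.flip x b).reg y = if y = x then (if b then 1 else 0) else σ.reg y := by
  simp [State.flip, State.setReg, Function.update_apply]
@[simp] theorem State.flip_mem (x : ℕ) (b : Bool) : (σ.flip x b).mem = σ.mem := rfl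
@[simp] theorem State.flip_used (x : ℕ) (b : Bool) : (σ.flip x b).used = σ.used + 1 := rfl
end StateLemmas

/-! ### Lengths of values and costs of expressions -/

/-- The number of nodes of an expression. -/
def Expr.size : Expr → ℕ
  | .const _ => 1
  | .reg _ => 1
  | .cell _ i => i.size + 1
  | .bin _ e f => e.size + f.size + 1

/-- All constants of the expression are small. -/
def Expr.small : Expr → Bool
  | .const c => decide (c.natAbs < 256)
  | .reg _ => true
  | .cell _ i => i.small
  | .bin _ e f => e.small && f.small

/-- The expression has at most 100 nodes and only small constants. -/
def Expr.fits (e : Expr) : Bool := decide (e.size ≤ 100) && e.small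

/-- All registers and cells have at most `B + 8` bits. -/
def Bdd (B : ℕ) (σ : State) : Prop :=
  (∀ x, (σ.reg x).natAbs < 2 ^ (B + 8)) ∧ ∀ a i, (σ.mem a i).natAbs < 2 ^ (B + 8)

theorem natSize_mul_le (a b : ℕ) : Nat.size (a * b) ≤ Nat.size a + Nat.size b := by
  rw [Nat.size_le, pow_add]
  exact Nat.mul_lt_mul'' (Nat.lt_size_self a) (Nat.lt_size_self b)

theorem natSize_add_le (a b : ℕ) : Nat.size (a + b) ≤ Nat.size a + Nat.size b + 1 := by
  rw [Nat.size_le, pow_succ, pow_add]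
  have h1 := Nat.lt_size_self a
  have h2 := Nat.lt_size_self b
  have h3 : 0 < 2 ^ a.size := by positivity
  have h4 : 0 < 2 ^ b.size := by positivity
  nlinarith

/-- No operation yields more bits than its operands have together, plus one. The extra bit per node
turns `B + 8` into `B + 9`. Intermediate values may exceed the bound on stored numbers; only their
cost matters. -/
theorem Expr.natSize_eval_le {B : ℕ} {σ : State} (hσ : Bdd B σ) (e : Expr) (he : e.small) :
    Nat.size (e.eval σ).natAbs ≤ e.size * (B + 9) := by
  induction e with
  | const c =>
    simp only [Expr.small, decide_eq_true_eq] at he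
    have : Nat.size c.natAbs ≤ 8 := Nat.size_le.2 he
    simp only [Expr.eval, Expr.size]; omega
  | reg x =>
    have := Nat.size_le.2 (hσ.1 x)
    simp only [Expr.eval, Expr.size]; omega
  | cell a i ih =>
    have := Nat.size_le.2 (hσ.2 a (i.eval σ).toNat)
    simp only [Expr.eval, Expr.size]; nlinarith
  | bin o e f ihe ihf =>
    simp only [Expr.small, Bool.and_eq_true] at he
    have h1 := ihe he.1
    have h2 := ihf he.2
    simp only [Expr.eval, Expr.size]
    set x := e.eval σ
    set y := f.eval σ
    have key : Nat.size (o.eval x y).natAbs ≤ Nat.size x.natAbs + Nat.size y.natAbs + 1 := by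
      cases o with
      | add =>
        exact (Nat.size_le_size (Int.natAbs_add_le x y)).trans (natSize_add_le _ _)
      | sub =>
        exact (Nat.size_le_size (Int.natAbs_sub_le x y)).trans (natSize_add_le _ _)
      | mul =>
        simp only [Op.eval, Int.natAbs_mul]
        exact (natSize_mul_le _ _).trans (by omega)
      | div =>
        have : Nat.size (x / y).natAbs ≤ Nat.size x.natAbs :=
          Nat.size_le_size (Int.natAbs_ediv_le_natAbs x y)
        simp only [Op.eval]; omega
      | mod =>
        simp only [Op.eval]
        rcases eq_or_ne y 0 with hy | hy
        · simp [hy]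
        · have h0 := Int.emod_nonneg x hy
          have h3 := Int.emod_lt_abs x hy
          have : Nat.size (x % y).natAbs ≤ Nat.size y.natAbs := Nat.size_le_size (by
            zify; rw [abs_of_nonneg h0]; exact h3.le)
          omega
      | lt =>
        simp only [Op.eval]; split_ifs <;> simp
      | eq =>
        simp only [Op.eval]; split_ifs <;> simp
    nlinarith

theorem words_le {w b s : ℕ} {z : ℤ} (hs : 1 ≤ s) (h : Nat.size z.natAbs ≤ s * b) :
    words w z ≤ s * (b / w + 1) := by
  unfold words
  have h1 : Nat.size z.natAbs / w < s * (b / w + 1) := by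
    rcases Nat.eq_zero_or_pos w with rfl | hw
    · simp; omega
    rw [Nat.div_lt_iff_lt_mul hw]
    have h2 : b < (b / w + 1) * w := by
      have := Nat.div_add_mod b w
      have := Nat.mod_lt b hw
      nlinarith
    calc _ ≤ s * b := h
      _ < s * ((b / w + 1) * w) := by nlinarith
      _ = _ := by ring
  omega

theorem Expr.size_pos (e : Expr) : 1 ≤ e.size := by
  cases e <;> simp [Expr.size]

/-- The number of words of a stored number. -/
def wordBound (w B : ℕ) : ℕ := (B + 9) / w + 1

/-- The lengths of the operands are linear in the sizes of the subexpressions, so an operation costs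
a product of sizes, and `e^2 + f^2 + e * f ≤ (e + f + 1)^2`. -/
theorem Expr.cost_le {w B : ℕ} {σ : State} (hσ : Bdd B σ) (e : Expr) (he : e.small) :
    e.cost w σ ≤ e.size ^ 2 * wordBound w B ^ 2 := by
  have hK : 1 ≤ wordBound w B := by simp [wordBound]
  induction e with
  | const c =>
    have := words_le (w := w) (Expr.size_pos _) (Expr.natSize_eval_le hσ (.const c) he)
    simp only [Expr.eval, Expr.size, Expr.cost] at *
    change _ ≤ 1 * wordBound w B at this
    nlinarith
  | reg x =>
    have := words_le (w := w) (Expr.size_pos _) (Expr.natSize_eval_le hσ (.reg x) he)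
    simp only [Expr.eval, Expr.size, Expr.cost] at *
    change _ ≤ 1 * wordBound w B at this
    nlinarith
  | cell a i ih =>
    have h1 := ih he
    have h2 := words_le (w := w) (Expr.size_pos _) (Expr.natSize_eval_le hσ i he)
    have h3 : words w (σ.mem a (i.eval σ).toNat) ≤ 1 * wordBound w B :=
      words_le le_rfl (by
        have := Nat.size_le.2 (hσ.2 a (i.eval σ).toNat)
        omega)
    simp only [Expr.size, Expr.cost]
    change _ ≤ i.size * wordBound w B at h2
    have := Expr.size_pos i
    nlinarith [mul_le_mul_right hK (i.size * wordBound w B)]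
  | bin o e f ihe ihf =>
    simp only [Expr.small, Bool.and_eq_true] at he
    have h1 := ihe he.1
    have h2 := ihf he.2
    have h3 := words_le (w := w) (Expr.size_pos _) (Expr.natSize_eval_le hσ e he.1)
    have h4 := words_le (w := w) (Expr.size_pos _) (Expr.natSize_eval_le hσ f he.2)
    simp only [Expr.size, Expr.cost]
    change _ ≤ e.size * wordBound w B at h3
    change _ ≤ f.size * wordBound w B at h4
    calc _ ≤ e.size ^ 2 * wordBound w B ^ 2 + f.size ^ 2 * wordBound w B ^ 2
          + (e.size * wordBound w B) * (f.size * wordBound w B) := by gcongr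
      _ = (e.size ^ 2 + f.size ^ 2 + e.size * f.size) * wordBound w B ^ 2 := by ring
      _ ≤ _ := by
        gcongr
        nlinarith

/-- An upper bound on the time of a single elementary step. -/
def unitCost (w B : ℕ) : ℕ := 1 + 20000 * wordBound w B ^ 2

theorem Expr.fits_small {e : Expr} (he : e.fits) : e.small := by
  simp only [Expr.fits, Bool.and_eq_true] at he; exact he.2

/-- An elementary step evaluates at most two expressions (the address and the value of a store),
each with at most 100 nodes. This gives the `2 * 100^2` in `unitCost`. -/
theorem Expr.cost_le_of_fits {w B : ℕ} {σ : State} (hσ : Bdd B σ) {e : Expr} (he : e.fits) :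
    e.cost w σ ≤ 10000 * wordBound w B ^ 2 := by
  have h := Expr.cost_le (w := w) hσ e (Expr.fits_small he)
  simp only [Expr.fits, Bool.and_eq_true, decide_eq_true_eq] at he
  refine h.trans ?_
  gcongr
  nlinarith [he.1]

/-! ### What a program leaves unchanged -/

/-- The registers that a program may change. -/
def Stmt.wr : Stmt → List ℕ
  | .skip => []
  | .assign x _ => [x]
  | .store _ _ _ => []
  | .flip x => [x]
  | .seq s t => s.wr ++ t.wr
  | .ite _ s t => s.wr ++ t.wr
  | .while _ s => s.wr

/-- The arrays that a program may change. -/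
def Stmt.wm : Stmt → List ℕ
  | .skip => []
  | .assign _ _ => []
  | .store a _ _ => [a]
  | .flip _ => []
  | .seq s t => s.wm ++ t.wm
  | .ite _ s t => s.wm ++ t.wm
  | .while _ s => s.wm

/-- The program draws no random bits. -/
def Stmt.det : Stmt → Bool
  | .skip => true
  | .assign _ _ => true
  | .store _ _ _ => true
  | .flip _ => false
  | .seq s t => s.det && t.det
  | .ite _ s t => s.det && t.det
  | .while _ s => s.det

/-- The states agree except for the given registers and arrays. -/
structure Agree (R A : List ℕ) (d : Bool) (σ τ : State) : Prop where
  reg : ∀ x, x ∉ R → τ.reg x = σ.reg x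
  mem : ∀ a, a ∉ A → τ.mem a = σ.mem a
  used : d = true → τ.used = σ.used

theorem Agree.refl (R A : List ℕ) (d : Bool) (σ : State) : Agree R A d σ σ :=
  ⟨fun _ _ => rfl, fun _ _ => rfl, fun _ => rfl⟩

theorem Agree.trans {R A : List ℕ} {d : Bool} {σ τ ρ : State} (h : Agree R A d σ τ)
    (h' : Agree R A d τ ρ) : Agree R A d σ ρ :=
  ⟨fun x hx => (h'.reg x hx).trans (h.reg x hx), fun a ha => (h'.mem a ha).trans (h.mem a ha),
    fun hd => (h'.used hd).trans (h.used hd)⟩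

theorem Agree.mono {R A R' A' : List ℕ} {d d' : Bool} {σ τ : State} (h : Agree R A d σ τ)
    (hR : R ⊆ R') (hA : A ⊆ A') (hd : d' = true → d = true) : Agree R' A' d' σ τ :=
  ⟨fun x hx => h.reg x fun hx' => hx (hR hx'), fun a ha => h.mem a fun ha' => ha (hA ha'),
    fun h' => h.used (hd h')⟩

/-- The frame rule: the written registers and arrays can be read off from the program text, so for
concrete programs mostly `decide` settles what survives a subprogram. -/
theorem Exec.agree {w : ℕ} {ω : ℕ → Bool} {s : Stmt} {σ τ : State} {t : ℕ}
    (h : Exec w ω s σ τ t) : Agree s.wr s.wm s.det σ τ := by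
  induction h with
  | skip σ => exact Agree.refl _ _ _ _
  | assign σ x e =>
    exact ⟨fun y hy => by simp [Stmt.wr] at hy; simp [hy], fun _ _ => rfl, fun _ => rfl⟩
  | store σ a i e =>
    exact ⟨fun y hy => rfl, fun b hb => by simp [Stmt.wm] at hb; simp [hb], fun _ => rfl⟩
  | flip σ x =>
    exact ⟨fun y hy => by simp [Stmt.wr] at hy; simp [hy], fun _ _ => rfl,
      fun h => by simp [Stmt.det] at h⟩
  | seq _ _ ih1 ih2 =>
    exact (ih1.mono (by simp [Stmt.wr]) (by simp [Stmt.wm]) (by simp +contextual [Stmt.det])).trans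
      (ih2.mono (by simp [Stmt.wr]) (by simp [Stmt.wm]) (by simp [Stmt.det]))
  | iteTrue _ _ ih =>
    exact ih.mono (by simp [Stmt.wr]) (by simp [Stmt.wm]) (by simp +contextual [Stmt.det])
  | iteFalse _ _ ih =>
    exact ih.mono (by simp [Stmt.wr]) (by simp [Stmt.wm]) (by simp [Stmt.det])
  | whileTrue _ _ _ ih1 ih2 =>
    exact (ih1.mono (by simp [Stmt.wr]) (by simp [Stmt.wm]) (by simp [Stmt.det])).trans ih2
  | whileFalse _ => exact Agree.refl _ _ _ _

/-! ### A Hoare logic for total correctness that counts elementary steps -/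

/-- From the state `σ`, if it is bounded, the program reaches a bounded state with `Q` after at most `m`
elementary steps. -/
def WP (w : ℕ) (ω : ℕ → Bool) (B : ℕ) (s : Stmt) (m : ℕ) (Q : State → Prop) (σ : State) : Prop :=
  Bdd B σ → ∃ τ t, Exec w ω s σ τ t ∧ Bdd B τ ∧ Q τ ∧ t ≤ m * unitCost w B

section Rules
variable {w : ℕ} {ω : ℕ → Bool} {B : ℕ} {σ : State} {Q : State → Prop}

theorem WP.mono {s : Stmt} {m m' : ℕ} {Q' : State → Prop} (h : WP w ω B s m Q σ) (hm : m ≤ m')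
    (hQ : ∀ τ, Bdd B τ → Q τ → Q' τ) : WP w ω B s m' Q' σ := by
  intro hσ
  obtain ⟨τ, t, h1, h2, h3, h4⟩ := h hσ
  exact ⟨τ, t, h1, h2, hQ τ h2 h3, h4.trans (Nat.mul_le_mul_right _ hm)⟩

theorem WP.le {s : Stmt} {m m' : ℕ} (h : WP w ω B s m Q σ) (hm : m ≤ m') : WP w ω B s m' Q σ :=
  h.mono hm fun _ _ h => h

theorem WP.of_bdd {s : Stmt} {m : ℕ} (h : Bdd B σ → WP w ω B s m Q σ) : WP w ω B s m Q σ :=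
  fun hσ => h hσ hσ

theorem WP.agree {s : Stmt} {m : ℕ} (h : WP w ω B s m Q σ) :
    WP w ω B s m (fun τ => Agree s.wr s.wm s.det σ τ ∧ Q τ) σ := by
  intro hσ
  obtain ⟨τ, t, h1, h2, h3, h4⟩ := h hσ
  exact ⟨τ, t, h1, h2, ⟨h1.agree, h3⟩, h4⟩

theorem one_le_unitCost (w B : ℕ) : 1 ≤ unitCost w B := by simp [unitCost]

theorem WP.skip (h : Q σ) : WP w ω B .skip 1 Q σ := fun hσ =>
  ⟨σ, 1, .skip σ, hσ, h, by simpa using one_le_unitCost w B⟩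

theorem Bdd.setReg (hσ : Bdd B σ) {z : ℤ} (hz : z.natAbs < 2 ^ (B + 8)) (x : ℕ) :
    Bdd B (σ.setReg x z) :=
  ⟨fun y => by simp only [State.setReg_reg]; split_ifs; exacts [hz, hσ.1 y], hσ.2⟩

theorem WP.assign {x : ℕ} {e : Expr} (z : ℤ) (hz : e.eval σ = z) (he : e.fits)
    (hb : z.natAbs < 2 ^ (B + 8)) (h : Q (σ.setReg x z)) : WP w ω B (.assign x e) 1 Q σ := by
  intro hσ
  refine ⟨_, _, .assign σ x e, hz ▸ hσ.setReg hb x, hz ▸ h, ?_⟩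
  have := Expr.cost_le_of_fits (w := w) hσ he
  unfold unitCost; omega

theorem WP.store {a : ℕ} {i e : Expr} (j : ℕ) (z : ℤ) (hj : i.eval σ = j) (hz : e.eval σ = z)
    (hi : i.fits) (he : e.fits)
    (hb : z.natAbs < 2 ^ (B + 8)) (h : Q (σ.setCell a j z)) :
    WP w ω B (.store a i e) 1 Q σ := by
  intro hσ
  have hx := Exec.store (w := w) (ω := ω) σ a i e
  rw [hj, hz, Int.toNat_natCast] at hx
  refine ⟨_, _, hx, ⟨hσ.1, fun b l => ?_⟩, h, ?_⟩
  · rw [State.setCell_mem]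
    split_ifs
    · rw [Function.update_apply]
      split_ifs
      exacts [hb, hσ.2 a l]
    · exact hσ.2 b l
  have h1 := Expr.cost_le_of_fits (w := w) hσ he
  have h2 := Expr.cost_le_of_fits (w := w) hσ hi
  unfold unitCost; omega

theorem WP.flip {x : ℕ} (h : Q (σ.flip x (ω σ.used))) : WP w ω B (.flip x) 1 Q σ := by
  intro hσ
  refine ⟨_, _, .flip σ x, ⟨fun y => ?_, hσ.2⟩, h, by simpa using one_le_unitCost w B⟩
  have h1 : 1 < 2 ^ (B + 8) := Nat.one_lt_two_pow (by omega)
  rw [State.flip_reg]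
  split_ifs
  · simp
  · simp
  · exact hσ.1 y

theorem WP.seq {s s' : Stmt} {m m' : ℕ} (h : WP w ω B s m (fun τ => WP w ω B s' m' Q τ) σ) :
    WP w ω B (s ;; s') (m + m') Q σ := by
  intro hσ
  obtain ⟨τ, t, h1, h2, h3, h4⟩ := h hσ
  obtain ⟨ρ, t', h1', h2', h3', h4'⟩ := h3 h2
  exact ⟨ρ, _, h1.seq h1', h2', h3', by rw [add_mul]; omega⟩

/-- Sequential composition in which the second part may use what the first part leaves unchanged. -/
theorem WP.seq_agree {s s' : Stmt} {m m' : ℕ} {Q' : State → Prop} (h : WP w ω B s m Q' σ)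
    (h' : ∀ τ, Bdd B τ → Agree s.wr s.wm s.det σ τ → Q' τ → WP w ω B s' m' Q τ) :
    WP w ω B (s ;; s') (m + m') Q σ :=
  WP.seq (h.agree.mono le_rfl fun τ hτ h1 => h' τ hτ h1.1 h1.2)

theorem WP.assign_seq {x : ℕ} {e : Expr} {s : Stmt} {m : ℕ} (z : ℤ) (hz : e.eval σ = z)
    (he : e.fits) (hb : z.natAbs < 2 ^ (B + 8)) (h : WP w ω B s m Q (σ.setReg x z)) :
    WP w ω B (.assign x e ;; s) (m + 1) Q σ := by
  rw [add_comm]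
  exact WP.seq (WP.assign z hz he hb h)

theorem WP.store_seq {a : ℕ} {i e : Expr} {s : Stmt} {m : ℕ} (j : ℕ) (z : ℤ) (hj : i.eval σ = j)
    (hz : e.eval σ = z) (hi : i.fits) (he : e.fits)
    (hb : z.natAbs < 2 ^ (B + 8)) (h : WP w ω B s m Q (σ.setCell a j z)) :
    WP w ω B (.store a i e ;; s) (m + 1) Q σ := by
  rw [add_comm]
  exact WP.seq (WP.store j z hj hz hi he hb h)

theorem WP.ite {b : Expr} {s s' : Stmt} {m : ℕ} (hb : b.fits)
    (h : b.eval σ ≠ 0 → WP w ω B s m Q σ) (h' : b.eval σ = 0 → WP w ω B s' m Q σ) :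
    WP w ω B (.ite b s s') (m + 1) Q σ := by
  intro hσ
  have hc := Expr.cost_le_of_fits (w := w) hσ hb
  by_cases hz : b.eval σ = 0
  · obtain ⟨τ, t, h1, h2, h3, h4⟩ := h' hz hσ
    refine ⟨τ, _, .iteFalse hz h1, h2, h3, ?_⟩
    rw [add_mul]; unfold unitCost at *; omega
  · obtain ⟨τ, t, h1, h2, h3, h4⟩ := h hz hσ
    refine ⟨τ, _, .iteTrue hz h1, h2, h3, ?_⟩
    rw [add_mul]; unfold unitCost at *; omega

/-- `for i := 0, …, (register b) - 1`. -/
def Stmt.for (i b : ℕ) (s : Stmt) : Stmt :=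
  .assign i (.const 0) ;;
    .while ((Expr.reg i).lt (.reg b)) (s ;; .assign i (.reg i + .const 1))

/-- Each round pays for the test, the body and the increment; the final `+ 2` pays for the
initialisation and the last test. The invariant must not depend on the counter register, because the
counter is reset before the loop and increased after the body. The induction is on the number of
remaining rounds. -/
theorem WP.for {i b : ℕ} {s : Stmt} (N m : ℕ) (I : ℕ → State → Prop)
    (hN : σ.reg b = N) (hb : b ∉ i :: s.wr) (hi : i ∉ s.wr)
    (hI : ∀ j τ z, I j τ → I j (τ.setReg i z))
    (h0 : I 0 σ)
    (hs : ∀ j τ, j < N → Bdd B τ → Agree (i :: s.wr) s.wm s.det σ τ → τ.reg i = j → I j τ →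
      WP w ω B s m (I (j + 1)) τ)
    (hQ : ∀ τ, Bdd B τ → Agree (i :: s.wr) s.wm s.det σ τ → I N τ → Q τ) :
    WP w ω B (.for i b s) (N * (m + 2) + 2) Q σ := by
  have hwhile : ∀ l j τ, j + l = N → Bdd B τ → Agree (i :: s.wr) s.wm s.det σ τ → τ.reg i = j →
      I j τ → WP w ω B (.while ((Expr.reg i).lt (.reg b)) (s ;; .assign i (.reg i + .const 1)))
        (l * (m + 2) + 1) Q τ := by
    intro l
    induction l with
    | zero =>
      intro j τ hj hτ hA hr hI' _
      have hbn : τ.reg b = N := by rw [hA.reg b hb, hN]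
      have hz : ((Expr.reg i).lt (.reg b)).eval τ = 0 := by
        simp [hr, hbn]; omega
      have hc : ((Expr.reg i).lt (.reg b)).cost w τ ≤ 10000 * wordBound w B ^ 2 :=
        Expr.cost_le_of_fits (w := w) hτ (by rfl)
      refine ⟨τ, _, .whileFalse hz, hτ, hQ τ hτ hA ?_, ?_⟩
      · obtain rfl : j = N := by omega
        exact hI'
      · unfold unitCost; omega
    | succ l ih =>
      intro j τ hj hτ hA hr hI' _
      have hbn : τ.reg b = N := by rw [hA.reg b hb, hN]
      have hz : ((Expr.reg i).lt (.reg b)).eval τ ≠ 0 := by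
        simp [hr, hbn]; omega
      have hc : ((Expr.reg i).lt (.reg b)).cost w τ ≤ 10000 * wordBound w B ^ 2 :=
        Expr.cost_le_of_fits (w := w) hτ (by rfl)
      have hbody : WP w ω B (s ;; .assign i (.reg i + .const 1)) (m + 1)
          (fun ρ => Agree (i :: s.wr) s.wm s.det σ ρ ∧ ρ.reg i = (j + 1 : ℕ) ∧ I (j + 1) ρ) τ := by
        refine WP.seq_agree (hs j τ (by omega) hτ hA hr hI') fun ρ hρ hA' hI'' => ?_
        have hri : ρ.reg i = j := by rw [hA'.reg i hi, hr]
        refine WP.assign (j + 1 : ℕ) (by simp [hri]) rfl ?_ ⟨?_, by simp, hI _ _ _ hI''⟩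
        -- The increased counter is at most `N`, which fits since register `b` holds it.
        · have := hτ.1 b
          rw [hbn] at this
          simp only [Int.natAbs_natCast] at *
          omega
        · refine hA.trans ⟨fun x hx => ?_, fun a ha => hA'.mem a ha, fun hd => hA'.used hd⟩
          rw [List.mem_cons, not_or] at hx
          simp [hx.1, hA'.reg x hx.2]
      obtain ⟨ρ, t, h1, h2, ⟨h3, h4, h5⟩, h6⟩ := hbody hτ
      obtain ⟨ξ, t', h1', h2', h3', h4'⟩ := ih (j + 1) ρ (by omega) h2 h3 h4 h5 h2
      refine ⟨ξ, _, .whileTrue hz h1 h1', h2', h3', ?_⟩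
      have : ((l + 1) * (m + 2) + 1) * unitCost w B
          = (m + 1) * unitCost w B + (l * (m + 2) + 1) * unitCost w B + unitCost w B := by ring
      rw [this]
      unfold unitCost at *; omega
  refine WP.of_bdd fun hσ => ?_
  have h0' : (0 : ℤ).natAbs < 2 ^ (B + 8) := by simp
  rw [show N * (m + 2) + 2 = (N * (m + 2) + 1) + 1 by ring]
  refine WP.assign_seq 0 rfl rfl h0' (hwhile N 0 _ (by omega) (hσ.setReg h0' i) ?_ (by simp) ?_)
  · exact ⟨fun x hx => by simp at hx; simp [hx.1], fun _ _ => rfl, fun _ => rfl⟩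
  · exact hI 0 σ 0 h0

end Rules

/-! ### Exterior products of random sign vectors -/

section Fock
variable {ι : Type*} [Fintype ι] [LinearOrder ι]

/-- The sign of moving `a` past the larger elements of `P`. -/
def moveSign (P : Finset ι) (a : ι) : ℤ := ∏ b ∈ P, if a < b then -1 else 1

theorem moveSign_mul_self (P : Finset ι) (a : ι) : moveSign P a * moveSign P a = 1 := by
  unfold moveSign
  rw [← Finset.prod_mul_distrib]
  exact Finset.prod_eq_one fun b _ => by split_ifs <;> norm_num

theorem moveSign_insert {P : Finset ι} {a b : ι} (h : b ∉ P) :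
    moveSign (insert b P) a = (if a < b then -1 else 1) * moveSign P a := by
  unfold moveSign; rw [Finset.prod_insert h]

theorem moveSign_insert_self (P : Finset ι) (a : ι) : moveSign (insert a P) a = moveSign P a := by
  by_cases h : a ∈ P
  · rw [Finset.insert_eq_of_mem h]
  · rw [moveSign_insert h]; simp

theorem moveSign_erase_self (P : Finset ι) (a : ι) : moveSign (P.erase a) a = moveSign P a := by
  by_cases h : a ∈ P
  · conv_rhs => rw [← Finset.insert_erase h]
    rw [moveSign_insert_self]
  · rw [Finset.erase_eq_of_notMem h]

theorem moveSign_erase {P : Finset ι} {a b : ι} (h : b ∈ P) :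
    moveSign (P.erase b) a = (if a < b then -1 else 1) * moveSign P a := by
  conv_rhs => rw [← Finset.insert_erase h, moveSign_insert (Finset.notMem_erase b P), ← mul_assoc]
  split_ifs <;> simp

/-- The creation operator. -/
def create (a : ι) (E : Finset ι → ℤ) (P : Finset ι) : ℤ :=
  if a ∈ P then moveSign P a * E (P.erase a) else 0

/-- The annihilation operator. -/
def annihilate (a : ι) (E : Finset ι → ℤ) (P : Finset ι) : ℤ :=
  if a ∈ P then 0 else moveSign P a * E (insert a P)

/-- The exterior product with a vector. -/
def wedge (x : ι → ℤ) (E : Finset ι → ℤ) (P : Finset ι) : ℤ := ∑ a, x a * create a E P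

/-- The interior product with a vector. -/
def contract (x : ι → ℤ) (E : Finset ι → ℤ) (P : Finset ι) : ℤ := ∑ a, x a * annihilate a E P

/-- The inner product. -/
def inn (E F : Finset ι → ℤ) : ℤ := ∑ P, E P * F P

theorem inn_self_nonneg (E : Finset ι → ℤ) : 0 ≤ inn E E :=
  Finset.sum_nonneg fun P _ => mul_self_nonneg (E P)

theorem inn_comm (E F : Finset ι → ℤ) : inn E F = inn F E :=
  Finset.sum_congr rfl fun _ _ => mul_comm _ _

/-- Creation and annihilation are adjoint: removing `a` is a bijection from the sets with `a` to the
sets without `a`, and the sign does not notice `a` itself. -/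
theorem inn_create (a : ι) (E F : Finset ι → ℤ) :
    inn (create a E) F = inn E (annihilate a F) := by
  have h1 : inn (create a E) F
      = ∑ P with a ∈ P, moveSign P a * E (P.erase a) * F P := by
    simp only [inn, create, ite_mul, zero_mul, Finset.sum_filter]
  have h2 : inn E (annihilate a F)
      = ∑ P with a ∉ P, E P * (moveSign P a * F (insert a P)) := by
    simp only [inn, annihilate, mul_ite, mul_zero, Finset.sum_filter, ite_not]
  rw [h1, h2]
  refine Finset.sum_nbij' (fun P => P.erase a) (fun P => insert a P) ?_ ?_ ?_ ?_ ?_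
  · simp
  · simp
  · intro P hP
    exact Finset.insert_erase (by simpa using hP)
  · intro P hP
    exact Finset.erase_insert (by simpa using hP)
  · intro P hP
    rw [Finset.insert_erase (by simpa using hP), moveSign_erase_self]; ring

theorem annihilate_create_self (a : ι) (E : Finset ι → ℤ) (P : Finset ι) :
    annihilate a (create a E) P = if a ∈ P then 0 else E P := by
  unfold annihilate
  split_ifs with h
  · rfl
  · rw [create, if_pos (by simp), moveSign_insert_self, ← mul_assoc, moveSign_mul_self, one_mul,
      Finset.erase_insert h]

theorem create_annihilate_self (a : ι) (E : Finset ι → ℤ) (P : Finset ι) :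
    create a (annihilate a E) P = if a ∈ P then E P else 0 := by
  unfold create
  split_ifs with h
  · rw [annihilate, if_neg (by simp), moveSign_erase_self, ← mul_assoc, moveSign_mul_self, one_mul,
      Finset.insert_erase h]
  · rfl

/-- Exactly one of `a < b` and `b < a` holds, so exchanging the two operators changes exactly one of
the two signs. -/
theorem annihilate_create_ne {a b : ι} (hab : a ≠ b) (E : Finset ι → ℤ) (P : Finset ι) :
    annihilate a (create b E) P = - create b (annihilate a E) P := by
  by_cases ha : a ∈ P
  · simp [ha, hab, annihilate, create]
  by_cases hb : b ∈ P
  · rw [annihilate, if_neg ha, create, if_pos (by simp [hb]), create, if_pos hb, annihilate,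
      if_neg (by simp [ha]), moveSign_insert ha, moveSign_erase hb, Finset.erase_insert_of_ne hab]
    rcases lt_or_gt_of_ne hab with h | h
    · rw [if_neg h.not_gt, if_pos h]; ring
    · rw [if_pos h, if_neg h.not_gt]; ring
  · simp [ha, hb, hab.symm, annihilate, create]

theorem create_anticomm (a b : ι) (E : Finset ι → ℤ) (P : Finset ι) :
    create a (create b E) P = - create b (create a E) P := by
  by_cases hab : a = b
  · subst hab; simp [create]
  by_cases ha : a ∈ P
  · by_cases hb : b ∈ P
    · rw [create, if_pos ha, create, if_pos (by simp [hb, Ne.symm hab]), create, if_pos hb, create,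
        if_pos (by simp [ha, hab]), moveSign_erase ha, moveSign_erase hb, Finset.erase_right_comm]
      rcases lt_or_gt_of_ne hab with h | h
      · rw [if_neg h.not_gt, if_pos h]; ring
      · rw [if_pos h, if_neg h.not_gt]; ring
    · simp [hb, create]
  · simp [ha, create]

theorem create_wedge (a : ι) (x : ι → ℤ) (E : Finset ι → ℤ) (P : Finset ι) :
    create a (wedge x E) P = ∑ b, x b * create a (create b E) P := by
  by_cases h : a ∈ P
  · rw [create, if_pos h, wedge, Finset.mul_sum]
    refine Finset.sum_congr rfl fun b _ => ?_
    rw [show create a (create b E) P = moveSign P a * create b E (P.erase a) from if_pos h]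
    ring
  · rw [create, if_neg h]
    symm
    refine Finset.sum_eq_zero fun b _ => ?_
    rw [create, if_neg h, mul_zero]

theorem wedge_anticomm (x y : ι → ℤ) (E : Finset ι → ℤ) (P : Finset ι) :
    wedge x (wedge y E) P = - wedge y (wedge x E) P := by
  conv_lhs => rw [wedge]
  conv_rhs => rw [wedge]
  simp only [create_wedge, Finset.mul_sum]
  rw [Finset.sum_comm, ← Finset.sum_neg_distrib]
  refine Finset.sum_congr rfl fun a _ => ?_
  rw [← Finset.sum_neg_distrib]
  refine Finset.sum_congr rfl fun b _ => ?_
  rw [create_anticomm]; ring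

theorem wedge_self (x : ι → ℤ) (E : Finset ι → ℤ) (P : Finset ι) : wedge x (wedge x E) P = 0 := by
  have := wedge_anticomm x x E P
  omega

theorem wedge_congr {E F : Finset ι → ℤ} (x : ι → ℤ) (h : ∀ P, E P = F P) : wedge x E = wedge x F := by
  rw [funext h]

/-- The Gram matrix of the vectors `e_a ∧ E`. -/
def gram (E : Finset ι → ℤ) (a b : ι) : ℤ := inn (create a E) (create b E)

theorem gram_comm (E : Finset ι → ℤ) (a b : ι) : gram E a b = gram E b a := inn_comm _ _

theorem inn_wedge_wedge (x : ι → ℤ) (E : Finset ι → ℤ) :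
    inn (wedge x E) (wedge x E) = ∑ a, ∑ b, gram E a b * (x a * x b) := by
  have h : ∀ P, wedge x E P * wedge x E P
      = ∑ a, ∑ b, create a E P * create b E P * (x a * x b) := by
    intro P
    rw [wedge, Finset.sum_mul_sum]
    refine Finset.sum_congr rfl fun a _ => Finset.sum_congr rfl fun b _ => ?_
    ring
  simp only [gram, inn, h, Finset.sum_mul]
  rw [Finset.sum_comm]
  refine Finset.sum_congr rfl fun a _ => ?_
  rw [Finset.sum_comm]

theorem inn_contract_contract (x : ι → ℤ) (E : Finset ι → ℤ) :
    inn (contract x E) (contract x E)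
      = ∑ a, ∑ b, inn (annihilate a E) (annihilate b E) * (x a * x b) := by
  have h : ∀ P, contract x E P * contract x E P
      = ∑ a, ∑ b, annihilate a E P * annihilate b E P * (x a * x b) := by
    intro P
    rw [contract, Finset.sum_mul_sum]
    refine Finset.sum_congr rfl fun a _ => Finset.sum_congr rfl fun b _ => ?_
    ring
  simp only [inn, h, Finset.sum_mul]
  rw [Finset.sum_comm]
  refine Finset.sum_congr rfl fun a _ => ?_
  rw [Finset.sum_comm]

/-- The canonical anticommutation relation (annihilate `a` after create `b`, plus the reverse order,
is the identity if `a = b` and `0` otherwise), paired with `E`. -/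
theorem gram_eq (E : Finset ι → ℤ) (a b : ι) :
    gram E a b = (if a = b then inn E E else 0) - inn (annihilate b E) (annihilate a E) := by
  rw [gram, inn_create]
  have h : inn (annihilate b E) (annihilate a E) = inn E (create b (annihilate a E)) := by
    rw [inn_comm E, inn_create, inn_comm]
  rw [h]
  by_cases hab : a = b
  · subst hab
    rw [if_pos rfl]
    simp only [inn, ← Finset.sum_sub_distrib]
    refine Finset.sum_congr rfl fun P _ => ?_
    rw [annihilate_create_self, create_annihilate_self]
    split_ifs <;> ring
  · rw [if_neg hab]
    simp only [inn, annihilate_create_ne hab]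
    simp

/-- By `gram_eq` the squared norms of the exterior and of the interior product with `x` add up to
`|x|^2 * |E|^2`, and the second of them is nonnegative. So the Gram matrix has operator norm at most
`|E|^2`. -/
theorem inn_wedge_le (x : ι → ℤ) (E : Finset ι → ℤ) :
    inn (wedge x E) (wedge x E) ≤ (∑ a, x a ^ 2) * inn E E := by
  have h := inn_self_nonneg (contract x E)
  rw [inn_contract_contract] at h
  rw [inn_wedge_wedge]
  simp only [gram_eq, sub_mul, Finset.sum_sub_distrib]
  have h1 : ∑ a, ∑ b, (if a = b then inn E E else 0) * (x a * x b) = (∑ a, x a ^ 2) * inn E E := by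
    rw [Finset.sum_mul]
    refine Finset.sum_congr rfl fun a _ => ?_
    simp; ring
  have h2 : ∑ a, ∑ b, inn (annihilate b E) (annihilate a E) * (x a * x b)
      = ∑ a, ∑ b, inn (annihilate a E) (annihilate b E) * (x a * x b) := by
    refine Finset.sum_congr rfl fun a _ => Finset.sum_congr rfl fun b _ => ?_
    rw [inn_comm]
  rw [h1, h2]; linarith

theorem inn_mul_self_le (E F : Finset ι → ℤ) : inn E F ^ 2 ≤ inn E E * inn F F := by
  have := Finset.sum_mul_sq_le_sq_mul_sq Finset.univ E F
  simpa only [inn, sq] using this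

/-- With `v` the row of the Gram matrix at `a`, the left side is the inner product of `v ∧ E` with
`e_a ∧ E`. Cauchy-Schwarz and `inn_wedge_le` bound its square by itself times the right side, and
one factor cancels. -/
theorem sum_gram_sq_le (E : Finset ι → ℤ) (a : ι) :
    ∑ b, gram E a b ^ 2 ≤ inn E E * gram E a a := by
  set v := fun b => gram E a b
  set y := create a E
  have h1 : ∑ b, v b ^ 2 = inn (wedge v E) y := by
    simp only [inn, wedge, Finset.sum_mul]
    rw [Finset.sum_comm]
    refine Finset.sum_congr rfl fun b _ => ?_
    rw [sq]
    conv_lhs => rw [show v b = inn y (create b E) from rfl]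
    simp only [inn, Finset.sum_mul]
    refine Finset.sum_congr rfl fun P _ => ?_
    change _ = inn y (create b E) * _ * _
    simp only [inn]; ring
  have h2 := inn_mul_self_le (wedge v E) y
  rw [← h1] at h2
  have h3 := inn_wedge_le v E
  have h4 : 0 ≤ inn y y := inn_self_nonneg y
  have h5 : 0 ≤ inn E E := inn_self_nonneg E
  have h6 : (∑ b, v b ^ 2) ^ 2 ≤ (∑ b, v b ^ 2) * (inn E E * inn y y) := by
    nlinarith [mul_le_mul_of_nonneg_right h3 h4]
  change ∑ b, v b ^ 2 ≤ inn E E * inn y y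
  have h7 : 0 ≤ ∑ b, v b ^ 2 := Finset.sum_nonneg fun b _ => sq_nonneg _
  rcases h7.eq_or_lt with h | h
  · rw [← h]; positivity
  · rw [sq] at h6
    exact le_of_mul_le_mul_left h6 h

/-- The trace counts, for every basis element of degree `m`, the indices that can still be added to
it. -/
theorem sum_gram_diag {m : ℕ} (E : Finset ι → ℤ) (hE : ∀ P, P.card ≠ m → E P = 0) :
    ∑ a, gram E a a = ((Fintype.card ι : ℤ) - m) * inn E E := by
  simp only [gram, inn_create]
  simp only [inn, annihilate_create_self, Finset.mul_sum]
  rw [Finset.sum_comm]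
  refine Finset.sum_congr rfl fun P _ => ?_
  by_cases hP : P.card = m
  · have h1 : ∑ a, (if a ∈ P then 0 else E P) = ∑ a ∈ Pᶜ, E P := by
      have : Pᶜ = Finset.univ.filter fun a => a ∉ P := by ext; simp
      rw [this, Finset.sum_filter]
      simp only [ite_not]
    rw [← Finset.mul_sum, h1, Finset.sum_const, Finset.card_compl, nsmul_eq_mul, Nat.cast_sub (Finset.card_le_univ P), hP]
    ring
  · rw [hE P hP]; simp

/-! #### Random signs -/

/-- The sign of a random bit. -/
def bitSign (b : Bool) : ℤ := if b then 1 else -1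

@[simp] theorem bitSign_mul_self (b : Bool) : bitSign b * bitSign b = 1 := by
  cases b <;> simp [bitSign]

theorem bitSign_not (b : Bool) : bitSign (!b) = - bitSign b := by
  cases b <;> simp [bitSign]

/-- Flipping the bit `a` is an involution of the sign vectors. -/
theorem sum_eq_zero_of_flip (f : (ι → Bool) → ℤ) (a : ι)
    (h : ∀ s, f (Function.update s a (!s a)) = - f s) : ∑ s, f s = 0 := by
  have h1 : ∑ s, f (Function.update s a (!s a)) = ∑ s, f s := by
    refine Finset.sum_nbij' (fun s => Function.update s a (!s a))
      (fun s => Function.update s a (!s a)) ?_ ?_ ?_ ?_ ?_ <;> simp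
  simp only [h, Finset.sum_neg_distrib] at h1
  omega

theorem sum_bitSign_two (a b : ι) :
    ∑ s : ι → Bool, bitSign (s a) * bitSign (s b)
      = (Fintype.card (ι → Bool) : ℤ) * if a = b then 1 else 0 := by
  split_ifs with h
  · subst h; simp
  · rw [mul_zero]
    refine sum_eq_zero_of_flip _ a fun s => ?_
    simp [Ne.symm h, bitSign_not]

/-- The mean is 1 if the four indices can be paired off and 0 otherwise. There are three pairings;
if all indices coincide, all three apply, and the last term removes the surplus. -/
theorem sum_bitSign_four (a b c d : ι) :
    ∑ s : ι → Bool, (bitSign (s a) * bitSign (s b)) * (bitSign (s c) * bitSign (s d))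
      = (Fintype.card (ι → Bool) : ℤ) * ((if a = b then if c = d then 1 else 0 else 0)
        + (if a = c then if b = d then 1 else 0 else 0)
        + (if a = d then if b = c then 1 else 0 else 0)
        - 2 * (if a = b then if c = d then if a = c then 1 else 0 else 0 else 0)) := by
  have key : ∀ i : ι, (∀ s : ι → Bool,
      (fun s : ι → Bool => (bitSign (s a) * bitSign (s b)) * (bitSign (s c) * bitSign (s d)))
        (Function.update s i (!s i))
      = - ((bitSign (s a) * bitSign (s b)) * (bitSign (s c) * bitSign (s d)))) →
      ∑ s : ι → Bool, (bitSign (s a) * bitSign (s b)) * (bitSign (s c) * bitSign (s d)) = 0 :=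
    fun i h => sum_eq_zero_of_flip _ i h
  by_cases hab : a = b
  · subst hab
    by_cases hcd : c = d
    · subst hcd
      by_cases hac : a = c
      · subst hac; simp
      · simp [hac]
    · rw [key c fun s => by
        by_cases hac : a = c
        · subst hac; simp [Ne.symm hcd, bitSign_not]
        · simp [hac, Ne.symm hcd, bitSign_not]]
      by_cases hac : a = c
      · subst hac; simp [hcd]
      · simp [hac, hcd]
  · by_cases hcd : c = d
    · subst hcd
      rw [key a fun s => by
        by_cases hac : c = a
        · subst hac; simp [Ne.symm hab, bitSign_not]
        · simp [hac, Ne.symm hab, bitSign_not]]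
      by_cases hac : a = c
      · subst hac; simp [Ne.symm hab, hab]
      · simp [hab, hac]
    · by_cases hac : a = c
      · subst hac
        by_cases hbd : b = d
        · subst hbd
          simp only [hab, if_true, if_false]
          rw [Finset.sum_congr rfl fun s _ => show _ = (1 : ℤ) by
            rw [mul_mul_mul_comm, bitSign_mul_self, bitSign_mul_self, one_mul]]
          simp
        · rw [key b fun s => by simp [hab, Ne.symm hbd, bitSign_not]]
          simp [hab, hbd, hcd]
      · by_cases had : a = d
        · subst had
          by_cases hbc : b = c
          · subst hbc
            simp only [hab, if_true, if_false]
            rw [Finset.sum_congr rfl fun s _ => show _ = (1 : ℤ) by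
              rw [mul_comm (bitSign (s b)) (bitSign (s a)), mul_mul_mul_comm,
                bitSign_mul_self, bitSign_mul_self, one_mul]]
            simp
          · rw [key b fun s => by simp [hab, Ne.symm hbc, bitSign_not]]
            simp [hab, hbc, hac]
        · rw [key a fun s => by
            simp [Ne.symm hab, Ne.symm hac, Ne.symm had, bitSign_not]]
          simp [hab, hac, had]

/-- The vector of the signs of random bits. -/
def signVec (s : ι → Bool) (a : ι) : ℤ := bitSign (s a)

theorem sum_inn_wedge {m : ℕ} (E : Finset ι → ℤ) (hE : ∀ P, P.card ≠ m → E P = 0) :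
    ∑ s : ι → Bool, inn (wedge (signVec s) E) (wedge (signVec s) E)
      = Fintype.card (ι → Bool) * (((Fintype.card ι : ℤ) - m) * inn E E) := by
  simp only [inn_wedge_wedge, signVec]
  rw [← sum_gram_diag E hE, Finset.sum_comm, Finset.mul_sum]
  refine Finset.sum_congr rfl fun a _ => ?_
  rw [Finset.sum_comm]
  simp only [← Finset.mul_sum, sum_bitSign_two]
  simp [mul_comm]

/-- The three pairings of `sum_bitSign_four` yield the squared trace and twice the squared Frobenius
norm; the correction yields the diagonal. -/
theorem sum_quadForm_sq (M : ι → ι → ℤ) (hM : ∀ a b, M a b = M b a) :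
    ∑ s : ι → Bool, (∑ a, ∑ b, M a b * (signVec s a * signVec s b)) ^ 2
      = Fintype.card (ι → Bool) * ((∑ a, M a a) ^ 2 + 2 * ∑ a, ∑ b, M a b ^ 2
        - 2 * ∑ a, M a a ^ 2) := by
  have h1 : ∀ s : ι → Bool, (∑ a, ∑ b, M a b * (signVec s a * signVec s b)) ^ 2
      = ∑ a, ∑ b, ∑ c, ∑ d, M a b * M c d *
        ((bitSign (s a) * bitSign (s b)) * (bitSign (s c) * bitSign (s d))) := by
    intro s
    simp only [sq, Finset.sum_mul, Finset.mul_sum, signVec]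
    refine Finset.sum_congr rfl fun a _ => Finset.sum_congr rfl fun b _ =>
      Finset.sum_congr rfl fun c _ => Finset.sum_congr rfl fun d _ => ?_
    ring
  simp only [h1]
  have h2 : ∑ s : ι → Bool, ∑ a, ∑ b, ∑ c, ∑ d, M a b * M c d *
        ((bitSign (s a) * bitSign (s b)) * (bitSign (s c) * bitSign (s d)))
      = ∑ a, ∑ b, ∑ c, ∑ d, M a b * M c d * ∑ s : ι → Bool,
        ((bitSign (s a) * bitSign (s b)) * (bitSign (s c) * bitSign (s d))) := by
    rw [Finset.sum_comm]
    refine Finset.sum_congr rfl fun a _ => ?_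
    rw [Finset.sum_comm]
    refine Finset.sum_congr rfl fun b _ => ?_
    rw [Finset.sum_comm]
    refine Finset.sum_congr rfl fun c _ => ?_
    rw [Finset.sum_comm]
    refine Finset.sum_congr rfl fun d _ => ?_
    rw [Finset.mul_sum]
  rw [h2]
  simp only [sum_bitSign_four]
  have h3 : ∀ a b c d : ι, M a b * M c d * ((Fintype.card (ι → Bool) : ℤ) *
      ((if a = b then if c = d then 1 else 0 else 0)
        + (if a = c then if b = d then 1 else 0 else 0)
        + (if a = d then if b = c then 1 else 0 else 0)
        - 2 * (if a = b then if c = d then if a = c then 1 else 0 else 0 else 0)))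
      = (Fintype.card (ι → Bool) : ℤ) *
      (((if a = b then if c = d then M a b * M c d else 0 else 0)
        + (if a = c then if b = d then M a b * M c d else 0 else 0)
        + (if a = d then if b = c then M a b * M c d else 0 else 0)
        - 2 * (if a = b then if c = d then if a = c then M a b * M c d else 0 else 0 else 0))) := by
    intro a b c d
    split_ifs <;> ring
  simp only [h3, ← Finset.mul_sum, Finset.sum_add_distrib, Finset.sum_sub_distrib]
  congr 1
  have e1 : ∑ a, ∑ b, ∑ c, ∑ d, (if a = b then if c = d then M a b * M c d else 0 else 0)
      = (∑ a, M a a) ^ 2 := by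
    simp [sq, Finset.sum_mul_sum, Finset.sum_ite_irrel]
  have e2 : ∑ a, ∑ b, ∑ c, ∑ d, (if a = c then if b = d then M a b * M c d else 0 else 0)
      = ∑ a, ∑ b, M a b ^ 2 := by
    simp [sq, Finset.sum_ite_irrel]
  have e3 : ∑ a, ∑ b, ∑ c, ∑ d, (if a = d then if b = c then M a b * M c d else 0 else 0)
      = ∑ a, ∑ b, M a b ^ 2 := by
    refine Finset.sum_congr rfl fun a _ => Finset.sum_congr rfl fun b _ => ?_
    simp [sq, hM b a]
  have e4 : ∑ a, ∑ b, ∑ c, ∑ d,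
      (if a = b then if c = d then if a = c then M a b * M c d else 0 else 0 else 0)
      = ∑ a, M a a ^ 2 := by
    simp [sq, Finset.sum_ite_irrel]
  rw [e1, e2, e3, e4]; ring

/-- With `d = card ι - m`, the squared trace gives `d^2`, and by `sum_gram_sq_le` the squared
Frobenius norm is at most `|E|^2` times the trace, giving `2 * d`; the negative diagonal term is
dropped. The form `d * (d + 2)` produces the two falling factorials of the fourth moment. -/
theorem sum_inn_wedge_sq_le {m : ℕ} (E : Finset ι → ℤ) (hE : ∀ P, P.card ≠ m → E P = 0) :
    ∑ s : ι → Bool, inn (wedge (signVec s) E) (wedge (signVec s) E) ^ 2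
      ≤ Fintype.card (ι → Bool) * ((((Fintype.card ι : ℤ) - m) ^ 2
        + 2 * ((Fintype.card ι : ℤ) - m)) * inn E E ^ 2) := by
  simp only [inn_wedge_wedge]
  rw [sum_quadForm_sq _ (gram_comm E)]
  refine mul_le_mul_of_nonneg_left ?_ (by positivity)
  have h1 : ∑ a, ∑ b, gram E a b ^ 2 ≤ inn E E * ∑ a, gram E a a := by
    rw [Finset.mul_sum]
    exact Finset.sum_le_sum fun a _ => sum_gram_sq_le E a
  have h2 : 0 ≤ ∑ a, gram E a a ^ 2 := Finset.sum_nonneg fun a _ => sq_nonneg _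
  rw [sum_gram_diag E hE] at *
  nlinarith

theorem wedge_eq_zero_of_card {m : ℕ} {E : Finset ι → ℤ} (x : ι → ℤ)
    (hE : ∀ P, P.card ≠ m → E P = 0) (P : Finset ι) (hP : P.card ≠ m + 1) : wedge x E P = 0 := by
  refine Finset.sum_eq_zero fun a _ => ?_
  unfold create
  split_ifs with h
  · rw [hE, mul_zero, mul_zero]
    have := Finset.card_erase_add_one h
    omega
  · rw [mul_zero]

/-! #### Products of rows -/

variable {κ : Type*}

/-- The exterior product of the rows `φ 0, …, φ (i - 1)` of the matrix `R`. -/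
def rowProd (R : κ → ι → ℤ) (φ : ℕ → κ) : ℕ → Finset ι → ℤ
  | 0 => fun P => if P = ∅ then 1 else 0
  | i + 1 => wedge (R (φ i)) (rowProd R φ i)

theorem rowProd_congr (R : κ → ι → ℤ) {φ ψ : ℕ → κ} {i : ℕ} (h : ∀ j < i, φ j = ψ j) :
    rowProd R φ i = rowProd R ψ i := by
  induction i with
  | zero => rfl
  | succ i ih => rw [rowProd, rowProd, ih fun j hj => h j (by omega), h i (by omega)]

theorem rowProd_congr_rows {R R' : κ → ι → ℤ} {φ : ℕ → κ} {i : ℕ}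
    (h : ∀ j < i, R (φ j) = R' (φ j)) : rowProd R φ i = rowProd R' φ i := by
  induction i with
  | zero => rfl
  | succ i ih => rw [rowProd, rowProd, ih fun j hj => h j (by omega), h i (by omega)]

theorem rowProd_comp {κ' : Type*} (R : κ → ι → ℤ) (f : κ' → κ) (φ : ℕ → κ') (i : ℕ) :
    rowProd (fun x => R (f x)) φ i = rowProd R (fun j => f (φ j)) i := by
  induction i with
  | zero => rfl
  | succ i ih => rw [rowProd, rowProd, ih]

theorem rowProd_eq_zero_of_card (R : κ → ι → ℤ) (φ : ℕ → κ) (i : ℕ) (P : Finset ι)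
    (hP : P.card ≠ i) : rowProd R φ i P = 0 := by
  induction i generalizing P with
  | zero => exact if_neg (by rintro rfl; simp at hP)
  | succ i ih => exact wedge_eq_zero_of_card _ ih P hP

/-- The new factor is moved by anticommutation until it meets its own copy. -/
theorem wedge_rowProd_eq_zero (R : κ → ι → ℤ) (φ : ℕ → κ) {i j : ℕ} (hj : j < i) (P : Finset ι) :
    wedge (R (φ j)) (rowProd R φ i) P = 0 := by
  induction i generalizing P with
  | zero => omega
  | succ i ih =>
    rw [rowProd]
    rcases Nat.lt_succ_iff_lt_or_eq.1 hj with h | rfl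
    · rw [wedge_anticomm, wedge_congr (F := fun _ => 0) _ (ih h)]
      simp [wedge, create]
    · exact wedge_self _ _ _

theorem rowProd_eq_zero_of_repeat (R : κ → ι → ℤ) (φ : ℕ → κ) {i j l : ℕ} (hjl : j < l)
    (hl : l < i) (h : φ j = φ l) (P : Finset ι) : rowProd R φ i P = 0 := by
  induction i generalizing P with
  | zero => omega
  | succ i ih =>
    rw [rowProd]
    rcases Nat.lt_succ_iff_lt_or_eq.1 hl with h' | rfl
    · rw [wedge_congr (F := fun _ => 0) _ (ih h')]
      simp [wedge, create]
    · rw [← h]; exact wedge_rowProd_eq_zero R φ hjl P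

/-- In top degree only the full set has a nonzero coefficient, which is the determinant up to sign.
-/
theorem inn_rowProd_card (R : κ → ι → ℤ) (φ : ℕ → κ) :
    inn (rowProd R φ (Fintype.card ι)) (rowProd R φ (Fintype.card ι))
      = rowProd R φ (Fintype.card ι) Finset.univ ^ 2 := by
  rw [inn, Finset.sum_eq_single Finset.univ, sq]
  · intro P _ hP
    rw [rowProd_eq_zero_of_card, zero_mul]
    rwa [Ne, Finset.card_eq_iff_eq_univ]
  · simp

end Fock

/-! ### Moments of the squared determinant, one random row at a time -/

section Resample
variable {κ S : Type*} [Fintype κ] [DecidableEq κ] [Fintype S]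

/-- Exchanging the entry `ρ r` with a fresh sample `s` is an involution of the pairs `(ρ, s)`. This
replaces conditioning on all rows but one. -/
theorem sum_sum_update {A : Type*} [NonAssocSemiring A] (F : (κ → S) → A) (r : κ) :
    ∑ ρ : κ → S, ∑ s : S, F (Function.update ρ r s) = Fintype.card S * ∑ ρ, F ρ := by
  have h1 : ∑ ρ : κ → S, ∑ _s : S, F ρ = Fintype.card S * ∑ ρ, F ρ := by
    simp [Finset.mul_sum]
  rw [← h1, ← Fintype.sum_prod_type', ← Fintype.sum_prod_type']
  refine Finset.sum_nbij' (fun p => (Function.update p.1 r p.2, p.1 r))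
    (fun p => (Function.update p.1 r p.2, p.1 r)) ?_ ?_ ?_ ?_ ?_ <;> simp

end Resample

section Moments
variable {ι κ : Type*} [Fintype ι] [LinearOrder ι] [Fintype κ] [DecidableEq κ]

/-- The matrix of the signs of random bits. -/
def signMat (ρ : κ → ι → Bool) (x : κ) : ι → ℤ := signVec (ρ x)

theorem rowProd_signMat_update (ρ : κ → ι → Bool) (φ : ℕ → κ) {i : ℕ} (h : ∀ j < i, φ j ≠ φ i)
    (s : ι → Bool) :
    rowProd (signMat (Function.update ρ (φ i) s)) φ (i + 1)
      = wedge (signVec s) (rowProd (signMat ρ) φ i) := by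
  rw [rowProd]
  congr 1
  · simp [signMat]
  · refine rowProd_congr_rows fun j hj => ?_
    simp [signMat, h j hj]

theorem card_signs_pos : (0 : ℤ) < Fintype.card (ι → Bool) := by
  exact_mod_cast Fintype.card_pos

/-- Since the rows are distinct, the last one can be resampled independently of the product of the
others, and it contributes the factor `card ι - i`. -/
theorem sum_inn_rowProd (φ : ℕ → κ) (i : ℕ) (hi : i ≤ Fintype.card ι)
    (hφ : ∀ j l, j < l → l < i → φ j ≠ φ l) :
    ∑ ρ : κ → ι → Bool, inn (rowProd (signMat ρ) φ i) (rowProd (signMat ρ) φ i)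
      = Fintype.card (κ → ι → Bool) * ((Fintype.card ι).descFactorial i : ℤ) := by
  induction i with
  | zero => simp [rowProd, inn]
  | succ i ih =>
    have ih' := ih (by omega) fun j l h1 h2 => hφ j l h1 (by omega)
    have h1 := sum_sum_update (fun ρ : κ → ι → Bool =>
      inn (rowProd (signMat ρ) φ (i + 1)) (rowProd (signMat ρ) φ (i + 1))) (φ i)
    have h2 : ∀ ρ : κ → ι → Bool, ∀ s : ι → Bool,
        rowProd (signMat (Function.update ρ (φ i) s)) φ (i + 1)
        = wedge (signVec s) (rowProd (signMat ρ) φ i) :=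
      fun ρ s => rowProd_signMat_update ρ φ (fun j hj => hφ j i hj (by omega)) s
    simp only [h2, sum_inn_wedge _ (rowProd_eq_zero_of_card _ φ i), ← Finset.mul_sum] at h1
    have h3 := mul_left_cancel₀ card_signs_pos.ne' h1
    rw [← h3, ih', Nat.descFactorial_succ, Nat.cast_mul, Nat.cast_sub (by omega)]
    ring

/-- Here the resampled row contributes at most `(card ι - i) * (card ι + 2 - i)`, by
`sum_inn_wedge_sq_le`. -/
theorem sum_inn_rowProd_sq_le (φ : ℕ → κ) (i : ℕ) (hi : i ≤ Fintype.card ι)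
    (hφ : ∀ j l, j < l → l < i → φ j ≠ φ l) :
    ∑ ρ : κ → ι → Bool, inn (rowProd (signMat ρ) φ i) (rowProd (signMat ρ) φ i) ^ 2
      ≤ Fintype.card (κ → ι → Bool) * (((Fintype.card ι).descFactorial i : ℤ)
        * ((Fintype.card ι + 2).descFactorial i : ℤ)) := by
  induction i with
  | zero => simp [rowProd, inn]
  | succ i ih =>
    have ih' := ih (by omega) fun j l h1 h2 => hφ j l h1 (by omega)
    have h1 := sum_sum_update (fun ρ : κ → ι → Bool =>
      inn (rowProd (signMat ρ) φ (i + 1)) (rowProd (signMat ρ) φ (i + 1)) ^ 2) (φ i)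
    have h2 : ∀ ρ : κ → ι → Bool, ∀ s : ι → Bool,
        rowProd (signMat (Function.update ρ (φ i) s)) φ (i + 1)
        = wedge (signVec s) (rowProd (signMat ρ) φ i) :=
      fun ρ s => rowProd_signMat_update ρ φ (fun j hj => hφ j i hj (by omega)) s
    simp only [h2] at h1
    have h4 : (Fintype.card (ι → Bool) : ℤ) * ∑ ρ : κ → ι → Bool,
        inn (rowProd (signMat ρ) φ (i + 1)) (rowProd (signMat ρ) φ (i + 1)) ^ 2
        ≤ (Fintype.card (ι → Bool) : ℤ) * ((((Fintype.card ι : ℤ) - i) ^ 2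
        + 2 * ((Fintype.card ι : ℤ) - i)) * ∑ ρ : κ → ι → Bool,
          inn (rowProd (signMat ρ) φ i) (rowProd (signMat ρ) φ i) ^ 2) := by
      rw [← h1, Finset.mul_sum, Finset.mul_sum]
      exact Finset.sum_le_sum fun ρ _ => sum_inn_wedge_sq_le _ (rowProd_eq_zero_of_card _ φ i)
    have h5 := le_of_mul_le_mul_left h4 card_signs_pos
    have h6 : (i : ℤ) + 1 ≤ Fintype.card ι := by exact_mod_cast hi
    refine h5.trans ((mul_le_mul_of_nonneg_left ih' (by nlinarith)).trans (le_of_eq ?_))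
    rw [Nat.descFactorial_succ, Nat.descFactorial_succ, Nat.cast_mul, Nat.cast_mul,
      Nat.cast_sub (by omega), Nat.cast_sub (by omega)]
    push_cast
    ring

end Moments

/-! ### Averages of independent copies -/

section Chebyshev
variable {Ω : Type*} [Fintype Ω]

theorem sum_pi_apply {T : ℕ} (f : Ω → ℝ) (t : Fin T) :
    Fintype.card Ω * ∑ η : Fin T → Ω, f (η t)
      = Fintype.card (Fin T → Ω) * ∑ s, f s := by
  have h := sum_sum_update (fun η : Fin T → Ω => f (η t)) t
  simp only [Function.update_self, Finset.sum_const, Finset.card_univ, nsmul_eq_mul] at h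
  exact h.symm

theorem sum_pi_mul_eq_zero {T : ℕ} (f : Ω → ℝ) (hf : ∑ s, f s = 0) {t t' : Fin T} (h : t ≠ t') :
    ∑ η : Fin T → Ω, f (η t) * f (η t') = 0 := by
  rcases isEmpty_or_nonempty Ω with hΩ | hΩ
  · have : Nonempty (Fin T) := ⟨t⟩
    simp
  have h1 := sum_sum_update (fun η : Fin T → Ω => f (η t) * f (η t')) t
  simp only [Function.update_self, Function.update_of_ne h.symm, ← Finset.sum_mul, hf, zero_mul,
    Finset.sum_const_zero] at h1
  have : (Fintype.card Ω : ℝ) ≠ 0 := by exact_mod_cast Fintype.card_ne_zero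
  simpa [this] using h1.symm

theorem sum_pi_sum_sq {T : ℕ} (f : Ω → ℝ) (hf : ∑ s, f s = 0) :
    Fintype.card Ω * ∑ η : Fin T → Ω, (∑ t, f (η t)) ^ 2
      = Fintype.card (Fin T → Ω) * (T * ∑ s, f s ^ 2) := by
  have h1 : ∀ η : Fin T → Ω, (∑ t, f (η t)) ^ 2 = ∑ t, ∑ t', f (η t) * f (η t') := by
    intro η; rw [sq, Finset.sum_mul_sum]
  simp only [h1]
  rw [Finset.sum_comm]
  have h2 : ∀ t : Fin T, ∑ η : Fin T → Ω, ∑ t', f (η t) * f (η t')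
      = ∑ η : Fin T → Ω, f (η t) ^ 2 := by
    intro t
    rw [Finset.sum_comm, Finset.sum_eq_single t]
    · simp only [sq]
    · intro t' _ ht'
      exact sum_pi_mul_eq_zero f hf ht'.symm
    · simp
  simp only [h2, Finset.mul_sum]
  have h3 := fun t : Fin T => sum_pi_apply (fun s => f s ^ 2) t
  simp only [Finset.mul_sum] at h3
  simp only [h3]
  simp [Finset.mul_sum]
  refine Finset.sum_congr rfl fun s _ => ?_
  ring

/-- Chebyshev's inequality for the sum of `T` independent copies, phrased by counting outcomes: the
relative variance is at most `V / T`, so at most the fraction `V / (δ^2 * T) ≤ 1/100` of the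
outcomes is bad. -/
theorem card_deviation_le [Nonempty Ω] {T : ℕ} (X : Ω → ℝ) (μ V δ : ℝ) (hμ : 0 ≤ μ)
    (hX : ∑ s, X s = Fintype.card Ω * μ)
    (hX2 : ∑ s, X s ^ 2 ≤ Fintype.card Ω * ((1 + V) * μ ^ 2)) (hδ : 0 < δ)
    (hT : 100 * V ≤ δ ^ 2 * T) :
    99 / 100 * (Fintype.card (Fin T → Ω) : ℝ)
      ≤ ((Finset.univ.filter fun η : Fin T → Ω => |∑ t, X (η t) - T * μ| ≤ δ * (T * μ)).card : ℝ) := by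
  classical
  have hc : (0 : ℝ) < Fintype.card Ω := by exact_mod_cast Fintype.card_pos
  set f := fun s => X s - μ with hf
  have hf0 : ∑ s, f s = 0 := by
    simp [hf, Finset.sum_sub_distrib, hX]
  have hf2 : ∑ s, f s ^ 2 ≤ Fintype.card Ω * (V * μ ^ 2) := by
    have : ∑ s, f s ^ 2 = ∑ s, X s ^ 2 - 2 * μ * ∑ s, X s + Fintype.card Ω * μ ^ 2 := by
      simp only [hf, sub_sq, Finset.sum_add_distrib, Finset.sum_sub_distrib, Finset.mul_sum]
      simp
      refine Finset.sum_congr rfl fun s _ => ?_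
      ring
    rw [this, hX]
    nlinarith
  have h1 := sum_pi_sum_sq (T := T) f hf0
  set D : ℝ := (Fintype.card (Fin T → Ω) : ℝ) with hD
  have h2 : ∑ η : Fin T → Ω, (∑ t, f (η t)) ^ 2 ≤ D * (T * (V * μ ^ 2)) := by
    refine le_of_mul_le_mul_left ?_ hc
    rw [h1]
    have : (T : ℝ) * ∑ s, f s ^ 2 ≤ T * (Fintype.card Ω * (V * μ ^ 2)) := by gcongr
    calc _ ≤ D * (T * (Fintype.card Ω * (V * μ ^ 2))) := by gcongr
      _ = _ := by ring
  have hsum : ∀ η : Fin T → Ω, ∑ t, f (η t) = ∑ t, X (η t) - T * μ := by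
    intro η; simp [hf]
  set good := Finset.univ.filter fun η : Fin T → Ω => |∑ t, X (η t) - T * μ| ≤ δ * (T * μ)
  set bad := Finset.univ.filter fun η : Fin T → Ω => ¬ |∑ t, X (η t) - T * μ| ≤ δ * (T * μ)
  have hgb : (good.card : ℝ) + bad.card = D := by
    have := Finset.card_filter_add_card_filter_not (s := (Finset.univ : Finset (Fin T → Ω)))
      fun η : Fin T → Ω => |∑ t, X (η t) - T * μ| ≤ δ * (T * μ)
    rw [Finset.card_univ] at this
    rw [hD, ← this]; push_cast; rfl
  suffices h : (bad.card : ℝ) ≤ 1 / 100 * D by linarith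
  have hD0 : 0 ≤ D := by positivity
  rcases Nat.eq_zero_or_pos T with rfl | hT0
  · have : bad = ∅ := by simp [bad]
    rw [this]; simpa using hD0
  -- If the mean is zero, no relative error is allowed; but then the second moment vanishes too, and
  -- every outcome is exact.
  rcases hμ.eq_or_lt with h0 | hμ0
  · have hf3 : ∀ s, f s = 0 := by
      intro s
      have h4 : ∑ s, f s ^ 2 = 0 :=
        le_antisymm (by simpa [← h0] using hf2) (Finset.sum_nonneg fun s _ => sq_nonneg _)
      have := (Finset.sum_eq_zero_iff_of_nonneg fun s _ => sq_nonneg (f s)).1 h4 s (Finset.mem_univ s)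
      exact pow_eq_zero_iff (two_ne_zero) |>.1 this
    have : bad = ∅ := by
      rw [Finset.filter_eq_empty_iff]
      intro η _
      rw [not_not, ← hsum]
      simp [hf3, ← h0]
    rw [this]; simpa using hD0
  have hT1 : (0 : ℝ) < T := by exact_mod_cast hT0
  have hbad : (bad.card : ℝ) * (δ * (T * μ)) ^ 2 ≤ D * (T * (V * μ ^ 2)) := by
    refine le_trans ?_ h2
    rw [← nsmul_eq_mul]
    refine le_trans ?_ (Finset.sum_le_sum_of_subset_of_nonneg (Finset.subset_univ bad)
      fun η _ _ => sq_nonneg _)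
    refine Finset.card_nsmul_le_sum _ _ _ fun η hη => ?_
    rw [hsum, ← sq_abs (∑ t, X (η t) - T * μ)]
    have := (Finset.mem_filter.1 hη).2
    push Not at this
    gcongr
  have hpos : 0 < (δ * (T * μ)) ^ 2 := by positivity
  refine le_of_mul_le_mul_right (hbad.trans ?_) hpos
  calc D * (T * (V * μ ^ 2)) = D * (T * μ ^ 2) / 100 * (100 * V) := by ring
    _ ≤ D * (T * μ ^ 2) / 100 * (δ ^ 2 * T) := by gcongr
    _ = _ := by ring

end Chebyshev

/-! ### From the coin measure to counting finitely many bits -/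

section Coins

theorem coinMeasure_cylinder {J : Type*} [Fintype J] (idx : J → ℕ) (hidx : Function.Injective idx)
    (b : J → Bool) :
    coinMeasure {ω | ∀ j, ω (idx j) = b j} = (2⁻¹ : ENNReal) ^ Fintype.card J := by
  classical
  have h1 : {ω : ℕ → Bool | ∀ j, ω (idx j) = b j}
      = Set.pi (Finset.univ.image idx : Finset ℕ)
        (fun i => {Function.extend idx b (fun _ => false) i}) := by
    ext ω
    simp [Set.mem_pi, hidx.extend_apply]
  rw [h1, coinMeasure, MeasureTheory.Measure.infinitePi_pi]
  · rw [Finset.prod_image (fun x _ y _ h => hidx h)]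
    simp
  · intro i _; exact MeasurableSet.singleton _

theorem coinMeasure_finset {J : Type*} [Fintype J] [DecidableEq J] (idx : J → ℕ)
    (hidx : Function.Injective idx) (S : Finset (J → Bool)) :
    coinMeasure {ω | (fun j => ω (idx j)) ∈ S} = S.card * (2⁻¹ : ENNReal) ^ Fintype.card J := by
  have h1 : {ω : ℕ → Bool | (fun j => ω (idx j)) ∈ S}
      = ⋃ b ∈ S, {ω : ℕ → Bool | ∀ j, ω (idx j) = b j} := by
    ext ω
    simp only [Set.mem_ofPred_eq, Set.mem_iUnion, exists_prop]
    constructor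
    · intro h; exact ⟨_, h, fun j => rfl⟩
    · rintro ⟨b, hb, h⟩
      rwa [show (fun j => ω (idx j)) = b from funext h]
  rw [h1, MeasureTheory.measure_biUnion_finset]
  · simp only [coinMeasure_cylinder idx hidx]
    simp
  · intro b _ b' _ hbb
    rw [Function.onFun, Set.disjoint_left]
    intro ω h h'
    exact hbb (funext fun j => (h j).symm.trans (h' j))
  · intro b _
    rw [show {ω : ℕ → Bool | ∀ j, ω (idx j) = b j} = ⋂ j, (fun ω : ℕ → Bool => ω (idx j)) ⁻¹' {b j} by
      ext; simp]
    exact MeasurableSet.iInter fun j => measurable_pi_apply _ (MeasurableSet.singleton _)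

/-- The random matrix of trial `t`. -/
def trialBits (n k : ℕ) (ω : ℕ → Bool) (t : ℕ) (x : Fin n) (a : Fin k) : Bool :=
  ω (t * (n * k) + (x * k + a))

/-- Different entries of the matrices use different coins, so the matrices of the `T` trials are
uniformly distributed and a probability is a proportion of outcomes. -/
theorem coinMeasure_trials {n k T : ℕ} (p : (Fin T → Fin n → Fin k → Bool) → Prop)
    [DecidablePred p]
    (hp : 99 / 100 * (Fintype.card (Fin T → Fin n → Fin k → Bool) : ℝ)
      ≤ ((Finset.univ.filter p).card : ℝ)) :
    99 / 100 ≤ coinMeasure {ω | p fun t => trialBits n k ω t} := by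
  classical
  let e : (Fin T × Fin n × Fin k → Bool) ≃ (Fin T → Fin n → Fin k → Bool) :=
    ⟨fun b t x a => b (t, x, a), fun η j => η j.1 j.2.1 j.2.2, fun _ => rfl, fun _ => rfl⟩
  let idx : Fin T × Fin n × Fin k → ℕ := fun j => j.1 * (n * k) + (j.2.1 * k + j.2.2)
  have hidx : Function.Injective idx := by
    rintro ⟨t, x, a⟩ ⟨t', x', a'⟩ h
    simp only [idx] at h
    have hlt : ∀ (x : Fin n) (a : Fin k), (x : ℕ) * k + a < n * k := by
      intro x a
      have := x.2; have := a.2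
      nlinarith
    have hk : 0 < k := a.pos
    have hnk : 0 < n * k := Nat.mul_pos x.pos hk
    have h1 : (t : ℕ) = t' := by
      have := congrArg (· / (n * k)) h
      simpa [Nat.add_div_of_dvd_right, Nat.div_eq_of_lt (hlt _ _), hnk, mul_comm _ (n * k),
        Nat.mul_add_div] using this
    rw [h1] at h
    have h2 : (x : ℕ) * k + a = x' * k + a' := by omega
    have h3 : (x : ℕ) = x' := by
      have := congrArg (· / k) h2
      simpa [Nat.div_eq_of_lt a.2, Nat.div_eq_of_lt a'.2, mul_comm _ k, Nat.mul_add_div hk] using this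
    rw [h3] at h2
    simp only [Prod.mk.injEq, Fin.ext_iff]
    omega
  have h1 := coinMeasure_finset idx hidx (Finset.univ.filter fun b => p (e b))
  have h2 : {ω : ℕ → Bool | (fun j => ω (idx j)) ∈ Finset.univ.filter fun b => p (e b)}
      = {ω | p fun t => trialBits n k ω t} := by
    ext ω
    simp [e, idx]
    rfl
  rw [← h2, h1]
  have h3 : (Finset.univ.filter fun b => p (e b)).card = (Finset.univ.filter p).card := by
    refine Finset.card_bij (fun b _ => e b) ?_ ?_ ?_
    · simp
    · intro b _ b' _ h; exact e.injective h
    · intro η hη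
      exact ⟨e.symm η, by simpa using hη, by simp⟩
  rw [h3]
  have h4 : (Fintype.card (Fin T → Fin n → Fin k → Bool) : ℝ)
      = 2 ^ Fintype.card (Fin T × Fin n × Fin k) := by
    rw [← Fintype.card_congr e]; simp
  rw [h4] at hp
  set m := Fintype.card (Fin T × Fin n × Fin k)
  set c := (Finset.univ.filter p).card
  have h5 : (99 / 100 : ENNReal) = ENNReal.ofReal (99 / 100) := by
    rw [ENNReal.ofReal_div_of_pos (by norm_num)]; norm_num
  have h6 : (c : ENNReal) * 2⁻¹ ^ m = ENNReal.ofReal (c * (2⁻¹) ^ m) := by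
    rw [ENNReal.ofReal_mul (by positivity), ENNReal.ofReal_pow (by positivity),
      ENNReal.ofReal_inv_of_pos (by norm_num)]
    norm_num
  rw [h5, h6]
  refine ENNReal.ofReal_le_ofReal ?_
  rw [inv_pow, ← div_eq_mul_inv, le_div_iff₀ (by positivity)]
  exact hp

end Coins

/-! ### Subgraphs and injective homomorphisms -/

section InjHom
variable {V W : Type*}

/-- Injective homomorphisms. -/
def InjHom (H : Digraph V) (G : Digraph W) : Type _ :=
  {f : V → W // Function.Injective f ∧ ∀ u v, H.Adj u v → G.Adj (f u) (f v)}

@[ext] theorem DiSubgraph.ext {G : Digraph W} {S S' : DiSubgraph G} (h : S.verts = S'.verts)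
    (h' : ∀ x y, S.Adj x y ↔ S'.Adj x y) : S = S' := by
  cases S; cases S'
  simp only at h h'
  subst h
  congr
  funext x y
  exact propext (h' x y)

instance [Finite W] (G : Digraph W) : Finite (DiSubgraph G) := by
  refine Finite.of_injective (β := Set W × (W → W → Prop)) (fun S => (S.verts, S.Adj)) ?_
  intro S S' h
  simp only [Prod.mk.injEq] at h
  exact DiSubgraph.ext h.1 fun x y => by rw [h.2]

/-- The subgraphs isomorphic to `H`, together with an isomorphism, give injective homomorphisms. -/
def sigmaToInjHom (H : Digraph V) (G : Digraph W)
    (p : Σ S : {S : DiSubgraph G // Nonempty (RelIso H.Adj S.coe.Adj)}, RelIso H.Adj S.1.coe.Adj) :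
    InjHom H G :=
  ⟨fun v => (p.2 v : W), fun _ _ h => p.2.injective (Subtype.ext h),
    fun u v h => p.1.1.adj_sub ((p.2.map_rel_iff (a := u) (b := v)).2 h)⟩

/-- An injective homomorphism is an isomorphism onto its image, and a subgraph with an isomorphism
from `H` is recovered from the underlying map: its vertices and edges are the images of those of
`H`. -/
theorem sigmaToInjHom_bijective (H : Digraph V) (G : Digraph W) :
    Function.Bijective (sigmaToInjHom H G) := by
  constructor
  · rintro ⟨⟨S, hS⟩, e⟩ ⟨⟨S', hS'⟩, e'⟩ h
    have h1 : ∀ v, (e v : W) = (e' v : W) := fun v => congrFun (congrArg Subtype.val h) v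
    have key : ∀ {S : DiSubgraph G} (e : RelIso H.Adj S.coe.Adj) (x y : W),
        S.Adj x y ↔ ∃ u v, H.Adj u v ∧ (e u : W) = x ∧ (e v : W) = y := by
      intro S e x y
      constructor
      · intro hxy
        refine ⟨e.symm ⟨x, S.fst_mem hxy⟩, e.symm ⟨y, S.snd_mem hxy⟩, ?_, by simp, by simp⟩
        rw [← e.map_rel_iff]
        rw [RelIso.apply_symm_apply, RelIso.apply_symm_apply]
        exact hxy
      · rintro ⟨u, v, h, rfl, rfl⟩
        exact (e.map_rel_iff (a := u) (b := v)).2 h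
    have keyv : ∀ {S : DiSubgraph G} (e : RelIso H.Adj S.coe.Adj) (x : W),
        x ∈ S.verts ↔ ∃ u, (e u : W) = x := by
      intro S e x
      constructor
      · intro hx; exact ⟨e.symm ⟨x, hx⟩, by simp⟩
      · rintro ⟨u, rfl⟩; exact (e u).2
    have hSS : S = S' := by
      apply DiSubgraph.ext
      · ext x; rw [keyv e, keyv e']; simp only [h1]
      · intro x y; rw [key e, key e']; simp only [h1]
    subst hSS
    have : e = e' := RelIso.ext fun v => Subtype.ext (h1 v)
    subst this
    rfl
  · rintro ⟨f, hf, hadj⟩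
    let S : DiSubgraph G :=
      { verts := Set.range f
        Adj := fun x y => ∃ u v, H.Adj u v ∧ f u = x ∧ f v = y
        adj_sub := by rintro x y ⟨u, v, h, rfl, rfl⟩; exact hadj u v h
        fst_mem := by rintro x y ⟨u, v, h, rfl, rfl⟩; exact ⟨u, rfl⟩
        snd_mem := by rintro x y ⟨u, v, h, rfl, rfl⟩; exact ⟨v, rfl⟩ }
    let e : RelIso H.Adj S.coe.Adj :=
      { toEquiv := Equiv.ofInjective f hf
        map_rel_iff' := by
          intro u v
          constructor
          · rintro ⟨u', v', h, h1, h2⟩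
            rw [← hf h1, ← hf h2]; exact h
          · intro h; exact ⟨u, v, h, rfl, rfl⟩ }
    exact ⟨⟨⟨S, ⟨e⟩⟩, e⟩, rfl⟩

/-- All fibres of `sigmaToInjHom_bijective` over the subgraphs have as many elements as the
automorphism group. -/
theorem card_injHom [Finite V] [Finite W] (H : Digraph V) (G : Digraph W) :
    Nat.card (InjHom H G) = subCount H G * Nat.card (RelIso H.Adj H.Adj) := by
  classical
  rw [← Nat.card_congr (Equiv.ofBijective _ (sigmaToInjHom_bijective H G))]
  have : Fintype {S : DiSubgraph G // Nonempty (RelIso H.Adj S.coe.Adj)} := Fintype.ofFinite _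
  have hfin : ∀ S : {S : DiSubgraph G // Nonempty (RelIso H.Adj S.coe.Adj)},
      Finite (RelIso H.Adj S.1.coe.Adj) := fun S => DFunLike.finite _
  rw [Nat.card_sigma]
  have h : ∀ S : {S : DiSubgraph G // Nonempty (RelIso H.Adj S.coe.Adj)},
      Nat.card (RelIso H.Adj S.1.coe.Adj) = Nat.card (RelIso H.Adj H.Adj) := by
    rintro ⟨S, ⟨e⟩⟩
    exact Nat.card_congr ⟨fun f => f.trans e.symm, fun f => f.trans e,
      fun f => by ext; simp, fun f => by ext; simp⟩
  simp [h, subCount]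

/-- An injective endomorphism of a finite graph permutes the vertices and maps the edges
injectively, hence onto the edges, so it reflects adjacency. This lets the counting of homomorphisms
compute `|Aut H|`. -/
theorem card_injHom_self [Finite V] (H : Digraph V) :
    Nat.card (InjHom H H) = Nat.card (RelIso H.Adj H.Adj) := by
  refine (Nat.card_congr (Equiv.ofBijective
    (fun e : RelIso H.Adj H.Adj => (⟨e, e.injective, fun u v h => e.map_rel_iff.2 h⟩ : InjHom H H))
    ⟨?_, ?_⟩)).symm
  · intro e e' h
    exact RelIso.ext fun v => congrFun (congrArg Subtype.val h) v
  · rintro ⟨f, hf, hadj⟩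
    let g : {p : V × V // H.Adj p.1 p.2} → {p : V × V // H.Adj p.1 p.2} :=
      fun p => ⟨(f p.1.1, f p.1.2), hadj _ _ p.2⟩
    have hg : Function.Injective g := by
      rintro ⟨⟨u, v⟩, h⟩ ⟨⟨u', v'⟩, h'⟩ hh
      simp only [g, Subtype.mk.injEq, Prod.mk.injEq] at hh
      simp [hf hh.1, hf hh.2]
    have hgs := Finite.surjective_of_injective hg
    refine ⟨⟨Equiv.ofBijective f ⟨hf, Finite.surjective_of_injective hf⟩, ?_⟩, rfl⟩
    intro u v
    refine ⟨fun h => ?_, hadj u v⟩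
    obtain ⟨⟨⟨u', v'⟩, h'⟩, hh⟩ := hgs ⟨(f u, f v), h⟩
    replace hh := Prod.mk.inj (congrArg Subtype.val hh)
    rw [← hf hh.1, ← hf hh.2]; exact h'

theorem card_relIso_pos [Finite V] (H : Digraph V) : 0 < Nat.card (RelIso H.Adj H.Adj) := by
  have : Finite (RelIso H.Adj H.Adj) := DFunLike.finite _
  have : Nonempty (RelIso H.Adj H.Adj) := ⟨RelIso.refl _⟩
  exact Nat.card_pos

/-- The graph `H` with its vertices renamed. -/
def relabel {V' : Type*} (H : Digraph V) (e : V' ≃ V) : Digraph V' := ⟨fun i j => H.Adj (e i) (e j)⟩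

theorem subCount_relabel {V' : Type*} (H : Digraph V) (e : V' ≃ V) (G : Digraph W) :
    subCount (relabel H e) G = subCount H G := by
  let r : RelIso (relabel H e).Adj H.Adj := ⟨e, Iff.rfl⟩
  refine Nat.card_congr (Equiv.subtypeEquivRight fun S => ?_)
  exact ⟨fun ⟨f⟩ => ⟨r.symm.trans f⟩, fun ⟨f⟩ => ⟨r.trans f⟩⟩

theorem subCount_eq_zero [Finite V] [Finite W] (H : Digraph V) (G : Digraph W)
    (h : Nat.card W < Nat.card V) : subCount H G = 0 := by
  have : IsEmpty (InjHom H G) :=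
    ⟨fun f => absurd (Nat.card_le_card_of_injective f.1 f.2.1) (by omega)⟩
  have h1 := card_injHom H G
  rw [Nat.card_of_isEmpty] at h1
  have := card_relIso_pos H
  rcases Nat.mul_eq_zero.1 h1.symm with h2 | h2 <;> omega

end InjHom

/-! ### Sets as bit masks -/

section Mask
variable {k : ℕ}

/-- The number whose binary digits are the indicator function of the set. -/
def mask (P : Finset (Fin k)) : ℕ := ∑ a ∈ P, 2 ^ (a : ℕ)

theorem mask_eq (P : Finset (Fin k)) :
    mask P = Finset.equivBitIndices.symm (P.map Fin.valEmbedding) := by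
  simp [mask, Finset.equivBitIndices]

theorem testBit_mask (P : Finset (Fin k)) (i : ℕ) :
    (mask P).testBit i = true ↔ ∃ a ∈ P, (a : ℕ) = i := by
  have h1 : Finset.equivBitIndices (mask P) = P.map Fin.valEmbedding := by
    rw [mask_eq, Equiv.apply_symm_apply]
  have h2 : i ∈ Finset.equivBitIndices (mask P) ↔ (mask P).testBit i = true := by
    simp [Finset.equivBitIndices]
  rw [← h2, h1]
  simp

theorem mask_bit (P : Finset (Fin k)) (a : Fin k) :
    mask P / 2 ^ (a : ℕ) % 2 = if a ∈ P then 1 else 0 := by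
  have h := testBit_mask P a
  rw [Nat.testBit_eq_decide_div_mod_eq, decide_eq_true_eq] at h
  split_ifs with ha
  · exact h.2 ⟨a, ha, rfl⟩
  · have : ¬ mask P / 2 ^ (a : ℕ) % 2 = 1 := by
      rw [h]
      rintro ⟨b, hb, hab⟩
      exact ha (Fin.ext hab ▸ hb)
    omega

theorem mask_injective : Function.Injective (mask (k := k)) := by
  intro P Q h
  rw [mask_eq, mask_eq] at h
  exact Finset.map_injective _ (Finset.equivBitIndices.symm.injective h)

theorem mask_lt (P : Finset (Fin k)) : mask P < 2 ^ k := by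
  refine Nat.lt_pow_two_of_testBit _ fun i hi => ?_
  rw [Bool.eq_false_iff, Ne, testBit_mask]
  rintro ⟨a, -, rfl⟩
  exact absurd a.2 (by omega)

theorem exists_mask_eq {U : ℕ} (hU : U < 2 ^ k) : ∃ P : Finset (Fin k), mask P = U := by
  have h : Function.Bijective (fun P : Finset (Fin k) => (⟨mask P, mask_lt P⟩ : Fin (2 ^ k))) := by
    rw [Fintype.bijective_iff_injective_and_card]
    refine ⟨fun P Q hPQ => mask_injective (by simpa using hPQ), by simp⟩
  obtain ⟨P, hP⟩ := h.2 ⟨U, hU⟩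
  exact ⟨P, congrArg Fin.val hP⟩

@[simp] theorem mask_empty : mask (∅ : Finset (Fin k)) = 0 := rfl

theorem mask_erase {P : Finset (Fin k)} {a : Fin k} (h : a ∈ P) :
    mask (P.erase a) + 2 ^ (a : ℕ) = mask P :=
  Finset.sum_erase_add P (fun a : Fin k => 2 ^ (a : ℕ)) h

theorem mask_insert {P : Finset (Fin k)} {a : Fin k} (h : a ∉ P) :
    mask (insert a P) = mask P + 2 ^ (a : ℕ) := by
  rw [mask, Finset.sum_insert h, add_comm]; rfl

theorem mask_univ : mask (Finset.univ : Finset (Fin k)) + 1 = 2 ^ k := by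
  obtain ⟨P, hP⟩ := exists_mask_eq (k := k) (U := 2 ^ k - 1) (by
    have : 0 < 2 ^ k := by positivity
    omega)
  have h1 : mask P ≤ mask (Finset.univ : Finset (Fin k)) :=
    Finset.sum_le_sum_of_subset (Finset.subset_univ P)
  have h2 := mask_lt (Finset.univ : Finset (Fin k))
  omega

theorem sum_range_two_pow {A : Type*} [AddCommMonoid A] (g : ℕ → A) :
    ∑ p ∈ Finset.range (2 ^ k), g p = ∑ P : Finset (Fin k), g (mask P) := by
  symm
  refine Finset.sum_bij (fun P _ => mask P) ?_ ?_ ?_ ?_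
  · intro P _; exact Finset.mem_range.2 (mask_lt P)
  · intro P _ Q _ h; exact mask_injective h
  · intro U hU
    obtain ⟨P, hP⟩ := exists_mask_eq (Finset.mem_range.1 hU)
    exact ⟨P, Finset.mem_univ _, hP⟩
  · intro P _; rfl

end Mask

/-! ### Pathwidth and orderings of the vertices -/

section Ordering
variable {V : Type*} [Fintype V] [DecidableEq V]

open Classical in
/-- The vertices of `S` that have a neighbour outside of `S`. -/
noncomputable def boundary (H : Digraph V) (S : Finset V) : Finset V :=
  S.filter fun u => ∃ w, w ∉ S ∧ (H.Adj u w ∨ H.Adj w u)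

theorem mem_boundary {H : Digraph V} {S : Finset V} {u : V} :
    u ∈ boundary H S ↔ u ∈ S ∧ ∃ w, w ∉ S ∧ (H.Adj u w ∨ H.Adj w u) := by
  simp [boundary]

theorem boundary_empty (H : Digraph V) : boundary H ∅ = ∅ := by simp [boundary]

theorem boundary_univ (H : Digraph V) : boundary H Finset.univ = ∅ := by
  ext; simp [mem_boundary]

theorem boundary_card_le (H : Digraph V) (S : Finset V) :
    (boundary H S).card ≤ Fintype.card V := Finset.card_le_univ _

/-- `S` can be built up one vertex at a time such that all boundaries have at most `p` vertices. -/
inductive Reach (H : Digraph V) (p : ℕ) : Finset V → Prop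
  | empty : Reach H p ∅
  | step {S : Finset V} {v : V} : v ∈ S → Reach H p (S.erase v) → (boundary H S).card ≤ p →
      Reach H p S

theorem exists_pathDecomposition (H : Digraph V) :
    ∃ D : PathDecomposition H, ∀ i, (D.bag i).card ≤ pathwidth H + 1 := by
  have h : {p : ℕ | ∃ D : PathDecomposition H, ∀ i, (D.bag i).card ≤ p + 1}.Nonempty := by
    refine ⟨Fintype.card V, ⟨0, fun _ => Finset.univ, fun v => ⟨0, Finset.mem_univ _⟩,
      fun _ _ _ _ _ _ _ _ => Finset.mem_univ _,
      fun _ _ _ => ⟨0, Finset.mem_univ _, Finset.mem_univ _⟩⟩, fun i => ?_⟩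
    exact (Finset.card_le_univ _).trans (Nat.le_succ _)
  exact Nat.sInf_mem h

/-- Order the vertices by the first bag `l v` that contains them. Every initial segment then has a
small boundary (`hb`), and removing a vertex with maximal `l` leaves an initial segment. -/
theorem reach_pathwidth (H : Digraph V) : Reach H (pathwidth H) Finset.univ := by
  obtain ⟨D, hD⟩ := exists_pathDecomposition H
  have hl : ∀ v, ∃ i, v ∈ D.bag i ∧ ∀ j, v ∈ D.bag j → i ≤ j := by
    intro v
    obtain ⟨i, hi⟩ := D.vertex_mem v
    have hne : (Finset.univ.filter fun i => v ∈ D.bag i).Nonempty := ⟨i, by simpa using hi⟩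
    refine ⟨Finset.min' _ hne, ?_, fun j hj => Finset.min'_le _ _ (by simpa using hj)⟩
    simpa using Finset.min'_mem _ hne
  choose l hl hmin using hl
  have hb : ∀ S : Finset V, (∀ u ∈ S, ∀ v, v ∉ S → l u ≤ l v) →
      (boundary H S).card ≤ pathwidth H := by
    intro S hS
    rcases eq_or_ne S Finset.univ with rfl | hne
    · rw [boundary_univ]; simp
    obtain ⟨w, hw, hwmin⟩ := Finset.exists_min_image Sᶜ l (by
      rw [← Finset.card_pos, Finset.card_compl]
      have := (Finset.card_lt_iff_ne_univ S).2 hne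
      omega)
    rw [Finset.mem_compl] at hw
    -- The vertex `w` is the first one missing from `S`. A boundary vertex `u` has `l u ≤ l w`, and
    -- it shares a bag, at position `l w` or later, with a missing neighbour; so it lies in the bag
    -- `l w`. As `w` is not in `S`, one element of that bag is spared.
    have hsub : boundary H S ⊆ (D.bag (l w)).erase w := by
      intro u hu
      obtain ⟨huS, w', hw', hadj⟩ := mem_boundary.1 hu
      refine Finset.mem_erase.2 ⟨fun h => hw (h ▸ huS), ?_⟩
      obtain ⟨j, huj, hwj⟩ : ∃ j, u ∈ D.bag j ∧ w' ∈ D.bag j := by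
        rcases hadj with h | h
        · exact D.edge_mem _ _ h
        · obtain ⟨j, h1, h2⟩ := D.edge_mem _ _ h
          exact ⟨j, h2, h1⟩
      exact D.interval u (l u) (l w) j (hS u huS w hw)
        ((hwmin w' (by simpa using hw')).trans (hmin w' j hwj)) (hl u) huj
    have h1 := Finset.card_le_card hsub
    rw [Finset.card_erase_of_mem (hl w)] at h1
    have := hD (l w)
    omega
  have key : ∀ m, ∀ S : Finset V, S.card = m → (∀ u ∈ S, ∀ v, v ∉ S → l u ≤ l v) →
      Reach H (pathwidth H) S := by
    intro m
    induction m with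
    | zero =>
      intro S hS _
      rw [Finset.card_eq_zero] at hS
      subst hS
      exact Reach.empty
    | succ m ih =>
      intro S hS hdown
      obtain ⟨v, hv, hvmax⟩ := Finset.exists_max_image S l (by
        rw [← Finset.card_pos]; omega)
      refine Reach.step hv (ih _ ?_ ?_) (hb S hdown)
      · rw [Finset.card_erase_of_mem hv]; omega
      · intro u hu x hx
        have huS := Finset.mem_of_mem_erase hu
        by_cases hxv : x = v
        · rw [hxv]; exact hvmax u huS
        · exact hdown u huS x fun h => hx (Finset.mem_erase.2 ⟨hxv, h⟩)
  exact key _ _ rfl fun u _ v hv => absurd (Finset.mem_univ v) hv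

/-- This makes time `n^2` for an adjacency matrix of `G` affordable as soon as `H` has an edge. -/
theorem one_le_pathwidth {H : Digraph V} {u v : V} (huv : u ≠ v) (h : H.Adj u v) :
    1 ≤ pathwidth H := by
  obtain ⟨D, hD⟩ := exists_pathDecomposition H
  obtain ⟨i, hu, hv⟩ := D.edge_mem u v h
  have h1 := hD i
  have h2 : 1 < (D.bag i).card := Finset.one_lt_card.2 ⟨u, hu, v, hv, huv⟩
  omega

theorem boundary_relabel {V' : Type*} [Fintype V'] [DecidableEq V'] (H : Digraph V) (e : V' ≃ V)
    (S : Finset V') :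
    (boundary (relabel H e) S).card = (boundary H (S.map e.toEmbedding)).card := by
  rw [← Finset.card_map e.toEmbedding]
  congr 1
  ext v
  simp only [Finset.mem_map_equiv, mem_boundary, relabel, Equiv.apply_symm_apply]
  refine and_congr_right fun _ => ?_
  constructor
  · rintro ⟨w, hw, h⟩; exact ⟨e w, by simpa using hw, h⟩
  · rintro ⟨w, hw, h⟩; exact ⟨e.symm w, hw, by simpa using h⟩

end Ordering

/-! ### Mixed radix codes of partial maps -/

section Codes

/-- The number of elements of the set with indicator function `f` below `u`. -/
def rankOf (f : ℕ → ℕ) (u : ℕ) : ℕ := ∑ v ∈ Finset.range u, f v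

/-- The code of the restriction of `φ` to the set with indicator function `f`. -/
def encode (N : ℕ) (f φ : ℕ → ℕ) (U : ℕ) : ℕ := ∑ u ∈ Finset.range U, f u * φ u * N ^ rankOf f u

theorem rankOf_succ (f : ℕ → ℕ) (u : ℕ) : rankOf f (u + 1) = rankOf f u + f u :=
  Finset.sum_range_succ _ _

theorem rankOf_mono (f : ℕ → ℕ) : Monotone (rankOf f) := fun _ _ h =>
  Finset.sum_le_sum_of_subset (Finset.range_mono h)

theorem encode_succ (N : ℕ) (f φ : ℕ → ℕ) (U : ℕ) :
    encode N f φ (U + 1) = encode N f φ U + f U * φ U * N ^ rankOf f U :=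
  Finset.sum_range_succ _ _

theorem encode_lt {N : ℕ} {f φ : ℕ → ℕ} {U : ℕ} (hf : ∀ u < U, f u = 0 ∨ f u = 1)
    (hφ : ∀ u < U, f u = 1 → φ u < N) : encode N f φ U < N ^ rankOf f U := by
  induction U with
  | zero => simp [encode, rankOf]
  | succ U ih =>
    have ih' := ih (fun u hu => hf u (by omega)) fun u hu => hφ u (by omega)
    rw [encode_succ, rankOf_succ]
    rcases hf U (by omega) with h | h
    · simpa [h] using ih'
    · have := hφ U (by omega) h
      rw [h, pow_succ, one_mul]
      nlinarith [mul_le_mul_right (Nat.succ_le_of_lt this) (N ^ rankOf f U)]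

/-- The digit of `u` has the place value `N ^ rankOf f u`: the earlier digits sum to less than it by
`encode_lt`, and the later ones are multiples of `N` times it. -/
theorem decode_encode {N : ℕ} {f φ : ℕ → ℕ} {U : ℕ} (hf : ∀ u < U, f u = 0 ∨ f u = 1)
    (hφ : ∀ u < U, f u = 1 → φ u < N) {u : ℕ} (hu : u < U) (hfu : f u = 1) :
    encode N f φ U / N ^ rankOf f u % N = φ u := by
  have hN : 0 < N := (Nat.zero_le _).trans_lt (hφ u hu hfu)
  induction U with
  | zero => omega
  | succ U ih =>
    have hp : 0 < N ^ rankOf f u := by positivity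
    rw [encode_succ]
    rcases Nat.lt_succ_iff_lt_or_eq.1 hu with h | rfl
    · have ih' := ih (fun u hu => hf u (by omega)) (fun u hu => hφ u (by omega)) h
      have h1 : rankOf f u + 1 ≤ rankOf f U := by
        rw [← hfu, ← rankOf_succ]; exact rankOf_mono f h
      obtain ⟨d, hd⟩ := Nat.exists_eq_add_of_le h1
      rw [hd, show f U * φ U * N ^ (rankOf f u + 1 + d)
        = N ^ rankOf f u * (N * (f U * φ U * N ^ d)) by ring, Nat.add_mul_div_left _ _ hp,
        Nat.add_mul_mod_self_left, ih']
    · have h1 := encode_lt (N := N) (fun v hv => hf v (Nat.lt_succ_of_lt hv))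
        fun v hv => hφ v (Nat.lt_succ_of_lt hv)
      rw [hfu, one_mul, mul_comm (φ u), Nat.add_mul_div_left _ _ hp, Nat.div_eq_of_lt h1, zero_add,
        Nat.mod_eq_of_lt (hφ u hu hfu)]

theorem sum_range_mul_div_mod {A : Type*} [AddCommMonoid A] (m n : ℕ) (f : ℕ → ℕ → A) :
    ∑ y ∈ Finset.range (m * n), f (y / n) (y % n)
      = ∑ i ∈ Finset.range m, ∑ j ∈ Finset.range n, f i j := by
  induction m with
  | zero => simp
  | succ m ih =>
    rw [Nat.succ_mul, Finset.sum_range_add, ih, Finset.sum_range_succ]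
    congr 1
    refine Finset.sum_congr rfl fun j hj => ?_
    have hj' := Finset.mem_range.1 hj
    rw [mul_comm m n, Nat.mul_add_div (by omega), Nat.div_eq_of_lt hj', Nat.mul_add_mod,
      Nat.mod_eq_of_lt hj', add_zero]

end Codes

/-! ### The dynamic program over prefixes of the vertex sequence -/

section Prefix

open Classical in
/-- The maps from `{0, …, i - 1}` to `{0, …, N - 1}`, extended by `0`. -/
noncomputable def prefixMaps (N : ℕ) : ℕ → Finset (ℕ → ℕ)
  | 0 => {fun _ => 0}
  | i + 1 => (prefixMaps N i ×ˢ Finset.range N).image fun p => Function.update p.1 i p.2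

theorem mem_prefixMaps {N i : ℕ} {φ : ℕ → ℕ} :
    φ ∈ prefixMaps N i ↔ (∀ u < i, φ u < N) ∧ ∀ u, i ≤ u → φ u = 0 := by
  induction i generalizing φ with
  | zero =>
    simp only [prefixMaps, Finset.mem_singleton]
    exact ⟨by rintro rfl; simp, fun h => funext fun u => h.2 u (Nat.zero_le _)⟩
  | succ i ih =>
    simp only [prefixMaps, Finset.mem_image, Finset.mem_product, Finset.mem_range, Prod.exists, ih]
    constructor
    · rintro ⟨ψ, x, ⟨⟨h1, h2⟩, hx⟩, rfl⟩
      refine ⟨fun u hu => ?_, fun u hu => ?_⟩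
      · rw [Function.update_apply]
        split_ifs with h
        · exact hx
        · exact h1 u (by omega)
      · rw [Function.update_of_ne (by omega)]; exact h2 u (by omega)
    · rintro ⟨h1, h2⟩
      refine ⟨Function.update φ i 0, φ i, ⟨⟨fun u hu => ?_, fun u hu => ?_⟩, h1 i (by omega)⟩, ?_⟩
      · rw [Function.update_of_ne (by omega)]; exact h1 u (by omega)
      · rw [Function.update_apply]
        split_ifs with h
        · rfl
        · exact h2 u (by omega)
      · simp

theorem sum_prefixMaps_succ {A : Type*} [AddCommMonoid A] (N i : ℕ) (g : (ℕ → ℕ) → A) :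
    ∑ φ ∈ prefixMaps N (i + 1), g φ
      = ∑ φ ∈ prefixMaps N i, ∑ x ∈ Finset.range N, g (Function.update φ i x) := by
  classical
  rw [prefixMaps, Finset.sum_image, Finset.sum_product]
  rintro ⟨φ, x⟩ h ⟨ψ, y⟩ h' hxy
  simp only [Finset.coe_product, Set.mem_prod, Finset.mem_coe] at h h'
  have h1 := congrFun hxy i
  simp only [Function.update_self] at h1
  refine Prod.ext (funext fun u => ?_) h1
  by_cases hu : u = i
  · rw [hu]
    exact ((mem_prefixMaps.1 h.1).2 i le_rfl).trans ((mem_prefixMaps.1 h'.1).2 i le_rfl).symm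
  · have := congrFun hxy u
    simpa [hu] using this

variable {k : ℕ}

/-- The adjacency indicator of a digraph, as a function of natural numbers. -/
noncomputable def adjInd {m : ℕ} (H : Digraph (Fin m)) (u v : ℕ) : ℤ :=
  open Classical in if ∃ (hu : u < m) (hv : v < m), H.Adj ⟨u, hu⟩ ⟨v, hv⟩ then 1 else 0

theorem adjInd_eq {m : ℕ} (H : Digraph (Fin m)) (u v : ℕ) : adjInd H u v = 0 ∨ adjInd H u v = 1 := by
  unfold adjInd; split_ifs <;> simp

theorem adjInd_fin {m : ℕ} (H : Digraph (Fin m)) (u v : Fin m) :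
    adjInd H u v = open Classical in if H.Adj u v then 1 else 0 := by
  have h : (∃ (hu : (u : ℕ) < m) (hv : (v : ℕ) < m), H.Adj ⟨u, hu⟩ ⟨v, hv⟩) ↔ H.Adj u v :=
    ⟨fun ⟨_, _, h⟩ => h, fun h => ⟨u.2, v.2, h⟩⟩
  by_cases hh : H.Adj u v
  · rw [adjInd, if_pos (h.2 hh), if_pos hh]
  · rw [adjInd, if_neg (mt h.1 hh), if_neg hh]

/-- The vertices below `i`. -/
def below (k i : ℕ) : Finset (Fin k) := Finset.univ.filter fun u => (u : ℕ) < i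

/-- The indicator function of the boundary of the set of the first `i` vertices. -/
noncomputable def bdInd (H : Digraph (Fin k)) (i u : ℕ) : ℕ :=
  open Classical in if ∃ hu : u < k, (⟨u, hu⟩ : Fin k) ∈ boundary H (below k i) then 1 else 0

theorem bdInd_eq (H : Digraph (Fin k)) (i u : ℕ) : bdInd H i u = 0 ∨ bdInd H i u = 1 := by
  unfold bdInd; split_ifs <;> simp

theorem bdInd_eq_one {H : Digraph (Fin k)} {i u : ℕ} :
    bdInd H i u = 1 ↔ ∃ hu : u < k, (⟨u, hu⟩ : Fin k) ∈ boundary H (below k i) := by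
  unfold bdInd; split_ifs with h <;> simp [h]

theorem bdInd_iff {H : Digraph (Fin k)} {i u : ℕ} :
    bdInd H i u = 1 ↔ u < i ∧ u < k ∧ ∃ w < k, i ≤ w ∧ adjInd H u w + adjInd H w u ≠ 0 := by
  rw [bdInd_eq_one]
  constructor
  · rintro ⟨hu, h⟩
    obtain ⟨h1, w, hw, hadj⟩ := mem_boundary.1 h
    simp only [below, Finset.mem_filter, Finset.mem_univ, true_and, not_lt] at h1 hw
    refine ⟨h1, hu, w, w.2, hw, ?_⟩
    have e1 := adjInd_fin H ⟨u, hu⟩ w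
    have e2 := adjInd_fin H w ⟨u, hu⟩
    simp only at e1 e2
    rw [e1, e2]
    rcases hadj with h | h <;> simp only [h, if_true] <;> split_ifs <;> simp
  · rintro ⟨h1, hu, w, hw, hiw, hne⟩
    refine ⟨hu, mem_boundary.2 ⟨by simpa [below] using h1, ⟨w, hw⟩, by simpa [below] using hiw, ?_⟩⟩
    have e1 := adjInd_fin H ⟨u, hu⟩ ⟨w, hw⟩
    have e2 := adjInd_fin H ⟨w, hw⟩ ⟨u, hu⟩
    simp only at e1 e2
    rw [e1, e2] at hne
    by_contra hcon
    push Not at hcon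
    simp [hcon.1, hcon.2] at hne

/-- The number of digits of a code is the size of the boundary; this is what bounds a table by a
power of `n` with exponent `pw H`. -/
theorem rankOf_bdInd (H : Digraph (Fin k)) (i : ℕ) :
    rankOf (bdInd H i) k = (boundary H (below k i)).card := by
  classical
  have h : ∀ u : Fin k, bdInd H i u = if u ∈ boundary H (below k i) then 1 else 0 := by
    intro u
    split_ifs with hu
    · exact bdInd_eq_one.2 ⟨u.2, hu⟩
    · refine (bdInd_eq H i u).resolve_right fun h => hu ?_
      exact (bdInd_eq_one.1 h).2
  rw [rankOf, Finset.sum_range]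
  simp [h]

/-- The factor that checks the edges between `u` and `i`. -/
noncomputable def edgeFactor (hA tA : ℕ → ℕ → ℤ) (φ : ℕ → ℕ) (i u : ℕ) : ℤ :=
  (1 - hA u i * (1 - tA (φ u) (φ i))) * (1 - hA i u * (1 - tA (φ i) (φ u)))

/-- The indicator function of the homomorphisms on the first `i` vertices. -/
noncomputable def homInd (hA tA : ℕ → ℕ → ℤ) (φ : ℕ → ℕ) (i : ℕ) : ℤ :=
  ∏ j ∈ Finset.range i, ∏ u ∈ Finset.range j, edgeFactor hA tA φ j u

theorem homInd_succ (hA tA : ℕ → ℕ → ℤ) (φ : ℕ → ℕ) (i : ℕ) :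
    homInd hA tA φ (i + 1)
      = homInd hA tA φ i * ∏ u ∈ Finset.range i, edgeFactor hA tA φ i u :=
  Finset.prod_range_succ _ _

theorem homInd_congr (hA tA : ℕ → ℕ → ℤ) {φ ψ : ℕ → ℕ} {i : ℕ} (h : ∀ u < i, φ u = ψ u) :
    homInd hA tA φ i = homInd hA tA ψ i := by
  refine Finset.prod_congr rfl fun j hj => Finset.prod_congr rfl fun u hu => ?_
  have hj' := Finset.mem_range.1 hj
  have hu' := Finset.mem_range.1 hu
  rw [edgeFactor, edgeFactor, h u (by omega), h j hj']

/-- The table of the dynamic program. -/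
noncomputable def table (H : Digraph (Fin k)) (tA : ℕ → ℕ → ℤ) (R : ℕ → Fin k → ℤ) (N i c : ℕ)
    (P Q : Finset (Fin k)) : ℤ :=
  ∑ φ ∈ prefixMaps N i, if encode N (bdInd H i) φ k = c then
    homInd (adjInd H) tA φ i * (rowProd R φ i P * rowProd R φ i Q) else 0

theorem table_zero (H : Digraph (Fin k)) (tA : ℕ → ℕ → ℤ) (R : ℕ → Fin k → ℤ) (N c : ℕ)
    (P Q : Finset (Fin k)) :
    table H tA R N 0 c P Q = if c = 0 ∧ P = ∅ ∧ Q = ∅ then 1 else 0 := by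
  have h : encode N (bdInd H 0) (fun _ => 0) k = 0 := by simp [encode]
  rw [table, prefixMaps, Finset.sum_singleton, h]
  simp only [homInd, Finset.range_zero, Finset.prod_empty, one_mul, rowProd]
  by_cases hc : c = 0 <;> by_cases hP : P = ∅ <;> by_cases hQ : Q = ∅ <;> simp [hc, hP, hQ, eq_comm]

/-- The digit for the vertex `u` in the code `c`, where the new vertex `i` is mapped to `x`. -/
noncomputable def digit (H : Digraph (Fin k)) (N i x c u : ℕ) : ℕ :=
  if u = i then x else bdInd H i u * (c / N ^ rankOf (bdInd H i) u % N)

/-- The factor for the vertex `u` when the vertex `i` is mapped to `x`. -/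
noncomputable def checkFactor (H : Digraph (Fin k)) (tA : ℕ → ℕ → ℤ) (N i x c u : ℕ) : ℤ :=
  (1 - bdInd H i u * adjInd H u i * (1 - tA (digit H N i x c u) x))
    * (1 - bdInd H i u * adjInd H i u * (1 - tA x (digit H N i x c u)))

/-- The factor for the position `u` in the sign of the move of `a` past the set with mask `p`. -/
def signFactor (p a u : ℕ) : ℤ := 1 - 2 * (if a < u then 1 else 0) * ((p / 2 ^ u % 2 : ℕ) : ℤ)

/-- The contribution of a single step of the inner loop. -/
noncomputable def stepValue (H : Digraph (Fin k)) (tA : ℕ → ℕ → ℤ) (A : ℕ → ℕ → ℤ)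
    (N i x c p q a b : ℕ) : ℤ :=
  A x a * A x b * (1 - ((p / 2 ^ a % 2 : ℕ) : ℤ)) * (1 - ((q / 2 ^ b % 2 : ℕ) : ℤ))
    * ∏ u ∈ Finset.range k, (checkFactor H tA N i x c u * (signFactor p a u * signFactor q b u))

theorem prod_signFactor (P : Finset (Fin k)) (a : Fin k) :
    ∏ u ∈ Finset.range k, signFactor (mask P) a u = moveSign P a := by
  classical
  rw [Finset.prod_range, moveSign]
  symm
  refine Finset.prod_subset_one_on_sdiff (Finset.subset_univ P) ?_ ?_
  · intro u hu
    have : u ∉ P := by simpa using hu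
    rw [signFactor, mask_bit, if_neg this]; simp
  · intro u hu
    rw [signFactor, mask_bit, if_pos hu]
    simp only [Fin.lt_def]
    split_ifs <;> norm_num

/-- A vertex of the new boundary other than `i` already lies in the old one, so the old code
together with `x` determines the new code. -/
theorem encode_update {H : Digraph (Fin k)} {N i x : ℕ} {φ : ℕ → ℕ}
    (hφ : φ ∈ prefixMaps N i) :
    ∑ u ∈ Finset.range k, bdInd H (i + 1) u * digit H N i x (encode N (bdInd H i) φ k) u
        * N ^ rankOf (bdInd H (i + 1)) u
      = encode N (bdInd H (i + 1)) (Function.update φ i x) k := by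
  refine Finset.sum_congr rfl fun u hu => ?_
  congr 1
  rcases bdInd_eq H (i + 1) u with h | h
  · rw [h]; simp
  congr 1
  unfold digit
  split_ifs with hui
  · rw [hui]; simp
  rw [Function.update_of_ne hui]
  obtain ⟨h1, h2, w, hw, hiw, hne⟩ := bdInd_iff.1 h
  have h3 : bdInd H i u = 1 := bdInd_iff.2 ⟨by omega, h2, w, hw, by omega, hne⟩
  rw [h3, one_mul]
  refine decode_encode (fun u _ => bdInd_eq H i u) (fun u _ hu => ?_) h2 h3
  exact (mem_prefixMaps.1 hφ).1 u (bdInd_iff.1 hu).1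

/-- An earlier neighbour of `i` has a neighbour, namely `i`, among the vertices to come. So it lies
on the boundary, and its image can be read off from the code. -/
theorem prod_checkFactor {H : Digraph (Fin k)} {tA : ℕ → ℕ → ℤ} {N i x : ℕ} (hi : i < k)
    {φ : ℕ → ℕ} (hφ : φ ∈ prefixMaps N i) :
    ∏ u ∈ Finset.range k, checkFactor H tA N i x (encode N (bdInd H i) φ k) u
      = ∏ u ∈ Finset.range i, edgeFactor (adjInd H) tA (Function.update φ i x) i u := by
  symm
  refine Finset.prod_subset_one_on_sdiff (Finset.range_mono hi.le) ?_ ?_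
  · intro u hu
    have hu' : i ≤ u := by
      simp only [Finset.mem_sdiff, Finset.mem_range, not_lt] at hu; exact hu.2
    have h0 : bdInd H i u = 0 := by
      rcases bdInd_eq H i u with h | h
      · exact h
      · have := (bdInd_iff.1 h).1; omega
    simp [checkFactor, h0]
  · intro u hu
    have hu' := Finset.mem_range.1 hu
    rw [edgeFactor, checkFactor, Function.update_self, Function.update_of_ne (by omega)]
    by_cases h : bdInd H i u = 1
    · have hd : digit H N i x (encode N (bdInd H i) φ k) u = φ u := by
        rw [digit, if_neg (by omega), h, one_mul]
        refine decode_encode (fun u _ => bdInd_eq H i u) (fun u _ hu => ?_) (by omega) h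
        exact (mem_prefixMaps.1 hφ).1 u (bdInd_iff.1 hu).1
      rw [hd, h]; simp
    · have h0 : bdInd H i u = 0 := (bdInd_eq H i u).resolve_right h
      rw [bdInd_iff] at h
      push Not at h
      have h1 := h hu' (by omega) i hi le_rfl
      rcases adjInd_eq H u i with h2 | h2 <;> rcases adjInd_eq H i u with h3 | h3 <;>
        simp_all

/-- The two exterior products are expanded in columns `a` and `b`. The factors `1 - bit` discard a
column already used; otherwise adding `2^a` to the mask inserts `a` without a carry, and the address
determines the code and both sets. -/
theorem sum_step_inner (x : Fin k → ℤ) (E : Finset (Fin k) → ℤ) (d j : ℕ) (v : ℤ)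
    (P' Q' : Finset (Fin k)) :
    ∑ P : Finset (Fin k), ∑ Q : Finset (Fin k), ∑ a : Fin k, ∑ b : Fin k,
      (if (d * 2 ^ k + (mask P + 2 ^ (a : ℕ))) * 2 ^ k + (mask Q + 2 ^ (b : ℕ))
          = (j * 2 ^ k + mask P') * 2 ^ k + mask Q' then
        x a * x b * (1 - ((mask P / 2 ^ (a : ℕ) % 2 : ℕ) : ℤ))
          * (1 - ((mask Q / 2 ^ (b : ℕ) % 2 : ℕ) : ℤ))
          * (v * (moveSign P a * moveSign Q b)) * (E P * E Q) else 0)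
      = if d = j then v * (wedge x E P' * wedge x E Q') else 0 := by
  have hw : ∀ (P' : Finset (Fin k)), wedge x E P'
      = ∑ P : Finset (Fin k), ∑ a : Fin k,
        if a ∉ P ∧ insert a P = P' then x a * (moveSign P a * E P) else 0 := by
    intro P'
    rw [Finset.sum_comm, wedge]
    refine Finset.sum_congr rfl fun a _ => ?_
    rw [create]
    split_ifs with h
    · rw [Finset.sum_eq_single (P'.erase a), if_pos ⟨by simp, Finset.insert_erase h⟩,
        moveSign_erase_self]
      · intro P _ hP
        rw [if_neg]
        rintro ⟨h1, rfl⟩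
        exact hP (Finset.erase_insert h1).symm
      · simp
    · rw [mul_zero]
      symm
      refine Finset.sum_eq_zero fun P _ => if_neg ?_
      rintro ⟨-, rfl⟩
      simp at h
  have hterm : ∀ (P Q : Finset (Fin k)) (a b : Fin k),
      (if (d * 2 ^ k + (mask P + 2 ^ (a : ℕ))) * 2 ^ k + (mask Q + 2 ^ (b : ℕ))
          = (j * 2 ^ k + mask P') * 2 ^ k + mask Q' then
        x a * x b * (1 - ((mask P / 2 ^ (a : ℕ) % 2 : ℕ) : ℤ))
          * (1 - ((mask Q / 2 ^ (b : ℕ) % 2 : ℕ) : ℤ))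
          * (v * (moveSign P a * moveSign Q b)) * (E P * E Q) else 0)
      = if d = j then v * ((if a ∉ P ∧ insert a P = P' then x a * (moveSign P a * E P) else 0)
        * (if b ∉ Q ∧ insert b Q = Q' then x b * (moveSign Q b * E Q) else 0)) else 0 := by
    intro P Q a b
    rw [mask_bit, mask_bit]
    by_cases ha : a ∈ P
    · simp [ha]
    by_cases hb : b ∈ Q
    · simp [hb]
    simp only [ha, hb, not_false_eq_true, true_and, if_false]
    rw [← mask_insert ha, ← mask_insert hb]
    have hkey : (d * 2 ^ k + mask (insert a P)) * 2 ^ k + mask (insert b Q)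
        = (j * 2 ^ k + mask P') * 2 ^ k + mask Q' ↔ d = j ∧ insert a P = P' ∧ insert b Q = Q' := by
      constructor
      · intro h
        have hp : 0 < 2 ^ k := by positivity
        have l1 := mask_lt (insert a P)
        have l2 := mask_lt (insert b Q)
        have l3 := mask_lt P'
        have l4 := mask_lt Q'
        have e1 := congrArg (· / 2 ^ k) h
        have e2 := congrArg (· % 2 ^ k) h
        simp only [mul_comm _ (2 ^ k), Nat.mul_add_div hp, Nat.mul_add_mod, Nat.div_eq_of_lt l2,
          Nat.div_eq_of_lt l4, Nat.mod_eq_of_lt l2, Nat.mod_eq_of_lt l4, add_zero] at e1 e2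
        have e3 := congrArg (· / 2 ^ k) e1
        have e4 := congrArg (· % 2 ^ k) e1
        simp only [Nat.mul_add_div hp, Nat.mul_add_mod, Nat.div_eq_of_lt l1,
          Nat.div_eq_of_lt l3, Nat.mod_eq_of_lt l1, Nat.mod_eq_of_lt l3, add_zero] at e3 e4
        exact ⟨e3, mask_injective e4, mask_injective e2⟩
      · rintro ⟨rfl, rfl, rfl⟩; rfl
    simp only [hkey]
    by_cases h1 : d = j <;> by_cases h2 : insert a P = P' <;> by_cases h3 : insert b Q = Q' <;>
      simp [h1, h2, h3]
    ring
  simp only [hterm]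
  split_ifs with hd
  · simp only [← Finset.mul_sum, ← Finset.sum_mul, hw P', hw Q']
  · simp

/-- The address computed by a single step of the inner loop, relative to the next table. -/
noncomputable def stepAddr (H : Digraph (Fin k)) (N i x c p q a b : ℕ) : ℕ :=
  ((∑ u ∈ Finset.range k, bdInd H (i + 1) u * digit H N i x c u * N ^ rankOf (bdInd H (i + 1)) u)
    * 2 ^ k + (p + 2 ^ a)) * 2 ^ k + (q + 2 ^ b)

/-- A map on `i + 1` vertices is a map `φ` on `i` vertices together with the image `x` of the next
one. New edges, new code and new row depend on `φ` only through its code and its two exterior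
products, so the sum over `φ` can be grouped by codes. -/
theorem table_succ (H : Digraph (Fin k)) (tA : ℕ → ℕ → ℤ) (A : ℕ → ℕ → ℤ) {N i : ℕ} (hi : i < k)
    (j : ℕ) (P' Q' : Finset (Fin k)) :
    ∑ c ∈ Finset.range (N ^ rankOf (bdInd H i) k), ∑ x ∈ Finset.range N,
      ∑ P : Finset (Fin k), ∑ Q : Finset (Fin k), ∑ a : Fin k, ∑ b : Fin k,
      (if stepAddr H N i x c (mask P) (mask Q) a b = (j * 2 ^ k + mask P') * 2 ^ k + mask Q' then
        stepValue H tA A N i x c (mask P) (mask Q) a b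
          * table H tA (fun x (a : Fin k) => A x a) N i c P Q else 0)
      = table H tA (fun x (a : Fin k) => A x a) N (i + 1) j P' Q' := by
  set R : ℕ → Fin k → ℤ := fun x (a : Fin k) => A x a with hR
  have h1 : ∀ c x, ∑ P : Finset (Fin k), ∑ Q : Finset (Fin k), ∑ a : Fin k, ∑ b : Fin k,
      (if stepAddr H N i x c (mask P) (mask Q) a b = (j * 2 ^ k + mask P') * 2 ^ k + mask Q' then
        stepValue H tA A N i x c (mask P) (mask Q) a b * table H tA R N i c P Q else 0)
      = ∑ φ ∈ prefixMaps N i, if encode N (bdInd H i) φ k = c then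
          (if (∑ u ∈ Finset.range k, bdInd H (i + 1) u * digit H N i x c u
              * N ^ rankOf (bdInd H (i + 1)) u) = j then
            (homInd (adjInd H) tA φ i * ∏ u ∈ Finset.range k, checkFactor H tA N i x c u)
              * (wedge (R x) (rowProd R φ i) P' * wedge (R x) (rowProd R φ i) Q') else 0) else 0 := by
    intro c x
    have h2 : ∀ φ, (if encode N (bdInd H i) φ k = c then
          (if (∑ u ∈ Finset.range k, bdInd H (i + 1) u * digit H N i x c u
              * N ^ rankOf (bdInd H (i + 1)) u) = j then
            (homInd (adjInd H) tA φ i * ∏ u ∈ Finset.range k, checkFactor H tA N i x c u)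
              * (wedge (R x) (rowProd R φ i) P' * wedge (R x) (rowProd R φ i) Q') else 0) else 0)
        = ∑ P : Finset (Fin k), ∑ Q : Finset (Fin k), ∑ a : Fin k, ∑ b : Fin k,
          (if stepAddr H N i x c (mask P) (mask Q) a b = (j * 2 ^ k + mask P') * 2 ^ k + mask Q' then
            stepValue H tA A N i x c (mask P) (mask Q) a b
              * (if encode N (bdInd H i) φ k = c then
                homInd (adjInd H) tA φ i * (rowProd R φ i P * rowProd R φ i Q) else 0) else 0) := by
      intro φ
      by_cases hφ : encode N (bdInd H i) φ k = c
      · simp only [hφ, if_true]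
        rw [← sum_step_inner (R x) (rowProd R φ i)]
        refine Finset.sum_congr rfl fun P _ => Finset.sum_congr rfl fun Q _ =>
          Finset.sum_congr rfl fun a _ => Finset.sum_congr rfl fun b _ => ?_
        unfold stepAddr
        split_ifs
        · rw [stepValue, Finset.prod_mul_distrib, Finset.prod_mul_distrib, prod_signFactor,
            prod_signFactor]
          ring
        · rfl
      · simp [hφ]
    rw [Finset.sum_congr rfl fun φ _ => h2 φ]
    symm
    rw [Finset.sum_comm]
    refine Finset.sum_congr rfl fun P _ => ?_
    rw [Finset.sum_comm]
    refine Finset.sum_congr rfl fun Q _ => ?_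
    rw [Finset.sum_comm]
    refine Finset.sum_congr rfl fun a _ => ?_
    rw [Finset.sum_comm]
    refine Finset.sum_congr rfl fun b _ => ?_
    split_ifs
    · rw [table, Finset.mul_sum]
    · simp
  simp only [h1]
  rw [table, sum_prefixMaps_succ]
  conv_rhs => rw [Finset.sum_comm]
  rw [Finset.sum_comm]
  refine Finset.sum_congr rfl fun x hx => ?_
  rw [Finset.sum_comm]
  refine Finset.sum_congr rfl fun φ hφ => ?_
  -- Each `φ` has exactly one code, so the sum over codes has a single nonzero term; the second goal
  -- is that this code is in range.
  rw [Finset.sum_ite_eq, if_pos]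
  · rw [encode_update hφ, prod_checkFactor hi hφ, homInd_succ, rowProd, Function.update_self,
      homInd_congr (φ := Function.update φ i x) (ψ := φ),
      rowProd_congr (φ := Function.update φ i x) (ψ := φ)]
    · intro u hu; rw [Function.update_of_ne (by omega)]
    · intro u hu; rw [Function.update_of_ne (by omega)]
  · refine Finset.mem_range.2 (encode_lt (fun u _ => bdInd_eq H i u) fun u _ hu => ?_)
    exact (mem_prefixMaps.1 hφ).1 u (bdInd_iff.1 hu).1

/-! #### The final table -/

/-- The extension of a map by `0`. -/
def extendMap {N : ℕ} (f : Fin k → Fin N) (u : ℕ) : ℕ := if h : u < k then f ⟨u, h⟩ else 0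

theorem extendMap_of_lt {N : ℕ} (f : Fin k → Fin N) {u : ℕ} (h : u < k) :
    extendMap f u = f ⟨u, h⟩ := dif_pos h

theorem sum_prefixMaps {A : Type*} [AddCommMonoid A] (N : ℕ) (g : (ℕ → ℕ) → A) :
    ∑ φ ∈ prefixMaps N k, g φ = ∑ f : Fin k → Fin N, g (extendMap f) := by
  symm
  refine Finset.sum_bij (fun f _ => extendMap f) ?_ ?_ ?_ ?_
  · intro f _
    refine mem_prefixMaps.2 ⟨fun u hu => ?_, fun u hu => ?_⟩
    · rw [extendMap_of_lt f hu]; exact (f _).2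
    · rw [extendMap, dif_neg (by omega)]
  · intro f _ f' _ h
    funext u
    have := congrFun h u
    rw [extendMap_of_lt f u.2, extendMap_of_lt f' u.2] at this
    exact Fin.ext this
  · intro φ hφ
    obtain ⟨h1, h2⟩ := mem_prefixMaps.1 hφ
    refine ⟨fun u => ⟨φ u, h1 u u.2⟩, Finset.mem_univ _, funext fun u => ?_⟩
    by_cases hu : u < k
    · rw [extendMap_of_lt _ hu]
    · rw [extendMap, dif_neg hu, h2 u (by omega)]
  · intro f _; rfl

open Classical in
/-- The sum of the squared determinants of the rows chosen by the injective homomorphisms. -/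
noncomputable def detSum {N : ℕ} (H : Digraph (Fin k)) (G : Digraph (Fin N)) (R : ℕ → Fin k → ℤ) :
    ℤ :=
  ∑ f : Fin k → Fin N, if Function.Injective f ∧ ∀ u v, H.Adj u v → G.Adj (f u) (f v) then
    rowProd R (extendMap f) k Finset.univ ^ 2 else 0

theorem edgeFactor_eq {N : ℕ} (H : Digraph (Fin k)) (G : Digraph (Fin N)) (f : Fin k → Fin N)
    (i u : Fin k) :
    edgeFactor (adjInd H) (adjInd G) (extendMap f) i u
      = open Classical in if (H.Adj u i → G.Adj (f u) (f i)) ∧ (H.Adj i u → G.Adj (f i) (f u))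
        then 1 else 0 := by
  rw [edgeFactor, extendMap_of_lt f u.2, extendMap_of_lt f i.2, adjInd_fin, adjInd_fin, adjInd_fin,
    adjInd_fin]
  by_cases h1 : H.Adj u i <;> by_cases h2 : H.Adj i u <;> by_cases h3 : G.Adj (f u) (f i) <;>
    by_cases h4 : G.Adj (f i) (f u) <;> simp [h1, h2, h3, h4]

/-- Only pairs of distinct vertices are checked, in both directions; this suffices because `H` has
no loops. -/
theorem homInd_eq {N : ℕ} {H : Digraph (Fin k)} (hH : ∀ v, ¬ H.Adj v v) (G : Digraph (Fin N))
    (f : Fin k → Fin N) :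
    homInd (adjInd H) (adjInd G) (extendMap f) k
      = open Classical in if ∀ u v, H.Adj u v → G.Adj (f u) (f v) then 1 else 0 := by
  split_ifs with h
  · refine Finset.prod_eq_one fun i hi => Finset.prod_eq_one fun u hu => ?_
    have hi' := Finset.mem_range.1 hi
    have hu' := Finset.mem_range.1 hu
    exact (edgeFactor_eq H G f ⟨i, hi'⟩ ⟨u, by omega⟩).trans (if_pos ⟨h _ _, h _ _⟩)
  · push Not at h
    obtain ⟨u, v, huv, hn⟩ := h
    have hne : (u : ℕ) ≠ v := fun h => hH v (by rwa [Fin.ext h] at huv)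
    have key : ∀ i u : Fin k, u < i → edgeFactor (adjInd H) (adjInd G) (extendMap f) i u = 0 →
        homInd (adjInd H) (adjInd G) (extendMap f) k = 0 := fun i u hui h0 =>
      Finset.prod_eq_zero (Finset.mem_range.2 i.2) (Finset.prod_eq_zero (Finset.mem_range.2 hui) h0)
    rcases lt_or_gt_of_ne hne with h | h
    · exact key v u h ((edgeFactor_eq H G f v u).trans (if_neg fun h => hn (h.1 huv)))
    · exact key u v h ((edgeFactor_eq H G f u v).trans (if_neg fun h => hn (h.2 huv)))

/-- At the end the boundary is empty, so every map has the code `0`. Injectivity is never checked by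
the recursion: non-injective maps repeat a row and drop out. -/
theorem table_last {N : ℕ} {H : Digraph (Fin k)} (hH : ∀ v, ¬ H.Adj v v) (G : Digraph (Fin N))
    (R : ℕ → Fin k → ℤ) :
    table H (adjInd G) R N k 0 Finset.univ Finset.univ = detSum H G R := by
  classical
  have hb : ∀ u, bdInd H k u = 0 := by
    intro u
    refine (bdInd_eq H k u).resolve_right fun h => ?_
    obtain ⟨_, _, w, hw, hw', _⟩ := bdInd_iff.1 h
    omega
  rw [table, sum_prefixMaps, detSum]
  refine Finset.sum_congr rfl fun f _ => ?_
  rw [if_pos (by simp [encode, hb]), homInd_eq hH, ← sq]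
  by_cases hf : Function.Injective f
  · by_cases hh : ∀ u v, H.Adj u v → G.Adj (f u) (f v)
    · rw [if_pos hh, if_pos ⟨hf, hh⟩, one_mul]
    · rw [if_neg hh, if_neg fun h => hh h.2, zero_mul]
  · simp only [hf, false_and, if_false]
    obtain ⟨u, v, huv, hne⟩ := Function.not_injective_iff.1 hf
    have hz : rowProd R (extendMap f) k Finset.univ = 0 := by
      rcases lt_or_gt_of_ne hne with h | h
      · exact rowProd_eq_zero_of_repeat R _ h v.2
          (by rw [extendMap_of_lt f u.2, extendMap_of_lt f v.2]; exact congrArg _ huv) _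
      · exact rowProd_eq_zero_of_repeat R _ h u.2
          (by rw [extendMap_of_lt f u.2, extendMap_of_lt f v.2]; exact congrArg _ huv.symm) _
    rw [hz]; simp

open Classical in
theorem card_injHom_eq {N : ℕ} (H : Digraph (Fin k)) (G : Digraph (Fin N)) :
    Nat.card (InjHom H G) = (Finset.univ.filter fun f : Fin k → Fin N =>
      Function.Injective f ∧ ∀ u v, H.Adj u v → G.Adj (f u) (f v)).card := by
  rw [InjHom, Nat.card_eq_fintype_card, Fintype.card_subtype]

/-- An exterior product of distinct basis vectors is plus or minus a basis vector, so each squared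
determinant is 1 and the sum counts injective homomorphisms. -/
theorem rowProd_single (R : ℕ → Fin k → ℤ) (φ : Fin k → Fin k)
    (hφ : Function.Injective φ) (hR : ∀ x a : Fin k, R x a = if x = a then 1 else 0) (i : ℕ) (hi : i ≤ k) :
    ∃ s : ℤ, s ^ 2 = 1 ∧ ∀ P, rowProd R (extendMap φ) i P
      = if P = Finset.univ.filter (fun a => ∃ u : Fin k, (u : ℕ) < i ∧ φ u = a) then s else 0 := by
  induction i with
  | zero =>
    refine ⟨1, by norm_num, fun P => ?_⟩
    simp [rowProd]
  | succ i ih =>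
    obtain ⟨s, hs, h⟩ := ih (by omega)
    set S := Finset.univ.filter (fun a => ∃ u : Fin k, (u : ℕ) < i ∧ φ u = a) with hS
    set x := φ ⟨i, by omega⟩ with hx
    have hxS : x ∉ S := by
      simp only [hS, Finset.mem_filter, Finset.mem_univ, true_and, not_exists, not_and]
      intro u hu h
      have := congrArg Fin.val (hφ h)
      simp at this
      omega
    have hS' : Finset.univ.filter (fun a => ∃ u : Fin k, (u : ℕ) < i + 1 ∧ φ u = a)
        = insert x S := by
      ext a
      simp only [hS, Finset.mem_filter, Finset.mem_univ, true_and, Finset.mem_insert]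
      constructor
      · rintro ⟨u, hu, rfl⟩
        rcases Nat.lt_succ_iff_lt_or_eq.1 hu with h | h
        · exact Or.inr ⟨u, h, rfl⟩
        · left; rw [hx]; congr 1; exact Fin.ext h
      · rintro (rfl | ⟨u, hu, rfl⟩)
        · exact ⟨⟨i, by omega⟩, by simp, rfl⟩
        · exact ⟨u, by omega, rfl⟩
    refine ⟨moveSign S x * s, ?_, fun P => ?_⟩
    · rw [mul_pow, hs, mul_one, sq, moveSign_mul_self]
    · have e1 : extendMap φ i = x := extendMap_of_lt φ (by omega)
      rw [hS', rowProd, wedge, Finset.sum_eq_single x]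
      · rw [e1, hR, if_pos rfl, one_mul, create]
        split_ifs with h1 h2 h2
        · rw [h, h2, Finset.erase_insert hxS, if_pos rfl, moveSign_insert_self]
        · rw [h, if_neg, mul_zero]
          intro h3
          exact h2 (by rw [← h3, Finset.insert_erase h1])
        · exact absurd (h2 ▸ Finset.mem_insert_self x S) h1
        · rfl
      · intro a _ ha
        rw [e1, hR, if_neg ha.symm, zero_mul]
      · simp

theorem detSum_single (H : Digraph (Fin k)) (R : ℕ → Fin k → ℤ)
    (hR : ∀ x a : Fin k, R x a = if x = a then 1 else 0) :
    detSum H H R = Nat.card (RelIso H.Adj H.Adj) := by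
  classical
  rw [← card_injHom_self, card_injHom_eq, detSum, Finset.card_eq_sum_ones, Finset.sum_filter]
  push_cast
  refine Finset.sum_congr rfl fun f _ => ?_
  split_ifs with h
  · obtain ⟨s, hs, h1⟩ := rowProd_single R f h.1 hR k le_rfl
    rw [h1, if_pos, hs]
    symm
    rw [Finset.filter_eq_self]
    intro a _
    obtain ⟨u, hu⟩ := (Finite.surjective_of_injective h.1) a
    exact ⟨u, u.2, hu⟩
  · rfl

end Prefix

/-! ### The estimator -/

section Estimator
variable {k n : ℕ}

/-- The rows of the random matrix. -/
def signRows (ρ : Fin n → Fin k → Bool) (x : ℕ) (a : Fin k) : ℤ :=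
  if h : x < n then bitSign (ρ ⟨x, h⟩ a) else 0

theorem rowProd_signRows (ρ : Fin n → Fin k → Bool) (f : Fin k → Fin n) (x₀ : Fin n) :
    rowProd (signRows ρ) (extendMap f) k
      = rowProd (signMat ρ) (fun u => if h : u < k then f ⟨u, h⟩ else x₀) k := by
  have h : (fun x : Fin n => signRows ρ x) = signMat ρ := by
    funext x a
    simp [signRows, signMat, signVec]
  rw [← h, rowProd_comp (signRows ρ) (fun x : Fin n => (x : ℕ))]
  refine rowProd_congr (signRows ρ) fun j hj => ?_
  rw [extendMap_of_lt f hj, dif_pos hj]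

theorem sum_rowProd_sq (f : Fin k → Fin n) (hf : Function.Injective f) (x₀ : Fin n) :
    ∑ ρ : Fin n → Fin k → Bool, rowProd (signRows ρ) (extendMap f) k Finset.univ ^ 2
      = Fintype.card (Fin n → Fin k → Bool) * (k.factorial : ℤ) := by
  have h := sum_inn_rowProd (ι := Fin k) (fun u => if h : u < k then f ⟨u, h⟩ else x₀)
    (Fintype.card (Fin k)) le_rfl (by
      rw [Fintype.card_fin]
      intro j l hjl hl h
      rw [dif_pos (by omega), dif_pos hl] at h
      have := congrArg Fin.val (hf h)
      simp at this
      omega)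
  rw [Nat.descFactorial_self] at h
  simp only [inn_rowProd_card] at h
  simp only [Fintype.card_fin k] at h
  rw [← h]
  exact Finset.sum_congr rfl fun ρ _ => by rw [rowProd_signRows ρ f x₀]

theorem sum_rowProd_four (f : Fin k → Fin n) (hf : Function.Injective f) (x₀ : Fin n) :
    ∑ ρ : Fin n → Fin k → Bool, (rowProd (signRows ρ) (extendMap f) k Finset.univ ^ 2) ^ 2
      ≤ Fintype.card (Fin n → Fin k → Bool) * ((k.factorial : ℤ) * (k + 2).descFactorial k) := by
  have h := sum_inn_rowProd_sq_le (ι := Fin k) (fun u => if h : u < k then f ⟨u, h⟩ else x₀)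
    (Fintype.card (Fin k)) le_rfl (by
      rw [Fintype.card_fin]
      intro j l hjl hl h
      rw [dif_pos (by omega), dif_pos hl] at h
      have := congrArg Fin.val (hf h)
      simp at this
      omega)
  rw [Nat.descFactorial_self] at h
  simp only [inn_rowProd_card] at h
  simp only [Fintype.card_fin k] at h
  refine le_trans (le_of_eq ?_) h
  exact Finset.sum_congr rfl fun ρ _ => by rw [rowProd_signRows ρ f x₀]

theorem two_mul_descFactorial (k : ℕ) :
    2 * (k + 2).descFactorial k = (k + 1) * (k + 2) * k.factorial := by
  have h := Nat.factorial_mul_descFactorial (n := k + 2) (k := k) (by omega)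
  rw [Nat.add_sub_cancel_left, Nat.factorial_succ, Nat.factorial_succ] at h
  simp [Nat.factorial] at h
  rw [h]; ring

theorem sum_detSum (H : Digraph (Fin k)) (G : Digraph (Fin n)) (x₀ : Fin n) :
    ∑ ρ : Fin n → Fin k → Bool, detSum H G (signRows ρ)
      = Fintype.card (Fin n → Fin k → Bool) * ((k.factorial : ℤ) * Nat.card (InjHom H G)) := by
  classical
  rw [card_injHom_eq, Finset.card_eq_sum_ones, Finset.sum_filter]
  simp only [detSum]
  rw [Finset.sum_comm]
  push_cast
  rw [Finset.mul_sum, Finset.mul_sum]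
  refine Finset.sum_congr rfl fun f _ => ?_
  split_ifs with h
  · rw [sum_rowProd_sq f h.1 x₀, mul_one]
  · simp

/-- Cauchy-Schwarz over the injective homomorphisms reduces the second moment of the sum to the
fourth moment of one determinant. The correlations between overlapping images play no role, because
all terms have the same mean `k!`. -/
theorem sum_detSum_sq_le (H : Digraph (Fin k)) (G : Digraph (Fin n)) (x₀ : Fin n) :
    2 * ∑ ρ : Fin n → Fin k → Bool, detSum H G (signRows ρ) ^ 2
      ≤ Fintype.card (Fin n → Fin k → Bool) * ((k + 1) * (k + 2)
        * ((k.factorial : ℤ) * Nat.card (InjHom H G)) ^ 2) := by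
  classical
  set F := Finset.univ.filter fun f : Fin k → Fin n =>
      Function.Injective f ∧ ∀ u v, H.Adj u v → G.Adj (f u) (f v) with hF
  have hc : Nat.card (InjHom H G) = F.card := card_injHom_eq H G
  have hd : ∀ ρ : Fin n → Fin k → Bool, detSum H G (signRows ρ)
      = ∑ f ∈ F, rowProd (signRows ρ) (extendMap f) k Finset.univ ^ 2 := by
    intro ρ
    rw [detSum, hF, Finset.sum_filter]
  have hcs : ∀ ρ : Fin n → Fin k → Bool, detSum H G (signRows ρ) ^ 2
      ≤ F.card * ∑ f ∈ F, (rowProd (signRows ρ) (extendMap f) k Finset.univ ^ 2) ^ 2 := by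
    intro ρ
    rw [hd]
    exact sq_sum_le_card_mul_sum_sq
  have h1 : ∑ ρ : Fin n → Fin k → Bool, detSum H G (signRows ρ) ^ 2
      ≤ F.card * ∑ f ∈ F, (Fintype.card (Fin n → Fin k → Bool)
        * ((k.factorial : ℤ) * (k + 2).descFactorial k)) := by
    refine (Finset.sum_le_sum fun ρ _ => hcs ρ).trans ?_
    rw [← Finset.mul_sum, Finset.sum_comm]
    refine mul_le_mul_of_nonneg_left (Finset.sum_le_sum fun f hf => ?_) (by positivity)
    exact sum_rowProd_four f (Finset.mem_filter.1 hf).2.1 x₀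
  rw [Finset.sum_const, nsmul_eq_mul] at h1
  have h2 : (2 : ℤ) * (k + 2).descFactorial k = (k + 1) * (k + 2) * k.factorial := by
    exact_mod_cast two_mul_descFactorial k
  rw [hc]
  calc _ ≤ 2 * ((F.card : ℤ) * (F.card * (Fintype.card (Fin n → Fin k → Bool)
        * ((k.factorial : ℤ) * (k + 2).descFactorial k)))) := by linarith
    _ = F.card ^ 2 * Fintype.card (Fin n → Fin k → Bool) * k.factorial
        * (2 * (k + 2).descFactorial k) := by ring
    _ = _ := by rw [h2]; ring

/-- The main probabilistic estimate. -/
theorem detSum_concentration (H : Digraph (Fin k)) (G : Digraph (Fin n)) (hn : 0 < n) {T : ℕ} {δ : ℝ}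
    (hδ : 0 < δ) (hT : 50 * ((k + 1) * (k + 2)) ≤ δ ^ 2 * T) :
    99 / 100 ≤ coinMeasure {ω | |((∑ t : Fin T, detSum H G (signRows (trialBits n k ω t)) : ℤ) : ℝ)
        - T * (k.factorial * Nat.card (InjHom H G))|
      ≤ δ * (T * (k.factorial * Nat.card (InjHom H G)))} := by
  classical
  have h1 := sum_detSum H G ⟨0, hn⟩
  have h2 := sum_detSum_sq_le H G ⟨0, hn⟩
  have h1' : ∑ ρ : Fin n → Fin k → Bool, (detSum H G (signRows ρ) : ℝ)
      = Fintype.card (Fin n → Fin k → Bool) * ((k.factorial : ℝ) * Nat.card (InjHom H G)) := by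
    exact_mod_cast h1
  have h2' : 2 * ∑ ρ : Fin n → Fin k → Bool, (detSum H G (signRows ρ) : ℝ) ^ 2
      ≤ Fintype.card (Fin n → Fin k → Bool) * ((k + 1) * (k + 2)
        * ((k.factorial : ℝ) * Nat.card (InjHom H G)) ^ 2) := by
    exact_mod_cast h2
  -- The relative variance is taken as `(k + 1) * (k + 2) / 2`, without subtracting 1; this is the
  -- 50 in the hypothesis on `T`.
  have h3 := card_deviation_le (T := T) (fun ρ : Fin n → Fin k → Bool => (detSum H G (signRows ρ) : ℝ))
    ((k.factorial : ℝ) * Nat.card (InjHom H G)) ((k + 1) * (k + 2) / 2) δ (by positivity) h1' (by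
      have : 0 ≤ (Fintype.card (Fin n → Fin k → Bool) : ℝ)
        * ((k.factorial : ℝ) * Nat.card (InjHom H G)) ^ 2 := by positivity
      nlinarith) hδ (by linarith)
  refine (coinMeasure_trials _ h3).trans (le_of_eq ?_)
  simp

end Estimator
open _root_.SubgraphCounting.Expr

/-! ### The program -/

/-- Builds the adjacency matrix in the array `ds` from the adjacency lists in the arrays `dg` and `nb`. -/
def adjProg (dg nb ds nr : ℕ) : Stmt :=
  .for 4 nr (.assign 7 (cell dg (reg 4)) ;;
    .for 5 7 (.store ds (reg 4 * reg nr + cell nb (reg 4 * reg nr + reg 5)) (const 1) ;;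
      .assign 6 (const 1)))

section Adj
variable {w : ℕ} {ω : ℕ → Bool} {B : ℕ} {σ : State}

theorem length_adjList_le {m : ℕ} {G : Digraph (Fin m)} {L : Fin m → List (Fin m)}
    (hL : IsAdjList G L) (u : Fin m) : (L u).length ≤ m := by
  simpa using (hL u).1.length_le_card

theorem nbrArray_eq {m : ℕ} {G : Digraph (Fin m)} {L : Fin m → List (Fin m)}
    (hL : IsAdjList G L) (u : Fin m) {l : ℕ} (hl : l < (L u).length) :
    nbrArray L (u * m + l) = ((L u)[l] : ℕ) := by
  have h1 := length_adjList_le hL u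
  have h2 : (u * m + l) / m = u := by
    rw [mul_comm, Nat.mul_add_div u.pos, Nat.div_eq_of_lt (by omega), add_zero]
  have h3 : (u * m + l) % m = l := by
    rw [mul_comm, Nat.mul_add_mod, Nat.mod_eq_of_lt (by omega)]
  rw [nbrArray, dif_pos (by rw [h2]; exact u.2)]
  simp only [h2, h3, Fin.eta]
  rw [List.getD_eq_getElem _ _ (by simpa using hl)]
  simp

theorem mul_add_inj {m u v u' v' : ℕ} (hv : v < m) (hv' : v' < m) :
    u * m + v = u' * m + v' ↔ u = u' ∧ v = v' := by
  constructor
  · intro h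
    have e1 := congrArg (· / m) h
    have hm : 0 < m := by omega
    simp only [mul_comm _ m, Nat.mul_add_div hm, Nat.div_eq_of_lt hv, Nat.div_eq_of_lt hv',
      add_zero] at e1
    subst e1
    exact ⟨rfl, by omega⟩
  · rintro ⟨rfl, rfl⟩; rfl

/-- Besides the matrix, register 6 records whether any edge was seen; for `H` this later decides
whether the lists of `G` are read at all. -/
theorem adjProg_spec {m : ℕ} {G : Digraph (Fin m)} {L : Fin m → List (Fin m)}
    (hL : IsAdjList G L) {dg nb ds nr : ℕ} (hnr : nr < 4) (hdg : dg < 4) (hnb : nb < 4) (hds : 4 ≤ ds)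
    (hm : σ.reg nr = m) (h1 : σ.mem dg = degArray L) (h2 : σ.mem nb = nbrArray L)
    (h3 : ∀ i, σ.mem ds i = 0) :
    WP w ω B (adjProg dg nb ds nr) (m * (m * 4 + 5) + 2) (fun τ =>
      (∀ u v, u < m → v < m → τ.mem ds (u * m + v) = adjInd G u v) ∧
      ((τ.reg 6 = σ.reg 6 ∧ ∀ u v, ¬ G.Adj u v) ∨ (τ.reg 6 = 1 ∧ ∃ u v, G.Adj u v))) σ := by
  have hcap : (1 : ℤ).natAbs < 2 ^ (B + 8) := Nat.one_lt_two_pow (by omega)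
  refine WP.for m (m * 4 + 3) (fun j τ =>
    (∀ u v, u < m → v < m → τ.mem ds (u * m + v) = if u < j then adjInd G u v else 0) ∧
      ((τ.reg 6 = σ.reg 6 ∧ ∀ u v : Fin m, u < j → ¬ G.Adj u v)
        ∨ (τ.reg 6 = 1 ∧ ∃ u v : Fin m, u < j ∧ G.Adj u v)))
    hm (by simp [Stmt.for, Stmt.wr]; omega) (by simp [Stmt.for, Stmt.wr]) ?_ ?_ ?_ ?_
  · intro j τ z h; simpa using h
  · simp [h3]
  · intro j τ hj hτ hA h4 ⟨hI, hI'⟩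
    have hd : τ.mem dg = degArray L := by
      rw [hA.mem dg (by simp [Stmt.for, Stmt.wm]; omega), h1]
    have hn : τ.mem nb = nbrArray L := by
      rw [hA.mem nb (by simp [Stmt.for, Stmt.wm]; omega), h2]
    have hmr : τ.reg nr = m := by
      rw [hA.reg nr (by simp [Stmt.for, Stmt.wr]; omega), hm]
    set row := L ⟨j, hj⟩ with hrow
    have hlen : row.length ≤ m := length_adjList_le hL ⟨j, hj⟩
    have h7 : (Expr.cell dg (reg 4)).eval τ = (row.length : ℤ) := by
      simp [h4, hd, degArray, hj, hrow]
    refine WP.le (WP.assign_seq (row.length : ℤ) h7 rfl ?_ (WP.for row.length 2 (fun l ρ =>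
      (∀ u v, u < m → v < m → ρ.mem ds (u * m + v) = if u < j then adjInd G u v else
          if ∃ (hv : v < m), u = j ∧ (⟨v, hv⟩ : Fin m) ∈ row.take l then 1 else 0) ∧
      -- Register 6 keeps its value only while no list entry has been processed, hence `l = 0`.
      ((ρ.reg 6 = σ.reg 6 ∧ l = 0 ∧ ∀ u v : Fin m, u < j → ¬ G.Adj u v)
        ∨ (ρ.reg 6 = 1 ∧ ∃ u v : Fin m, u < j + 1 ∧ G.Adj u v)))
      (by simp) (by simp [Stmt.wr]) (by simp [Stmt.wr]) ?_ ?_ ?_ ?_)) (by omega)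
    · rw [← h7]; exact hτ.2 _ _
    · intro l ρ z h; simpa using h
    · refine ⟨fun u v hu hv => by simp [hI u v hu hv], ?_⟩
      rcases hI' with h | ⟨h, u, v, h', h''⟩
      · left; simpa using h
      · right; exact ⟨by simpa using h, u, v, by omega, h''⟩
    · intro l ρ hl hρ hA' h5 ⟨hJ, hJ'⟩
      have hn' : ρ.mem nb = nbrArray L := by
        rw [hA'.mem nb (by simp [Stmt.wm]; omega)]; simpa using hn
      have hmr' : ρ.reg nr = m := by
        rw [hA'.reg nr (by simp [Stmt.wr]; omega), State.setReg_reg, if_neg (by omega), hmr]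
      have h4' : ρ.reg 4 = j := by
        rw [hA'.reg 4 (by simp [Stmt.wr])]; simpa using h4
      have hnbr : ρ.mem nb (j * m + l) = ((row[l] : Fin m) : ℕ) := by
        rw [hn']; exact nbrArray_eq hL ⟨j, hj⟩ hl
      have haddr : ((reg 4 * reg nr + cell nb (reg 4 * reg nr + reg 5) : Expr)).eval ρ
          = ((j * m + (row[l] : Fin m) : ℕ) : ℤ) := by
        have : ((j : ℤ) * m + l).toNat = j * m + l := by
          rw [← Nat.cast_mul, ← Nat.cast_add, Int.toNat_natCast]
        simp [h4', hmr', h5, this, hnbr]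
      have hadj : G.Adj ⟨j, hj⟩ row[l] := ((hL ⟨j, hj⟩).2 _).1 (List.getElem_mem hl)
      refine WP.store_seq _ 1 haddr rfl rfl rfl hcap (WP.assign 1 rfl rfl hcap ⟨?_, ?_⟩)
      · intro u v hu hv
        simp only [State.setReg_mem, State.setCell_mem, if_true, Function.update_apply,
          mul_add_inj hv row[l].2, hJ u v hu hv]
        have hmem : ∀ x, x ∈ row.take (l + 1) ↔ x ∈ row.take l ∨ x = row[l] := by
          intro x
          rw [List.take_succ_eq_append_getElem hl, List.mem_append, List.mem_singleton]
        simp only [hmem]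
        by_cases huj : u = j
        · subst huj
          by_cases hvr : v = row[l]
          · simp [hvr]
          · have : (⟨v, hv⟩ : Fin m) ≠ row[l] := fun h => hvr (congrArg Fin.val h)
            simp only [hvr, this, hv, lt_irrefl, if_false, and_false, or_false]
        · simp [huj]
      · right
        exact ⟨by simp, ⟨j, hj⟩, row[l], by simp, hadj⟩
    · intro ρ hρ hA' ⟨hJ, hJ'⟩
      refine ⟨fun u v hu hv => ?_, ?_⟩
      · rw [hJ u v hu hv, List.take_length]
        by_cases huj : u < j
        · simp [huj, Nat.lt_succ_of_lt huj]
        · by_cases huj' : u = j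
          · subst huj'
            have := adjInd_fin G ⟨u, hu⟩ ⟨v, hv⟩
            simp only at this
            rw [this, if_neg huj]
            have hiff : (∃ hv : v < m, u = u ∧ (⟨v, hv⟩ : Fin m) ∈ row) ↔ G.Adj ⟨u, hu⟩ ⟨v, hv⟩ := by
              rw [← (hL ⟨u, hu⟩).2]
              exact ⟨fun ⟨_, _, h⟩ => h, fun h => ⟨hv, rfl, h⟩⟩
            by_cases hadj : G.Adj ⟨u, hu⟩ ⟨v, hv⟩
            · rw [if_pos (hiff.2 hadj), if_pos (Nat.lt_succ_self u), if_pos hadj]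
            · rw [if_neg (mt hiff.1 hadj), if_pos (Nat.lt_succ_self u), if_neg hadj]
          · have : ¬ u < j + 1 := by omega
            simp [huj, huj', this]
      · rcases hJ' with ⟨h, h', h''⟩ | h
        · left
          refine ⟨h, fun u v hu hadj => ?_⟩
          rcases Nat.lt_succ_iff_lt_or_eq.1 hu with hu' | hu'
          · exact h'' u v hu' hadj
          · have : u = ⟨j, hj⟩ := Fin.ext hu'
            subst this
            have hv := ((hL ⟨j, hj⟩).2 v).2 hadj
            rw [← hrow, List.length_eq_zero_iff.1 h'] at hv
            simp at hv
        · right; exact h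
  · intro τ _ _ ⟨hI, hI'⟩
    refine ⟨fun u v hu hv => by rw [hI u v hu hv, if_pos hu], ?_⟩
    rcases hI' with ⟨h, h'⟩ | ⟨h, u, v, -, h'⟩
    · exact Or.inl ⟨h, fun u v => h' u v u.2⟩
    · exact Or.inr ⟨h, u, v, h'⟩

end Adj

/-! ### Constants of the algorithm -/

/-- Computes the powers of two (array 5, register 8), the size of a table (register 9), the factorial of `k`
(register 10) and the identity matrix (array 11). -/
def constProg : Stmt :=
  .assign 8 (const 1) ;; .assign 9 (const 4) ;; .assign 10 (const 1) ;;
  .for 4 1 (.store 5 (reg 4) (reg 8) ;; .assign 8 (reg 8 * const 2) ;;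
    .assign 9 (reg 9 * (const 4 * reg 0)) ;; .assign 10 (reg 10 * (reg 4 + const 1)) ;;
    .store 11 (reg 4 * reg 1 + reg 4) (const 1))

section Const
variable {w : ℕ} {ω : ℕ → Bool} {B : ℕ} {σ : State}

theorem constProg_spec {n k : ℕ} (hn : σ.reg 0 = n) (hk : σ.reg 1 = k) (hn0 : 0 < n)
    (h11 : ∀ i, σ.mem 11 i = 0)
    (hB : 4 * (4 * n) ^ k < 2 ^ (B + 8)) (hB' : k.factorial < 2 ^ (B + 8)) :
    WP w ω B constProg (k * 7 + 5) (fun τ =>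
      (∀ a < k, τ.mem 5 a = (2 ^ a : ℕ)) ∧ τ.reg 8 = (2 ^ k : ℕ) ∧ τ.reg 9 = (4 * (4 * n) ^ k : ℕ) ∧
      τ.reg 10 = k.factorial ∧
      ∀ x a, x < k → a < k → τ.mem 11 (x * k + a) = if x = a then 1 else 0) σ := by
  have hcap : (1 : ℤ).natAbs < 2 ^ (B + 8) := Nat.one_lt_two_pow (by omega)
  have hcap4 : (4 : ℤ).natAbs < 2 ^ (B + 8) :=
    (show (4 : ℤ).natAbs < 2 ^ 8 by decide).trans_le (Nat.pow_le_pow_right (by omega) (by omega))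
  have hZ : ∀ j ≤ k, 4 * (4 * n) ^ j < 2 ^ (B + 8) := fun j hj =>
    (Nat.mul_le_mul_left 4 (Nat.pow_le_pow_right (by omega) hj)).trans_lt hB
  have h2 : ∀ j ≤ k, 2 ^ j < 2 ^ (B + 8) := fun j hj =>
    ((Nat.pow_le_pow_left (by omega) j).trans (Nat.le_mul_of_pos_left _ (by omega))).trans_lt (hZ j hj)
  refine WP.le (WP.assign_seq 1 rfl rfl hcap (WP.assign_seq 4 rfl rfl hcap4 (WP.assign_seq 1 rfl rfl hcap
    (WP.for k 5 (fun j τ =>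
      (∀ a < j, τ.mem 5 a = (2 ^ a : ℕ)) ∧ τ.reg 8 = (2 ^ j : ℕ) ∧ τ.reg 9 = (4 * (4 * n) ^ j : ℕ) ∧
      τ.reg 10 = j.factorial ∧
      ∀ x a, x < k → a < k → τ.mem 11 (x * k + a) = if x = a ∧ x < j then 1 else 0)
      (by simpa using hk) (by decide) (by decide) ?_ ?_ ?_ ?_)))) (by omega)
  · intro j τ z h; simpa using h
  · simp [h11]
  · intro j τ hj hτ hA h4 ⟨i1, i2, i3, i4, i5⟩
    have hn' : τ.reg 0 = n := by rw [hA.reg 0 (by decide)]; simpa using hn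
    have hk' : τ.reg 1 = k := by rw [hA.reg 1 (by decide)]; simpa using hk
    refine WP.store_seq j (2 ^ j : ℕ) (by simpa using h4) (by simpa using i2) rfl rfl
      (by simpa using h2 j hj.le) ?_
    refine WP.assign_seq (2 ^ (j + 1) : ℕ) (by simp [i2, pow_succ]) rfl
      (by simpa using h2 (j + 1) hj) ?_
    refine WP.assign_seq (4 * (4 * n) ^ (j + 1) : ℕ) (by simp [i3, hn', pow_succ, mul_assoc]) rfl
      (by rw [Int.natAbs_natCast]; exact hZ (j + 1) hj) ?_
    refine WP.assign_seq ((j + 1).factorial : ℕ) (by simp [i4, h4, Nat.factorial_succ, mul_comm]) rfl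
      (by
        rw [Int.natAbs_natCast]
        exact (Nat.factorial_le hj).trans_lt hB') ?_
    refine WP.store (j * k + j) 1 (by simp [h4, hk']) rfl rfl rfl hcap ⟨?_, by simp, by simp, by simp, ?_⟩
    · intro a ha
      simp only [State.setCell_mem, State.setReg_mem, if_true]
      rcases Nat.lt_succ_iff_lt_or_eq.1 ha with h | h
      · simp [h.ne, i1 a h]
      · simp [h]
    · intro x a hx ha
      simp only [State.setCell_mem, State.setReg_mem, if_true, Function.update_apply,
        mul_add_inj ha hj, show (11 = 5) = False by simp, if_false, i5 x a hx ha]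
      by_cases hxj : x = j
      · subst hxj
        by_cases hax : a = x
        · simp [hax]
        · simp [hax, Ne.symm hax]
      · have : x < j + 1 ↔ x < j := by omega
        simp [hxj, this]
  · intro τ _ _ ⟨i1, i2, i3, i4, i5⟩
    exact ⟨i1, i2, i3, i4, fun x a hx ha => by simp [i5 x a hx ha, hx]⟩

end Const

/-! ### Boundaries of initial segments -/

/-- Marks in the arrays 14 and 15 the boundaries of the sets of the first `i` and of the first `i + 1`
vertices, where `i` is register 32, and computes the number of maps on the first of them. -/
def flagProg : Stmt :=
  .assign 33 (const 1) ;;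
  .for 34 1 (.assign 35 (const 0) ;; .assign 36 (const 0) ;;
    .for 37 1 (
      .ite ((reg 34).lt (reg 32) * (const 1 - (reg 37).lt (reg 32)) *
          (cell 9 (reg 34 * reg 1 + reg 37) + cell 9 (reg 37 * reg 1 + reg 34)))
        (.assign 35 (const 1)) .skip ;;
      .ite ((reg 34).lt (reg 32 + const 1) * (const 1 - (reg 37).lt (reg 32 + const 1)) *
          (cell 9 (reg 34 * reg 1 + reg 37) + cell 9 (reg 37 * reg 1 + reg 34)))
        (.assign 36 (const 1)) .skip) ;;
    .store 14 (reg 34) (reg 35) ;; .store 15 (reg 34) (reg 36) ;;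
    .assign 33 (reg 33 * (const 1 + reg 35 * (reg 20 - const 1))))

/-- What the dynamic program needs to find in the memory. -/
structure HomEnv {k : ℕ} (H : Digraph (Fin k)) (tA A : ℕ → ℕ → ℤ) (N Z ta : ℕ) (σ : State) : Prop where
  hk : σ.reg 1 = k
  pk : σ.reg 8 = (2 ^ k : ℕ)
  hZ : σ.reg 9 = Z
  hN : σ.reg 20 = N
  pow : ∀ a < k, σ.mem 5 a = (2 ^ a : ℕ)
  adj : ∀ u v, u < k → v < k → σ.mem 9 (u * k + v) = adjInd H u v
  tgt : ∀ x y, x < N → y < N → σ.mem ta (x * N + y) = tA x y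
  mat : ∀ x a, x < N → a < k → σ.mem 11 (x * k + a) = A x a

theorem HomEnv.congr {k : ℕ} {H : Digraph (Fin k)} {tA A : ℕ → ℕ → ℤ} {N Z ta : ℕ} {σ τ : State}
    {R M : List ℕ} {d : Bool} (h : HomEnv H tA A N Z ta σ) (hA : Agree R M d σ τ)
    (hR : ∀ x ∈ [1, 8, 9, 20], x ∉ R) (hM : ∀ a ∈ [5, 9, ta, 11], a ∉ M) :
    HomEnv H tA A N Z ta τ := by
  simp only [List.mem_cons, forall_eq_or_imp, List.not_mem_nil, false_imp_iff, implies_true,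
    and_true] at hR hM
  obtain ⟨r1, r2, r3, r4⟩ := hR
  obtain ⟨m1, m2, m3, m4⟩ := hM
  constructor
  · rw [hA.reg _ r1, h.hk]
  · rw [hA.reg _ r2, h.pk]
  · rw [hA.reg _ r3, h.hZ]
  · rw [hA.reg _ r4, h.hN]
  · rw [hA.mem _ m1]; exact h.pow
  · rw [hA.mem _ m2]; exact h.adj
  · rw [hA.mem _ m3]; exact h.tgt
  · rw [hA.mem _ m4]; exact h.mat

section Flag
variable {w : ℕ} {ω : ℕ → Bool} {B : ℕ} {σ : State} {k : ℕ} {H : Digraph (Fin k)}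
  {tA A : ℕ → ℕ → ℤ} {N Z ta : ℕ}

theorem flagProg_spec (henv : HomEnv H tA A N Z ta σ) (hta : ta = 9 ∨ ta = 10) {i : ℕ}
    (hi : σ.reg 32 = i) (hN : 0 < N) (hB : N ^ k < 2 ^ (B + 8)) :
    WP w ω B flagProg (k * (6 * k + 9) + 3) (fun τ =>
      (∀ u < k, τ.mem 14 u = bdInd H i u) ∧ (∀ u < k, τ.mem 15 u = bdInd H (i + 1) u) ∧
      τ.reg 33 = (N ^ rankOf (bdInd H i) k : ℕ)) σ := by
  classical
  have hcap : (1 : ℤ).natAbs < 2 ^ (B + 8) := Nat.one_lt_two_pow (by omega)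
  have hcap0 : (0 : ℤ).natAbs < 2 ^ (B + 8) := by simp
  refine WP.le (WP.assign_seq 1 rfl rfl hcap (WP.for k (6 * k + 7) (fun j τ =>
      (∀ u < j, τ.mem 14 u = bdInd H i u) ∧ (∀ u < j, τ.mem 15 u = bdInd H (i + 1) u) ∧
      τ.reg 33 = (N ^ rankOf (bdInd H i) j : ℕ))
      (by simpa using henv.hk) (by decide) (by decide) ?_ ?_ ?_ ?_)) (le_of_eq (by ring))
  · intro j τ z h; simpa using h
  · simp [rankOf]
  · intro u τ hu hτ hA h34 ⟨i1, i2, i3⟩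
    have h32 : τ.reg 32 = i := by rw [hA.reg 32 (by decide)]; simpa using hi
    have e1 : HomEnv H tA A N Z ta (σ.setReg 33 1) :=
      ⟨by simpa using henv.hk, by simpa using henv.pk, by simpa using henv.hZ, by simpa using henv.hN,
        henv.pow, henv.adj, henv.tgt, henv.mat⟩
    have e2 : HomEnv H tA A N Z ta τ := e1.congr hA (by decide) (by
      rcases hta with rfl | rfl <;> decide)
    -- The value of the flag of `u` for the first `i` vertices after the first `j` candidates for an
    -- outside neighbour.
    let p : ℕ → ℕ → ℤ := fun i j => if ∃ w < j, u < i ∧ i ≤ w ∧ adjInd H u w + adjInd H w u ≠ 0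
      then 1 else 0
    have hp0 : ∀ i, p i 0 = 0 := by intro i; simp [p]
    have hpb : ∀ i, p i k = bdInd H i u := by
      intro i
      by_cases h : bdInd H i u = 1
      · obtain ⟨h1, h2, w, h3, h4, h5⟩ := bdInd_iff.1 h
        rw [h]; simp only [p]
        rw [if_pos ⟨w, h3, h1, h4, h5⟩]; rfl
      · have h0 := (bdInd_eq H i u).resolve_right h
        rw [h0]; simp only [p]
        rw [if_neg]; · rfl
        rintro ⟨w, h3, h1, h4, h5⟩
        exact h (bdInd_iff.2 ⟨h1, hu, w, h3, h4, h5⟩)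
    have hps : ∀ i j, p i (j + 1) = if u < i ∧ i ≤ j ∧ adjInd H u j + adjInd H j u ≠ 0 then 1
        else p i j := by
      intro i j
      simp only [p, Nat.lt_succ_iff_lt_or_eq]
      by_cases h : u < i ∧ i ≤ j ∧ adjInd H u j + adjInd H j u ≠ 0
      · rw [if_pos h, if_pos ⟨j, Or.inr rfl, h⟩]
      · rw [if_neg h]
        congr 1
        refine propext ⟨?_, fun ⟨w, h1, h2⟩ => ⟨w, Or.inl h1, h2⟩⟩
        rintro ⟨w, h1 | rfl, h2⟩
        · exact ⟨w, h1, h2⟩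
        · exact absurd h2 h
    refine WP.le (WP.assign_seq 0 rfl rfl hcap0 (WP.assign_seq 0 rfl rfl hcap0 (WP.seq_agree
      (WP.for k 4 (fun j τ => τ.reg 35 = p i j ∧ τ.reg 36 = p (i + 1) j)
        (by simpa using e2.hk) (by decide) (by decide) ?_ ?_ ?_ (Q := fun τ => τ.reg 35 = p i k
          ∧ τ.reg 36 = p (i + 1) k) ?_) ?_ (m' := 3)))) (le_of_eq (by ring))
    · intro j τ z h; simpa using h
    · simp [hp0]
    · intro j ρ hj hρ hA' h37 ⟨j1, j2⟩
      have r1 : ρ.reg 1 = k := by rw [hA'.reg 1 (by decide)]; simpa using e2.hk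
      have r34 : ρ.reg 34 = u := by rw [hA'.reg 34 (by decide)]; simpa using h34
      have r32 : ρ.reg 32 = i := by rw [hA'.reg 32 (by decide)]; simpa using h32
      have m9 : ρ.mem 9 = τ.mem 9 := by rw [hA'.mem 9 (by decide)]; rfl
      have t1 : ((u : ℤ) * k + j).toNat = u * k + j := by
        rw [← Nat.cast_mul, ← Nat.cast_add, Int.toNat_natCast]
      have t2 : ((j : ℤ) * k + u).toNat = j * k + u := by
        rw [← Nat.cast_mul, ← Nat.cast_add, Int.toNat_natCast]
      have a1 := e2.adj u j hu hj
      have a2 := e2.adj j u hj hu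
      have hc : ∀ i' : ℕ, ((if (u : ℤ) < i' then 1 else 0) * (1 - if (j : ℤ) < i' then 1 else 0) *
          (adjInd H u j + adjInd H j u) : ℤ) ≠ 0 ↔ u < i' ∧ i' ≤ j ∧ adjInd H u j + adjInd H j u ≠ 0 := by
        intro i'
        rw [← and_assoc, Int.mul_ne_zero_iff, ← not_lt]
        simp only [Nat.cast_lt]
        refine and_congr_left fun _ => ?_
        split_ifs <;> simp_all
      have hc1 := hc (i + 1)
      push_cast at hc1
      refine WP.seq (m := 2) (m' := 2) (WP.ite rfl ?_ ?_)
      · intro h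
        simp only [eval_mul, eval_lt, eval_sub, eval_add, eval_const, eval_reg, eval_cell, r34, r32,
          r1, h37, t1, t2, m9, a1, a2] at h
        refine WP.assign 1 rfl rfl hcap (WP.ite rfl ?_ ?_)
        · intro h'
          simp only [eval_mul, eval_lt, eval_sub, eval_add, eval_const, eval_reg, eval_cell,
            State.setReg_reg, State.setReg_mem, Nat.reduceEqDiff, if_false, r34, r32,
            r1, h37, t1, t2, m9, a1, a2] at h'
          refine WP.assign 1 rfl rfl hcap ⟨?_, ?_⟩
          · simp [hps, (hc i).1 h]
          · rw [hps, if_pos (hc1.1 h')]; simp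
        · intro h'
          simp only [eval_mul, eval_lt, eval_sub, eval_add, eval_const, eval_reg, eval_cell,
            State.setReg_reg, State.setReg_mem, Nat.reduceEqDiff, if_false, r34, r32,
            r1, h37, t1, t2, m9, a1, a2] at h'
          refine WP.skip ⟨?_, ?_⟩
          · simp [hps, (hc i).1 h]
          · rw [hps, if_neg (fun hh => hc1.2 hh h')]; simpa using j2
      · intro h
        simp only [eval_mul, eval_lt, eval_sub, eval_add, eval_const, eval_reg, eval_cell, r34, r32,
          r1, h37, t1, t2, m9, a1, a2] at h
        refine WP.skip (WP.ite rfl ?_ ?_)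
        · intro h'
          simp only [eval_mul, eval_lt, eval_sub, eval_add, eval_const, eval_reg, eval_cell, r34, r32,
            r1, h37, t1, t2, m9, a1, a2] at h'
          refine WP.assign 1 rfl rfl hcap ⟨?_, ?_⟩
          · rw [hps, if_neg (fun hh => (hc i).2 hh h)]; simpa using j1
          · rw [hps, if_pos (hc1.1 h')]; simp
        · intro h'
          simp only [eval_mul, eval_lt, eval_sub, eval_add, eval_const, eval_reg, eval_cell, r34, r32,
            r1, h37, t1, t2, m9, a1, a2] at h'
          refine WP.skip ⟨?_, ?_⟩
          · rw [hps, if_neg (fun hh => (hc i).2 hh h)]; simpa using j1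
          · rw [hps, if_neg (fun hh => hc1.2 hh h')]; simpa using j2
    · intro ρ _ _ h; exact h
    · intro ρ hρ hA' ⟨j1, j2⟩
      rw [hpb] at j1 j2
      have r34 : ρ.reg 34 = u := by rw [hA'.reg 34 (by decide)]; simpa using h34
      have r33 : ρ.reg 33 = (N ^ rankOf (bdInd H i) u : ℕ) := by
        rw [hA'.reg 33 (by decide)]; simpa using i3
      have r20 : ρ.reg 20 = N := by rw [hA'.reg 20 (by decide)]; simpa using e2.hN
      have m14 : ρ.mem 14 = τ.mem 14 := by rw [hA'.mem 14 (by decide)]; rfl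
      have m15 : ρ.mem 15 = τ.mem 15 := by rw [hA'.mem 15 (by decide)]; rfl
      have hb : ∀ i, (bdInd H i u : ℤ).natAbs < 2 ^ (B + 8) := by
        intro i
        rcases bdInd_eq H i u with h | h <;> rw [h]
        · simp
        · exact hcap
      refine WP.store_seq u _ (by simpa using r34) (by simpa using j1) rfl rfl (hb i) ?_
      refine WP.store_seq u _ (by simpa using r34) (by simpa using j2) rfl rfl (hb (i + 1)) ?_
      -- For a flag `f` in `{0, 1}` the factor `1 + f * (N - 1)` equals `N ^ f`.
      refine WP.assign (N ^ rankOf (bdInd H i) (u + 1) : ℕ) ?_ rfl ?_ ⟨?_, ?_, ?_⟩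
      · simp only [eval_mul, eval_sub, eval_add, eval_const, eval_reg, State.setCell_reg, r33, j1, r20,
          rankOf_succ, pow_add]
        rcases bdInd_eq H i u with h | h <;> rw [h] <;> simp
      · rw [Int.natAbs_natCast]
        refine (Nat.pow_le_pow_right hN ?_).trans_lt hB
        calc rankOf (bdInd H i) (u + 1) ≤ ∑ v ∈ Finset.range (u + 1), 1 :=
              Finset.sum_le_sum fun v _ => by rcases bdInd_eq H i v with h | h <;> omega
          _ ≤ k := by simpa using hu
      · intro v hv
        simp only [State.setReg_mem, State.setCell_mem, show (14 = 15) = False by simp, if_false, if_true,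
          Function.update_apply, m14]
        rcases Nat.lt_succ_iff_lt_or_eq.1 hv with h | h
        · rw [if_neg h.ne]; exact i1 v h
        · rw [if_pos h, h]
      · intro v hv
        simp only [State.setReg_mem, State.setCell_mem, show (15 = 14) = False by simp, if_false, if_true,
          Function.update_apply, m15]
        rcases Nat.lt_succ_iff_lt_or_eq.1 hv with h | h
        · rw [if_neg h.ne]; exact i2 v h
        · rw [if_pos h, h]
      · simp
  · intro τ _ _ h; exact h

end Flag

/-! ### A single step of the dynamic program -/

/-- Handles the vertex in register 51 in a single step of the dynamic program. -/
def digitProg (ta : ℕ) : Stmt :=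
  .assign 52 ((reg 51).eq (reg 32) * reg 45 + cell 14 (reg 51) * (reg 46 % reg 20)) ;;
  .assign 46 (reg 46 / (const 1 + cell 14 (reg 51) * (reg 20 - const 1))) ;;
  .assign 50 (reg 50 * (((const 1 - cell 14 (reg 51) * cell 9 (reg 51 * reg 1 + reg 32)
      * (const 1 - cell ta (reg 52 * reg 20 + reg 45)))
    * (const 1 - cell 14 (reg 51) * cell 9 (reg 32 * reg 1 + reg 51)
      * (const 1 - cell ta (reg 45 * reg 20 + reg 52))))
    * ((const 1 - const 2 * (reg 42).lt (reg 51) * (reg 44 / cell 5 (reg 51) % const 2))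
      * (const 1 - const 2 * (reg 41).lt (reg 51) * (reg 43 / cell 5 (reg 51) % const 2))))) ;;
  .assign 48 (reg 48 + cell 15 (reg 51) * reg 52 * reg 49) ;;
  .assign 49 (reg 49 * (const 1 + cell 15 (reg 51) * (reg 20 - const 1)))

theorem toNat_mul_add (a b c : ℕ) : ((a : ℤ) * b + c).toNat = a * b + c := by
  rw [← Nat.cast_mul, ← Nat.cast_add, Int.toNat_natCast]

section Digit
variable {w : ℕ} {ω : ℕ → Bool} {B : ℕ} {σ : State} {k : ℕ} {H : Digraph (Fin k)}
  {tA A : ℕ → ℕ → ℤ} {N Z ta : ℕ}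

theorem digit_lt {i x c u : ℕ} (hx : x < N) : digit H N i x c u < N := by
  unfold digit
  split_ifs
  · exact hx
  · have := Nat.mod_lt (c / N ^ rankOf (bdInd H i) u) (by omega : 0 < N)
    rcases bdInd_eq H i u with h | h <;> rw [h]
    · omega
    · omega

theorem bdInd_self (i : ℕ) : bdInd H i i = 0 := by
  refine (bdInd_eq H i i).resolve_right fun h => ?_
  have := (bdInd_iff.1 h).1
  omega

theorem abs_checkFactor_le (htA : ∀ x y, tA x y = 0 ∨ tA x y = 1) (i x c u : ℕ) :
    |checkFactor H tA N i x c u| ≤ 1 := by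
  unfold checkFactor
  rcases bdInd_eq H i u with h1 | h1 <;> rcases adjInd_eq H u i with h2 | h2 <;>
  rcases adjInd_eq H i u with h3 | h3 <;> rcases htA (digit H N i x c u) x with h4 | h4 <;>
  rcases htA x (digit H N i x c u) with h5 | h5 <;> simp [h1, h2, h3, h4, h5]

theorem abs_signFactor_le (p a u : ℕ) : |signFactor p a u| ≤ 1 := by
  unfold signFactor
  rcases Nat.mod_two_eq_zero_or_one (p / 2 ^ u) with h | h <;> rw [h] <;> split_ifs <;> simp

theorem abs_mul_le_one {a b : ℤ} (ha : |a| ≤ 1) (hb : |b| ≤ 1) : |a * b| ≤ 1 := by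
  rw [abs_mul]; exact mul_le_one₀ ha (abs_nonneg b) hb

theorem abs_prod_le_one (f : ℕ → ℤ) (h : ∀ u, |f u| ≤ 1) (U : ℕ) :
    |∏ u ∈ Finset.range U, f u| ≤ 1 := by
  induction U with
  | zero => simp
  | succ U ih => rw [Finset.prod_range_succ]; exact abs_mul_le_one ih (h U)

theorem rankOf_le {f : ℕ → ℕ} (hf : ∀ u, f u = 0 ∨ f u = 1) (U : ℕ) : rankOf f U ≤ U := by
  calc rankOf f U ≤ ∑ v ∈ Finset.range U, 1 :=
        Finset.sum_le_sum fun v _ => by rcases hf v with h | h <;> omega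
    _ = U := by simp

/-- The product of the factors for the vertices below `U`. -/
noncomputable def partialValue (H : Digraph (Fin k)) (tA : ℕ → ℕ → ℤ) (N i x c p q a b U : ℕ) : ℤ :=
  ∏ u ∈ Finset.range U, (checkFactor H tA N i x c u * (signFactor p a u * signFactor q b u))

theorem abs_partialValue_le (htA : ∀ x y, tA x y = 0 ∨ tA x y = 1) (i x c p q a b U : ℕ) :
    |partialValue H tA N i x c p q a b U| ≤ 1 :=
  abs_prod_le_one _ (fun u => abs_mul_le_one (abs_checkFactor_le htA i x c u)
    (abs_mul_le_one (abs_signFactor_le p a u) (abs_signFactor_le q b u))) U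

/-- One pass over the vertices strips the digits off the old code (register 46) and assembles the
new one (register 48, with the current place value in register 49), while register 50 collects the
edge checks and signs. -/
theorem digitLoop_spec (henv : HomEnv H tA A N Z ta σ)
    (htA : ∀ x y, tA x y = 0 ∨ tA x y = 1) {i x c p q a b : ℕ} {v : ℤ} (hv : |v| ≤ 1)
    (hik : i < k) (hx : x < N) (hc : c < N ^ k) (hN : N < 2 ^ (B + 8)) (hB : N ^ k < 2 ^ (B + 8))
    (h14 : ∀ u < k, σ.mem 14 u = bdInd H i u) (h15 : ∀ u < k, σ.mem 15 u = bdInd H (i + 1) u)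
    (h32 : σ.reg 32 = i) (h41 : σ.reg 41 = b) (h42 : σ.reg 42 = a) (h43 : σ.reg 43 = q)
    (h44 : σ.reg 44 = p) (h45 : σ.reg 45 = x) (h46 : σ.reg 46 = c) (h48 : σ.reg 48 = 0)
    (h49 : σ.reg 49 = 1) (h50 : σ.reg 50 = v) :
    WP w ω B (.for 51 1 (digitProg ta)) (k * 7 + 2) (fun τ =>
      τ.reg 48 = (encode N (bdInd H (i + 1)) (digit H N i x c) k : ℕ) ∧
      τ.reg 50 = v * partialValue H tA N i x c p q a b k) σ := by
  have hN0 : 0 < N := by omega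
  have hpow : ∀ i U, U ≤ k → N ^ rankOf (bdInd H i) U ≤ N ^ k := fun i U hU =>
    Nat.pow_le_pow_right hN0 ((rankOf_le (bdInd_eq H i) U).trans hU)
  refine WP.for k 5 (fun U τ => τ.reg 46 = (c / N ^ rankOf (bdInd H i) U : ℕ) ∧
    τ.reg 49 = (N ^ rankOf (bdInd H (i + 1)) U : ℕ) ∧
    τ.reg 48 = (encode N (bdInd H (i + 1)) (digit H N i x c) U : ℕ) ∧
    τ.reg 50 = v * partialValue H tA N i x c p q a b U) henv.hk (by simp [digitProg, Stmt.wr])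
    (by simp [digitProg, Stmt.wr]) ?_ ?_ ?_ ?_
  · intro j τ z h; simpa using h
  · simp [h46, h48, h49, h50, rankOf, encode, partialValue]
  · intro u τ hu hτ hA h51 ⟨i46, i49, i48, i50⟩
    have e : HomEnv H tA A N Z ta τ := henv.congr hA (by simp [digitProg, Stmt.wr])
      (by simp [digitProg, Stmt.wm])
    have hr : ∀ x ∈ [32, 41, 42, 43, 44, 45], τ.reg x = σ.reg x := fun x hx => hA.reg x (by
      revert x; simp [digitProg, Stmt.wr])
    have r32 : τ.reg 32 = i := by rw [hr 32 (by simp), h32]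
    have r41 : τ.reg 41 = b := by rw [hr 41 (by simp), h41]
    have r42 : τ.reg 42 = a := by rw [hr 42 (by simp), h42]
    have r43 : τ.reg 43 = q := by rw [hr 43 (by simp), h43]
    have r44 : τ.reg 44 = p := by rw [hr 44 (by simp), h44]
    have r45 : τ.reg 45 = x := by rw [hr 45 (by simp), h45]
    have m14 : τ.mem 14 u = bdInd H i u := by
      rw [hA.mem 14 (by simp [digitProg, Stmt.wm]), h14 u hu]
    have m15 : τ.mem 15 u = bdInd H (i + 1) u := by
      rw [hA.mem 15 (by simp [digitProg, Stmt.wm]), h15 u hu]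
    have m5 := e.pow u hu
    have r1 := e.hk
    have r20 := e.hN
    set dg := digit H N i x c u with hdg
    have hdgN : dg < N := digit_lt hx
    have a1 := e.adj u i hu hik
    have a2 := e.adj i u hik hu
    have a3 := e.tgt dg x hdgN hx
    have a4 := e.tgt x dg hx hdgN
    refine WP.assign_seq (dg : ℤ) ?_ rfl (by rw [Int.natAbs_natCast]; omega) ?_
    · simp only [eval_mul, eval_add, eval_eq, eval_mod, eval_reg, eval_cell, h51, r32, r45, i46,
        r20, m14, Int.toNat_natCast, Nat.cast_inj, hdg, digit]
      split_ifs with hui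
      -- The new vertex `i` is not on the old boundary, so the two summands of the digit never
      -- overlap.
      · rw [hui, bdInd_self]; simp
      · push_cast; ring
    refine WP.assign_seq (c / N ^ rankOf (bdInd H i) (u + 1) : ℕ) ?_ rfl ?_ ?_
    · simp only [eval_div, eval_mul, eval_add, eval_sub, eval_const, eval_reg, eval_cell, State.setReg_reg,
        State.setReg_mem, Nat.reduceEqDiff, if_false, h51, i46, r20, m14, Int.toNat_natCast, rankOf_succ]
      rcases bdInd_eq H i u with h | h <;> rw [h]
      · simp
      · rw [pow_succ, ← Nat.div_div_eq_div_mul]; push_cast; congr 1; ring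
    · rw [Int.natAbs_natCast]
      exact (Nat.div_le_self _ _).trans_lt (hc.trans hB)
    refine WP.assign_seq (v * partialValue H tA N i x c p q a b (u + 1)) ?_ rfl ?_ ?_
    · simp only [eval_div, eval_mod, eval_lt, eval_mul, eval_add, eval_sub, eval_const, eval_reg,
        eval_cell, State.setReg_reg, State.setReg_mem, Nat.reduceEqDiff, if_false, if_true, h51, r32,
        r41, r42, r43, r44, r45, i50, r1, r20, m14, Int.toNat_natCast, toNat_mul_add, a1, a2, a3, a4, m5,
        Nat.cast_lt, partialValue, Finset.prod_range_succ, checkFactor, signFactor, ← hdg]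
      push_cast
      ring
    · have := abs_mul_le_one hv (abs_partialValue_le (H := H) (N := N) htA i x c p q a b (u + 1))
      rw [← Int.natCast_natAbs] at this
      have h2 : 1 < 2 ^ (B + 8) := Nat.one_lt_two_pow (by omega)
      omega
    refine WP.assign_seq (encode N (bdInd H (i + 1)) (digit H N i x c) (u + 1) : ℕ) ?_ rfl ?_ ?_
    · simp only [eval_mul, eval_add, eval_reg, eval_cell, State.setReg_reg, State.setReg_mem,
        Nat.reduceEqDiff, if_false, if_true, h51, i48, i49, m15, Int.toNat_natCast, encode_succ, ← hdg]
      push_cast; ring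
    · rw [Int.natAbs_natCast]
      exact (encode_lt (fun u _ => bdInd_eq H (i + 1) u) fun u _ _ => digit_lt hx).trans_le
        (hpow _ _ hu) |>.trans hB
    refine WP.assign (N ^ rankOf (bdInd H (i + 1)) (u + 1) : ℕ) ?_ rfl ?_ ?_
    · simp only [eval_mul, eval_add, eval_sub, eval_const, eval_reg, eval_cell, State.setReg_reg,
        State.setReg_mem, Nat.reduceEqDiff, if_false, h51, i49, r20, m15, Int.toNat_natCast, rankOf_succ]
      rcases bdInd_eq H (i + 1) u with h | h <;> rw [h]
      · simp
      · rw [pow_succ]; push_cast; ring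
    · rw [Int.natAbs_natCast]; exact (hpow _ _ hu).trans_lt hB
    · simp
  · intro τ _ _ ⟨_, _, h1, h2⟩; exact ⟨h1, h2⟩

end Digit

/-- A single step of the dynamic program; register 40 encodes a code of a map, the image of the new vertex,
two masks and two positions. -/
def stepProg (ta : ℕ) : Stmt :=
  .assign 41 (reg 40 % reg 1) ;; .assign 46 (reg 40 / reg 1) ;;
  .assign 42 (reg 46 % reg 1) ;; .assign 46 (reg 46 / reg 1) ;;
  .assign 43 (reg 46 % reg 8) ;; .assign 46 (reg 46 / reg 8) ;;
  .assign 44 (reg 46 % reg 8) ;; .assign 46 (reg 46 / reg 8) ;;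
  .assign 45 (reg 46 % reg 20) ;; .assign 46 (reg 46 / reg 20) ;;
  .assign 47 (reg 30 + ((reg 46 * reg 8 + reg 44) * reg 8 + reg 43)) ;;
  .assign 48 (const 0) ;; .assign 49 (const 1) ;;
  .assign 50 (cell 11 (reg 45 * reg 1 + reg 42) * cell 11 (reg 45 * reg 1 + reg 41)
    * (const 1 - reg 44 / cell 5 (reg 42) % const 2)
    * (const 1 - reg 43 / cell 5 (reg 41) % const 2)) ;;
  .for 51 1 (digitProg ta) ;;
  .assign 53 (reg 39 + ((reg 48 * reg 8 + (reg 44 + cell 5 (reg 42))) * reg 8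
    + (reg 43 + cell 5 (reg 41)))) ;;
  .store 13 (reg 53) (cell 13 (reg 53) + reg 50 * cell 13 (reg 47))

section Step
variable {w : ℕ} {ω : ℕ → Bool} {B : ℕ} {σ : State} {k : ℕ} {H : Digraph (Fin k)}
  {tA A : ℕ → ℕ → ℤ} {N Z ta : ℕ}

/-- The address, within the current table, that is read by a single step. -/
def readAddr (k c p q : ℕ) : ℕ := (c * 2 ^ k + p) * 2 ^ k + q

theorem stepAddr_eq (i x c p q a b : ℕ) : stepAddr H N i x c p q a b
    = (encode N (bdInd H (i + 1)) (digit H N i x c) k * 2 ^ k + (p + 2 ^ a)) * 2 ^ k + (q + 2 ^ b) :=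
  rfl

/-- This includes columns already used, for which the contribution is zero but the sum of mask and
power may overflow. The extra factor 4 in the table size keeps these harmless writes inside the next
table. -/
theorem stepAddr_lt {i x c p q a b : ℕ} (hx : x < N) (hp : p < 2 ^ k) (hq : q < 2 ^ k)
    (ha : a < k) (hb : b < k) : stepAddr H N i x c p q a b < 4 * (4 * N) ^ k := by
  rw [stepAddr_eq]
  have h1 : encode N (bdInd H (i + 1)) (digit H N i x c) k < N ^ k :=
    (encode_lt (fun u _ => bdInd_eq H (i + 1) u) fun u _ _ => digit_lt hx).trans_le
      (Nat.pow_le_pow_right (by omega) (rankOf_le (bdInd_eq H (i + 1)) k))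
  set d := encode N (bdInd H (i + 1)) (digit H N i x c) k
  have h2 : 2 ^ a ≤ 2 ^ k := Nat.pow_le_pow_right (by omega) ha.le
  have h3 : 2 ^ b ≤ 2 ^ k := Nat.pow_le_pow_right (by omega) hb.le
  have h4 : (4 * N) ^ k = N ^ k * (2 ^ k * 2 ^ k) := by
    rw [show 4 * N = N * (2 * 2) by ring, mul_pow, mul_pow]
  set K := 2 ^ k
  set M := N ^ k
  have hK : 1 ≤ K := Nat.one_le_two_pow
  have h5 : (d + 1) * (K * K) ≤ M * (K * K) := Nat.mul_le_mul_right _ h1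
  have h6 : d * K + (p + 2 ^ a) + 1 ≤ (d + 2) * K := by linarith
  have h7 : (d * K + (p + 2 ^ a) + 1) * K ≤ (d + 2) * K * K := Nat.mul_le_mul_right _ h6
  have h8 : K ≤ K * K := Nat.le_mul_self K
  rw [h4]
  nlinarith

theorem readAddr_lt {c p q : ℕ} (hc : c < N ^ k) (hp : p < 2 ^ k) (hq : q < 2 ^ k) :
    readAddr k c p q < (4 * N) ^ k := by
  unfold readAddr
  have h4 : (4 * N) ^ k = N ^ k * (2 ^ k * 2 ^ k) := by
    rw [show 4 * N = N * (2 * 2) by ring, mul_pow, mul_pow]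
  rw [h4]
  set K := 2 ^ k
  set M := N ^ k
  have h5 : (c + 1) * (K * K) ≤ M * (K * K) := Nat.mul_le_mul_right _ hc
  have h6 : (c * K + p + 1) * K ≤ ((c + 1) * K) * K := Nat.mul_le_mul_right _ (by linarith)
  nlinarith

/-- A single counter `y` encodes the six loop variables in mixed radix, so the number of rounds is
exactly the product of their ranges. That the result fits into a cell is assumed here; it follows
from the bound on partial sums in the surrounding loop. -/
theorem stepProg_spec (henv : HomEnv H tA A N Z ta σ)
    (htA : ∀ x y, tA x y = 0 ∨ tA x y = 1) (hAb : ∀ x a, |A x a| ≤ 1) {i y base : ℕ}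
    (hik : i < k) (hN : N < 2 ^ (B + 8)) (hZ : 4 * (4 * N) ^ k ≤ Z)
    (hbase : base + 2 * Z ≤ 2 ^ (B + 8))
    (h14 : ∀ u < k, σ.mem 14 u = bdInd H i u) (h15 : ∀ u < k, σ.mem 15 u = bdInd H (i + 1) u)
    (h30 : σ.reg 30 = base) (h39 : σ.reg 39 = (base + Z : ℕ))
    (h32 : σ.reg 32 = i) (h40 : σ.reg 40 = y) {c x p q a b : ℕ}
    (hb' : y % k = b) (ha' : y / k % k = a) (hq' : y / k / k % 2 ^ k = q)
    (hp' : y / k / k / 2 ^ k % 2 ^ k = p) (hx' : y / k / k / 2 ^ k / 2 ^ k % N = x)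
    (hc' : y / k / k / 2 ^ k / 2 ^ k / N = c) (hc : c < N ^ k) (hN0 : 0 < N)
    (hval : (σ.mem 13 (base + Z + stepAddr H N i x c p q a b) + stepValue H tA A N i x c p q a b
      * σ.mem 13 (base + readAddr k c p q)).natAbs < 2 ^ (B + 8)) :
    WP w ω B (stepProg ta) (k * 7 + 18) (fun τ => τ.mem 13 = Function.update (σ.mem 13)
      (base + Z + stepAddr H N i x c p q a b)
      (σ.mem 13 (base + Z + stepAddr H N i x c p q a b) + stepValue H tA A N i x c p q a b
      * σ.mem 13 (base + readAddr k c p q))) σ := by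
  refine WP.of_bdd fun hσ => ?_
  have hk0 : 0 < k := by omega
  have h2k : 0 < 2 ^ k := by positivity
  have hyB : y < 2 ^ (B + 8) := by
    have := hσ.1 40
    rwa [h40, Int.natAbs_natCast] at this
  have ha : a < k := ha' ▸ Nat.mod_lt _ hk0
  have hb : b < k := hb' ▸ Nat.mod_lt _ hk0
  have hp : p < 2 ^ k := hp' ▸ Nat.mod_lt _ h2k
  have hq : q < 2 ^ k := hq' ▸ Nat.mod_lt _ h2k
  have hx : x < N := hx' ▸ Nat.mod_lt _ hN0
  have hread : readAddr k c p q < Z := by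
    have := readAddr_lt hc hp hq
    omega
  have hwrite : stepAddr H N i x c p q a b < Z := (stepAddr_lt hx hp hq ha hb).trans_le hZ
  have hNk : N ^ k < 2 ^ (B + 8) := by
    have h1 : N ^ k ≤ (4 * N) ^ k := Nat.pow_le_pow_left (by omega) k
    have h2 : 0 < N ^ k := by positivity
    omega
  have hd1 : y / k < 2 ^ (B + 8) := (Nat.div_le_self _ _).trans_lt hyB
  have hd2 : y / k / k < 2 ^ (B + 8) := (Nat.div_le_self _ _).trans_lt hd1
  have hd3 : y / k / k / 2 ^ k < 2 ^ (B + 8) := (Nat.div_le_self _ _).trans_lt hd2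
  have hd4 : y / k / k / 2 ^ k / 2 ^ k < 2 ^ (B + 8) := (Nat.div_le_self _ _).trans_lt hd3
  have h2K : 2 ^ k ≤ (4 * N) ^ k := Nat.pow_le_pow_left (by omega) k
  have hkK : k < 2 ^ k := Nat.lt_two_pow_self
  have r1 := henv.hk
  have r8 := henv.pk
  have r20 := henv.hN
  have ev : ∀ z : ℕ, z < 2 ^ (B + 8) → (z : ℤ).natAbs < 2 ^ (B + 8) := fun z hz => by
    rwa [Int.natAbs_natCast]
  refine WP.assign_seq (b : ℤ) (by simp [h40, r1, ← hb']) rfl (ev _ (by omega)) ?_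
  refine WP.assign_seq (y / k : ℕ) (by simp [h40, r1]) rfl (ev _ hd1) ?_
  refine WP.assign_seq (a : ℤ) (by simp [r1, ← ha']) rfl (ev _ (by omega)) ?_
  refine WP.assign_seq (y / k / k : ℕ) (by simp [r1]) rfl (ev _ hd2) ?_
  refine WP.assign_seq (q : ℤ) (by simp [r8, ← hq']) rfl (ev _ (by omega)) ?_
  refine WP.assign_seq (y / k / k / 2 ^ k : ℕ) (by simp [r8]) rfl (ev _ hd3) ?_
  refine WP.assign_seq (p : ℤ) (by simp [r8, ← hp']) rfl (ev _ (by omega)) ?_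
  refine WP.assign_seq (y / k / k / 2 ^ k / 2 ^ k : ℕ) (by simp [r8]) rfl (ev _ hd4) ?_
  refine WP.assign_seq (x : ℤ) (by simp [r20, ← hx']) rfl (ev _ (by omega)) ?_
  refine WP.assign_seq (c : ℤ) (by simp [r20, ← hc']) rfl (ev _ (by omega)) ?_
  refine WP.assign_seq (base + readAddr k c p q : ℕ) (by simp [r8, h30, readAddr]) rfl
    (ev _ (by omega)) ?_
  refine WP.assign_seq 0 rfl rfl (by simp) ?_
  refine WP.assign_seq 1 rfl rfl (Nat.one_lt_two_pow (by omega)) ?_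
  set v : ℤ := A x a * A x b * (1 - ((p / 2 ^ a % 2 : ℕ) : ℤ)) * (1 - ((q / 2 ^ b % 2 : ℕ) : ℤ)) with hv
  have hbit : ∀ z : ℕ, |1 - ((z % 2 : ℕ) : ℤ)| ≤ 1 := by
    intro z
    rcases Nat.mod_two_eq_zero_or_one z with h | h <;> rw [h] <;> simp
  have hv1 : |v| ≤ 1 := abs_mul_le_one (abs_mul_le_one (abs_mul_le_one (hAb _ _) (hAb _ _)) (hbit _))
    (hbit _)
  refine WP.assign_seq v ?_ rfl ?_ ?_
  · simp [r1, toNat_mul_add, henv.mat x a hx ha, henv.mat x b hx hb, henv.pow a ha, henv.pow b hb, hv]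
  · rw [← Int.natCast_natAbs] at hv1
    have h2 : 1 < 2 ^ (B + 8) := Nat.one_lt_two_pow (by omega)
    omega
  have hstep : stepValue H tA A N i x c p q a b = v * partialValue H tA N i x c p q a b k := rfl
  refine WP.le (WP.seq_agree (m' := 2) (digitLoop_spec (H := H) (tA := tA) (A := A) (N := N) (Z := Z)
    (i := i) (x := x) (c := c) (p := p) (q := q) (a := a) (b := b) (v := v)
    ?_ htA hv1 hik hx hc hN hNk ?_ ?_ ?_ ?_ ?_ ?_ ?_ ?_ ?_ ?_ ?_ ?_) ?_) ?_
  · exact ⟨by simpa using r1, by simpa using r8, by simpa using henv.hZ, by simpa using r20, henv.pow,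
      henv.adj, henv.tgt, henv.mat⟩
  · exact h14
  · exact h15
  · simpa using h32
  all_goals try (simp; done)
  intro ρ hρ hA ⟨j48, j50⟩
  have hr : ∀ z ∈ [8, 30, 39, 41, 42, 43, 44, 47], z ∉ (Stmt.for 51 1 (digitProg ta)).wr := by
    simp [Stmt.for, digitProg, Stmt.wr]
  have s8 : ρ.reg 8 = (2 ^ k : ℕ) := by rw [hA.reg 8 (hr _ (by simp))]; simpa using r8
  have s39 : ρ.reg 39 = (base + Z : ℕ) := by rw [hA.reg 39 (hr _ (by simp))]; simpa using h39
  have s41 : ρ.reg 41 = b := by rw [hA.reg 41 (hr _ (by simp))]; simp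
  have s42 : ρ.reg 42 = a := by rw [hA.reg 42 (hr _ (by simp))]; simp
  have s43 : ρ.reg 43 = q := by rw [hA.reg 43 (hr _ (by simp))]; simp
  have s44 : ρ.reg 44 = p := by rw [hA.reg 44 (hr _ (by simp))]; simp
  have s47 : ρ.reg 47 = (base + readAddr k c p q : ℕ) := by rw [hA.reg 47 (hr _ (by simp))]; simp
  have hm : ∀ z, ρ.mem z = σ.mem z := by
    intro z
    rw [hA.mem z (by simp [Stmt.for, digitProg, Stmt.wm])]
    rfl
  refine WP.assign_seq (base + Z + stepAddr H N i x c p q a b : ℕ) ?_ rfl (ev _ (by omega)) ?_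
  · simp [s39, j48, s8, s44, s43, s41, s42, hm, henv.pow a ha, henv.pow b hb, stepAddr_eq]
  refine WP.store (base + Z + stepAddr H N i x c p q a b) _ (by simp) rfl rfl rfl ?_ ?_
  · simp only [eval_mul, eval_add, eval_reg, eval_cell, State.setReg_reg, State.setReg_mem,
      Nat.reduceEqDiff, if_false, if_true, j50, s47, hm, Int.toNat_natCast, ← hstep]
    exact hval
  · simp only [eval_mul, eval_add, eval_reg, eval_cell, State.setReg_reg, State.setReg_mem,
      Nat.reduceEqDiff, if_false, if_true, j50, s47, hm, Int.toNat_natCast, ← hstep,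
      State.setCell_mem]

end Step

/-! ### The dynamic program as a whole -/

/-- The dynamic program: puts the sum over all homomorphisms into register 54, using the part of array 13
that starts at the address in register 30. -/
def homProg (ta : ℕ) : Stmt :=
  .store 13 (reg 30) (const 1) ;;
  .for 32 1 (flagProg ;; .assign 38 (reg 33 * reg 20 * reg 8 * reg 8 * reg 1 * reg 1) ;;
    .assign 39 (reg 30 + reg 9) ;; .for 40 38 (stepProg ta) ;; .assign 30 (reg 39)) ;;
  .assign 54 (cell 13 (reg 30 + (reg 8 * reg 8 - const 1))) ;;
  .assign 30 (reg 30 + reg 9)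

theorem sum_range_flatten {A : Type*} [AddCommMonoid A] (M N K k : ℕ)
    (g : ℕ → ℕ → ℕ → ℕ → ℕ → ℕ → A) :
    ∑ y ∈ Finset.range (M * N * K * K * k * k), g (y / k / k / K / K / N) (y / k / k / K / K % N)
        (y / k / k / K % K) (y / k / k % K) (y / k % k) (y % k)
      = ∑ c ∈ Finset.range M, ∑ x ∈ Finset.range N, ∑ p ∈ Finset.range K, ∑ q ∈ Finset.range K,
        ∑ a ∈ Finset.range k, ∑ b ∈ Finset.range k, g c x p q a b := by
  rw [sum_range_mul_div_mod _ _ fun y b => g (y / k / K / K / N) (y / k / K / K % N)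
    (y / k / K % K) (y / k % K) (y % k) b]
  rw [sum_range_mul_div_mod _ _ fun y a => ∑ b ∈ Finset.range k, g (y / K / K / N) (y / K / K % N)
    (y / K % K) (y % K) a b]
  rw [sum_range_mul_div_mod _ _ fun y q => ∑ a ∈ Finset.range k, ∑ b ∈ Finset.range k,
    g (y / K / N) (y / K % N) (y % K) q a b]
  rw [sum_range_mul_div_mod _ _ fun y p => ∑ q ∈ Finset.range K, ∑ a ∈ Finset.range k,
    ∑ b ∈ Finset.range k, g (y / N) (y % N) p q a b]
  rw [sum_range_mul_div_mod _ _ fun c x => ∑ p ∈ Finset.range K, ∑ q ∈ Finset.range K,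
    ∑ a ∈ Finset.range k, ∑ b ∈ Finset.range k, g c x p q a b]

section Hom
variable {w : ℕ} {ω : ℕ → Bool} {B : ℕ} {σ : State} {k : ℕ} {H : Digraph (Fin k)}
  {tA A : ℕ → ℕ → ℤ} {N Z ta : ℕ}

/-- The contribution of a single step to the cell `j` of the next table, where `f` is the current table. -/
noncomputable def stepTerm (H : Digraph (Fin k)) (tA A : ℕ → ℕ → ℤ) (N i : ℕ) (f : ℕ → ℤ) (j : ℕ)
    (c x p q a b : ℕ) : ℤ :=
  if stepAddr H N i x c p q a b = j then
    stepValue H tA A N i x c p q a b * f (readAddr k c p q) else 0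

/-- The contribution of the step number `y`. -/
noncomputable def stepAt (H : Digraph (Fin k)) (tA A : ℕ → ℕ → ℤ) (N i : ℕ) (f : ℕ → ℤ) (j y : ℕ) : ℤ :=
  stepTerm H tA A N i f j (y / k / k / 2 ^ k / 2 ^ k / N) (y / k / k / 2 ^ k / 2 ^ k % N)
    (y / k / k / 2 ^ k % 2 ^ k) (y / k / k % 2 ^ k) (y / k % k) (y % k)

/-- The flattened loop adds up to the recursion `table_succ`. -/
theorem sum_stepAt {i : ℕ} (hi : i < k) {f : ℕ → ℤ}
    (hf : ∀ c P Q, f (readAddr k c (mask P) (mask Q)) = table H tA (fun x (a : Fin k) => A x a) N i c P Q)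
    (j : ℕ) (P' Q' : Finset (Fin k)) :
    ∑ y ∈ Finset.range (N ^ rankOf (bdInd H i) k * N * 2 ^ k * 2 ^ k * k * k),
      stepAt H tA A N i f (readAddr k j (mask P') (mask Q')) y
      = table H tA (fun x (a : Fin k) => A x a) N (i + 1) j P' Q' := by
  rw [← table_succ H tA A hi]
  unfold stepAt
  rw [sum_range_flatten _ _ _ _ fun c x p q a b =>
    stepTerm H tA A N i f (readAddr k j (mask P') (mask Q')) c x p q a b]
  refine Finset.sum_congr rfl fun c _ => Finset.sum_congr rfl fun x _ => ?_
  rw [sum_range_two_pow]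
  refine Finset.sum_congr rfl fun P _ => ?_
  rw [sum_range_two_pow]
  refine Finset.sum_congr rfl fun Q _ => ?_
  rw [Finset.sum_range]
  refine Finset.sum_congr rfl fun a _ => ?_
  rw [Finset.sum_range]
  refine Finset.sum_congr rfl fun b _ => ?_
  rw [stepTerm, hf]
  rfl

theorem abs_stepValue_le (htA : ∀ x y, tA x y = 0 ∨ tA x y = 1) (hAb : ∀ x a, |A x a| ≤ 1)
    (i x c p q a b : ℕ) : |stepValue H tA A N i x c p q a b| ≤ 1 := by
  have hbit : ∀ z : ℕ, |1 - ((z % 2 : ℕ) : ℤ)| ≤ 1 := by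
    intro z
    rcases Nat.mod_two_eq_zero_or_one z with h | h <;> rw [h] <;> simp
  exact abs_mul_le_one (abs_mul_le_one (abs_mul_le_one (abs_mul_le_one (hAb _ _) (hAb _ _)) (hbit _))
    (hbit _)) (abs_partialValue_le htA i x c p q a b k)

theorem abs_stepAt_le (htA : ∀ x y, tA x y = 0 ∨ tA x y = 1) (hAb : ∀ x a, |A x a| ≤ 1) {f : ℕ → ℤ}
    {C : ℤ} (hf : ∀ j, |f j| ≤ C) (i j y : ℕ) : |stepAt H tA A N i f j y| ≤ C := by
  unfold stepAt stepTerm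
  split_ifs
  · rw [abs_mul]
    calc _ ≤ 1 * |f _| := mul_le_mul_of_nonneg_right (abs_stepValue_le htA hAb ..) (abs_nonneg _)
      _ ≤ C := by rw [one_mul]; exact hf _
  · simpa using (abs_nonneg _).trans (hf 0)

/-- Nothing is written beyond the next table, so the memory for later tables stays zero and need not
be cleared. -/
theorem stepAt_eq_zero (hk : 0 < k) (hN : 0 < N) {f : ℕ → ℤ} (i : ℕ) {j : ℕ}
    (hj : 4 * (4 * N) ^ k ≤ j) (y : ℕ) : stepAt H tA A N i f j y = 0 := by
  unfold stepAt stepTerm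
  rw [if_neg]
  have h2 : 0 < 2 ^ k := by positivity
  have := stepAddr_lt (H := H) (i := i) (c := y / k / k / 2 ^ k / 2 ^ k / N)
    (Nat.mod_lt (y / k / k / 2 ^ k / 2 ^ k) hN) (Nat.mod_lt (y / k / k / 2 ^ k) h2)
    (Nat.mod_lt (y / k / k) h2) (Nat.mod_lt (y / k) hk) (Nat.mod_lt y hk)
  omega

/-- Reads stay below `base + Z` and writes at or above it, so the old table is constant during the
loop and every new cell is a partial sum of contributions computed from it. -/
theorem stepLoop_spec (henv : HomEnv H tA A N Z ta σ) (hta : ta = 9 ∨ ta = 10)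
    (htA : ∀ x y, tA x y = 0 ∨ tA x y = 1) (hAb : ∀ x a, |A x a| ≤ 1) {i base : ℕ}
    (hik : i < k) (hN0 : 0 < N) (hN : N < 2 ^ (B + 8)) (hZ : 4 * (4 * N) ^ k ≤ Z)
    (hbase : base + 2 * Z ≤ 2 ^ (B + 8))
    (h14 : ∀ u < k, σ.mem 14 u = bdInd H i u) (h15 : ∀ u < k, σ.mem 15 u = bdInd H (i + 1) u)
    (h30 : σ.reg 30 = base) (h39 : σ.reg 39 = (base + Z : ℕ)) (h32 : σ.reg 32 = i) {L C : ℕ}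
    (hL : L = N ^ rankOf (bdInd H i) k * N * 2 ^ k * 2 ^ k * k * k)
    (h38 : σ.reg 38 = L) (hC : ∀ j, |σ.mem 13 (base + j)| ≤ C) (hLC : L * C < 2 ^ (B + 8))
    (hzero : ∀ j, base + Z ≤ j → σ.mem 13 j = 0) :
    WP w ω B (.for 40 38 (stepProg ta)) (L * (k * 7 + 20) + 2) (fun τ =>
      (∀ j < base + Z, τ.mem 13 j = σ.mem 13 j) ∧ ∀ j, τ.mem 13 (base + Z + j)
        = ∑ y ∈ Finset.range L, stepAt H tA A N i (fun t => σ.mem 13 (base + t)) j y) σ := by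
  have hZ0 : 0 < Z := by
    have : 0 < (4 * N) ^ k := by positivity
    omega
  refine WP.for L (k * 7 + 18) (fun U τ =>
      (∀ j < base + Z, τ.mem 13 j = σ.mem 13 j) ∧ ∀ j, τ.mem 13 (base + Z + j)
        = ∑ y ∈ Finset.range U, stepAt H tA A N i (fun t => σ.mem 13 (base + t)) j y) h38
    (by simp [stepProg, digitProg, Stmt.for, Stmt.wr]) (by simp [stepProg, digitProg, Stmt.for, Stmt.wr])
    ?_ ?_ ?_ ?_
  · intro j τ z h; simpa using h
  · exact ⟨fun _ _ => rfl, fun j => by simpa using hzero _ (by omega)⟩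
  · intro y τ hy hτ hA h40 ⟨i1, i2⟩
    have e : HomEnv H tA A N Z ta τ := henv.congr hA
      (by simp [stepProg, digitProg, Stmt.for, Stmt.wr])
      (by rcases hta with rfl | rfl <;> simp [stepProg, digitProg, Stmt.for, Stmt.wm])
    have hr : ∀ z ∈ [30, 32, 39], z ∉ (40 :: (stepProg ta).wr) := by
      simp [Stmt.for, stepProg, digitProg, Stmt.wr]
    have hm : ∀ z ∈ [14, 15], z ∉ (stepProg ta).wm := by
      simp [Stmt.for, stepProg, digitProg, Stmt.wm]
    have hk0 : 0 < k := by omega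
    have h2 : 0 < 2 ^ k := by positivity
    set b := y % k with hb
    set a := y / k % k with ha
    set q := y / k / k % 2 ^ k with hq
    set p := y / k / k / 2 ^ k % 2 ^ k with hp
    set x := y / k / k / 2 ^ k / 2 ^ k % N with hx
    set c := y / k / k / 2 ^ k / 2 ^ k / N with hc
    have hcN : c < N ^ k := by
      refine lt_of_lt_of_le ?_ (Nat.pow_le_pow_right hN0 (rankOf_le (bdInd_eq H i) k))
      rw [hc, Nat.div_lt_iff_lt_mul hN0, Nat.div_lt_iff_lt_mul h2, Nat.div_lt_iff_lt_mul h2,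
        Nat.div_lt_iff_lt_mul hk0, Nat.div_lt_iff_lt_mul hk0]
      exact hy.trans_eq hL
    have hread : readAddr k c p q < Z := by
      have : readAddr k c p q < (4 * N) ^ k := readAddr_lt hcN (Nat.mod_lt _ h2) (Nat.mod_lt _ h2)
      omega
    have hterm : ∀ j, stepAt H tA A N i (fun t => σ.mem 13 (base + t)) j y
        = if stepAddr H N i x c p q a b = j then
          stepValue H tA A N i x c p q a b * σ.mem 13 (base + readAddr k c p q) else 0 := fun j => rfl
    -- Every coefficient has absolute value at most 1, so `U` contributions from entries bounded by
    -- `C` stay within `U * C`.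
    have hsum : ∀ j U, U ≤ L → (∑ y ∈ Finset.range U,
        stepAt H tA A N i (fun t => σ.mem 13 (base + t)) j y).natAbs < 2 ^ (B + 8) := by
      intro j U hU
      have h1 : |∑ y ∈ Finset.range U, stepAt H tA A N i (fun t => σ.mem 13 (base + t)) j y|
          ≤ ((U * C : ℕ) : ℤ) := by
        refine (Finset.abs_sum_le_sum_abs _ _).trans ((Finset.sum_le_card_nsmul _ _ (C : ℤ)
          fun y _ => abs_stepAt_le htA hAb hC i j y).trans_eq ?_)
        simp
      have h3 : U * C ≤ L * C := Nat.mul_le_mul_right _ hU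
      rw [← Int.natCast_natAbs] at h1
      omega
    have hval : τ.mem 13 (base + Z + stepAddr H N i x c p q a b) + stepValue H tA A N i x c p q a b
        * τ.mem 13 (base + readAddr k c p q) = ∑ y ∈ Finset.range (y + 1),
          stepAt H tA A N i (fun t => σ.mem 13 (base + t)) (stepAddr H N i x c p q a b) y := by
      rw [i2, i1 _ (by omega), Finset.sum_range_succ, hterm, if_pos rfl]
    refine WP.mono (stepProg_spec (H := H) (N := N) (i := i) (y := y) (base := base) (c := c) (x := x)
      (p := p) (q := q) (a := a) (b := b) e htA hAb hik hN hZ hbase ?_ ?_ ?_ ?_ ?_ h40 hb.symm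
      ha.symm hq.symm hp.symm hx.symm hc.symm hcN hN0 ?_) le_rfl ?_
    · rwa [hA.mem 14 (hm _ (by simp))]
    · rwa [hA.mem 15 (hm _ (by simp))]
    · rw [hA.reg 30 (hr _ (by simp)), h30]
    · rw [hA.reg 39 (hr _ (by simp)), h39]
    · rw [hA.reg 32 (hr _ (by simp)), h32]
    · rw [hval]; exact hsum _ _ hy
    · intro ρ hρ hupd
      rw [hval] at hupd
      refine ⟨fun j hj => ?_, fun j => ?_⟩
      · rw [hupd, Function.update_of_ne (by omega), i1 j hj]
      · rw [hupd]
        by_cases h : stepAddr H N i x c p q a b = j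
        · rw [h, Function.update_self]
        · rw [Function.update_of_ne (by omega), i2, Finset.sum_range_succ, hterm, if_neg h, add_zero]
  · intro τ _ _ h; exact h

theorem readAddr_eq_zero_iff {c : ℕ} {P Q : Finset (Fin k)} :
    readAddr k c (mask P) (mask Q) = 0 ↔ c = 0 ∧ P = ∅ ∧ Q = ∅ := by
  have h2 : 0 < 2 ^ k := by positivity
  have hm : ∀ P : Finset (Fin k), mask P = 0 ↔ P = ∅ := fun P =>
    ⟨fun h => mask_injective (by rw [h]; simp), fun h => by simp [h]⟩
  simp only [readAddr, Nat.add_eq_zero_iff, mul_eq_zero, h2.ne', or_false, hm]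
  tauto

/-- The table for `i` vertices starts at `base + i * Z` and has entries bounded by `L ^ i`, since a
cell receives at most `L` contributions per vertex. Register 30 finally points to untouched memory
for the next run. `N` may be zero only for `k = 0`, which occurs when the target is `H` itself. -/
theorem homProg_spec (henv : HomEnv H tA A N Z ta σ) (hta : ta = 9 ∨ ta = 10)
    (htA : ∀ x y, tA x y = 0 ∨ tA x y = 1) (hAb : ∀ x a, |A x a| ≤ 1) {base L : ℕ}
    (hN0 : 0 < k → 0 < N) (hN : N < 2 ^ (B + 8)) (hZ : 4 * (4 * N) ^ k ≤ Z)
    (hbase : base + (k + 1) * Z < 2 ^ (B + 8)) (h30 : σ.reg 30 = base)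
    (hL0 : 0 < L) (hL : ∀ i < k, N ^ rankOf (bdInd H i) k * N * 2 ^ k * 2 ^ k * k * k ≤ L)
    (hLB : L ^ k < 2 ^ (B + 8)) (hzero : ∀ j, base ≤ j → σ.mem 13 j = 0) :
    WP w ω B (homProg ta) (k * (k * (6 * k + 9) + L * (k * 7 + 20) + 10) + 5) (fun τ =>
      τ.reg 54 = table H tA (fun x (a : Fin k) => A x a) N k 0 Finset.univ Finset.univ ∧
      |τ.reg 54| ≤ ((L ^ k : ℕ) : ℤ) ∧ τ.reg 30 = (base + (k + 1) * Z : ℕ) ∧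
      ∀ j, base + (k + 1) * Z ≤ j → τ.mem 13 j = 0) σ := by
  have hcap : (1 : ℤ).natAbs < 2 ^ (B + 8) := Nat.one_lt_two_pow (by omega)
  have ev : ∀ z : ℕ, z < 2 ^ (B + 8) → (z : ℤ).natAbs < 2 ^ (B + 8) := fun z hz => by
    rwa [Int.natAbs_natCast]
  have h4k : 0 < (4 * N) ^ k := by
    rcases Nat.eq_zero_or_pos k with rfl | h
    · simp
    · have := hN0 h
      positivity
  have hNk : N ^ k < 2 ^ (B + 8) := by
    have h1 : N ^ k ≤ (4 * N) ^ k := Nat.pow_le_pow_left (by omega) k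
    have h2 : Z ≤ (k + 1) * Z := Nat.le_mul_of_pos_left _ (by omega)
    omega
  have h13 : ∀ j, |σ.mem 13 (base + j)| ≤ ((L ^ 0 : ℕ) : ℤ) := fun j => by
    rw [hzero _ (by omega)]; simp
  have hwr : ∀ z ∈ [1, 8, 9, 20], z ∉ (32 :: (flagProg ;;
      .assign 38 (reg 33 * reg 20 * reg 8 * reg 8 * reg 1 * reg 1) ;;
      .assign 39 (reg 30 + reg 9) ;; .for 40 38 (stepProg ta) ;; .assign 30 (reg 39)).wr) := by
    simp [Stmt.for, flagProg, stepProg, digitProg, Stmt.wr]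
  have hwm : ∀ a ∈ [5, 9, ta, 11], a ∉ (flagProg ;;
      .assign 38 (reg 33 * reg 20 * reg 8 * reg 8 * reg 1 * reg 1) ;;
      .assign 39 (reg 30 + reg 9) ;; .for 40 38 (stepProg ta) ;; .assign 30 (reg 39)).wm := by
    rcases hta with rfl | rfl <;> simp [Stmt.for, flagProg, stepProg, digitProg, Stmt.wm]
  refine WP.le (WP.store_seq base 1 h30 rfl rfl rfl hcap (WP.seq_agree (WP.for k
    (k * (6 * k + 9) + L * (k * 7 + 20) + 8)
    (fun i τ => τ.reg 30 = (base + i * Z : ℕ) ∧ (∀ j, |τ.mem 13 (base + i * Z + j)| ≤ ((L ^ i : ℕ) : ℤ)) ∧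
      (∀ j, base + (i + 1) * Z ≤ j → τ.mem 13 j = 0) ∧
      ∀ c P Q, τ.mem 13 (base + i * Z + readAddr k c (mask P) (mask Q))
        = table H tA (fun x (a : Fin k) => A x a) N i c P Q)
    (by simpa using henv.hk) (hwr 1 (by simp)) (by simp [Stmt.for, flagProg, stepProg, digitProg, Stmt.wr])
      ?_ ?_ ?_ fun τ _ _ h => h)
    ?_ (m' := 2))) (le_of_eq (by ring))
  · intro j τ z h; simpa using h
  · refine ⟨by simpa using h30, fun j => ?_, fun j hj => ?_, fun c P Q => ?_⟩
    · rw [State.setCell_mem, if_pos rfl, Function.update_apply]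
      split_ifs
      · simp
      · rw [zero_mul, add_zero]; exact h13 j
    · rw [State.setCell_mem, if_pos rfl, Function.update_of_ne (by omega), hzero _ (by omega)]
    · rw [State.setCell_mem, if_pos rfl, table_zero, Function.update_apply, zero_mul, add_zero]
      simp only [Nat.add_eq_left, readAddr_eq_zero_iff]
      split_ifs
      · rfl
      · exact hzero _ (by omega)
  · intro i τ hi hτ hA h32 ⟨i1, i2, i3, i4⟩
    have hN0 := hN0 (by omega)
    have e1 : HomEnv H tA A N Z ta (σ.setCell 13 base 1) := by
      refine ⟨henv.hk, henv.pk, henv.hZ, henv.hN, henv.pow, henv.adj, ?_, henv.mat⟩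
      rcases hta with rfl | rfl <;> exact henv.tgt
    have e : HomEnv H tA A N Z ta τ := e1.congr hA hwr hwm
    have hLk : L * L ^ i < 2 ^ (B + 8) := by
      rw [← pow_succ']
      exact (Nat.pow_le_pow_right hL0 hi).trans_lt hLB
    have hLL : L < 2 ^ (B + 8) := by
      have : 0 < L ^ i := by positivity
      exact (Nat.le_mul_of_pos_right _ this).trans_lt hLk
    have hbi : base + i * Z + 2 * Z ≤ 2 ^ (B + 8) := by
      have : (i + 2) * Z ≤ (k + 1) * Z := Nat.mul_le_mul_right _ (by omega)
      rw [add_mul] at this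
      omega
    set M := N ^ rankOf (bdInd H i) k * N * 2 ^ k * 2 ^ k * k * k with hM
    have hML : M ≤ L := hL i hi
    refine WP.le (WP.seq_agree (m' := M * (k * 7 + 20) + 5) (flagProg_spec e hta h32 hN0 hNk) ?_) ?_
    swap
    · have := Nat.mul_le_mul_right (k * 7 + 20) hML
      omega
    intro ρ hρ hA1 ⟨f14, f15, f33⟩
    have e2 : HomEnv H tA A N Z ta ρ := e.congr hA1 (by decide)
      (by rcases hta with rfl | rfl <;> decide)
    have r30 : ρ.reg 30 = (base + i * Z : ℕ) := by rw [hA1.reg 30 (by decide), i1]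
    have r32 : ρ.reg 32 = i := by rw [hA1.reg 32 (by decide), h32]
    have m13 : ρ.mem 13 = τ.mem 13 := hA1.mem 13 (by decide)
    refine WP.assign_seq (M : ℤ) (by simp [f33, e2.hN, e2.pk, e2.hk, hM]) rfl
      (ev _ (hML.trans_lt hLL)) ?_
    refine WP.assign_seq (base + i * Z + Z : ℕ) (by simp [r30, e2.hZ]) rfl (ev _ (by omega)) ?_
    refine WP.seq_agree (m := M * (k * 7 + 20) + 2) (m' := 1) (stepLoop_spec (H := H) (tA := tA) (A := A)
      (N := N) (Z := Z) (i := i) (base := base + i * Z) (L := M) (C := L ^ i)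
      ?_ hta htA hAb hi hN0 hN hZ hbi ?_ ?_ ?_ ?_ ?_ hM ?_ ?_ ?_ ?_) ?_
    · exact ⟨by simpa using e2.hk, by simpa using e2.pk, by simpa using e2.hZ, by simpa using e2.hN, e2.pow,
        e2.adj, e2.tgt, e2.mat⟩
    · exact f14
    · exact f15
    · simpa using r30
    · simp
    · simpa using r32
    · simp
    · simpa [m13] using i2
    · exact (Nat.mul_le_mul_right _ hML).trans_lt hLk
    · intro j hj
      simp only [State.setReg_mem, m13]
      exact i3 j (by rw [add_mul]; omega)
    · intro ξ hξ hA2 ⟨j1, j2⟩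
      simp only [State.setReg_mem, m13] at j1 j2
      have r39 : ξ.reg 39 = (base + i * Z + Z : ℕ) := by
        rw [hA2.reg 39 (by simp [Stmt.for, stepProg, digitProg, Stmt.wr])]; simp
      have hcell : ∀ j, |ξ.mem 13 (base + i * Z + Z + j)| ≤ ((L ^ (i + 1) : ℕ) : ℤ) := by
        intro j
        rw [j2]
        refine (Finset.abs_sum_le_sum_abs _ _).trans ((Finset.sum_le_card_nsmul _ _ ((L ^ i : ℕ) : ℤ)
          fun y _ => abs_stepAt_le htA hAb i2 i j y).trans ?_)
        rw [Finset.card_range, nsmul_eq_mul, ← Nat.cast_mul, pow_succ']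
        exact_mod_cast Nat.mul_le_mul_right _ hML
      have hb1 : base + (i + 1) * Z = base + i * Z + Z := by ring
      have hb2 : base + (i + 1 + 1) * Z = base + i * Z + Z + Z := by ring
      refine WP.assign (base + i * Z + Z : ℕ) (by simp [r39]) rfl (ev _ (by omega)) ⟨?_, ?_, ?_, ?_⟩
      · rw [hb1]; simp
      · rw [hb1]; exact hcell
      · rw [hb2]
        intro j hj
        obtain ⟨l, rfl⟩ := Nat.exists_eq_add_of_le hj
        rw [State.setReg_mem, show base + i * Z + Z + Z + l = base + i * Z + Z + (Z + l) by ring, j2]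
        exact Finset.sum_eq_zero fun y _ => stepAt_eq_zero (by omega) hN0 i (by omega) y
      · rw [hb1]
        intro c P Q
        rw [State.setReg_mem, j2, sum_stepAt hi i4]
  · intro τ hτ hA ⟨i1, i2, i3, i4⟩
    have r8 : τ.reg 8 = (2 ^ k : ℕ) := by rw [hA.reg 8 (by simp [Stmt.for, flagProg, stepProg, digitProg, Stmt.wr])]; simpa using henv.pk
    have r9 : τ.reg 9 = Z := by rw [hA.reg 9 (by simp [Stmt.for, flagProg, stepProg, digitProg, Stmt.wr])]; simpa using henv.hZ
    have hb2 : base + (k + 1) * Z = base + k * Z + Z := by ring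
    -- The result is in the cell of the code `0` and two full masks, which has offset `4^k - 1` in
    -- the last table.
    have haddr : readAddr k 0 (mask (Finset.univ : Finset (Fin k))) (mask (Finset.univ : Finset (Fin k))) + 1
        = 2 ^ k * 2 ^ k := by
      have := mask_univ (k := k)
      rw [← this, readAddr]; rw [← this]; ring
    have hlast := i4 0 Finset.univ Finset.univ
    have hval : (cell 13 (reg 30 + (reg 8 * reg 8 - const 1))).eval τ
        = table H tA (fun x (a : Fin k) => A x a) N k 0 Finset.univ Finset.univ := by
      rw [← hlast]
      simp only [eval_cell, eval_add, eval_mul, eval_sub, eval_reg, eval_const, i1, r8]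
      congr 1
      rw [← Nat.cast_mul, ← haddr]
      push_cast
      omega
    have habs := i2 (readAddr k 0 (mask (Finset.univ : Finset (Fin k)))
      (mask (Finset.univ : Finset (Fin k))))
    rw [hlast] at habs
    refine WP.assign_seq _ hval rfl ?_ ?_
    · rw [← Int.natCast_natAbs] at habs
      omega
    refine WP.assign (base + (k + 1) * Z : ℕ) ?_ rfl (ev _ hbase) ⟨?_, ?_, ?_, ?_⟩
    · simp [i1, r9]; ring
    · simp
    · simpa using habs
    · simp
    · simpa using i3

end Hom

/-! ### Optimal orderings by recursion over vertex sets -/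

section Width
variable {V : Type*} [Fintype V] [DecidableEq V] {H : Digraph V}

theorem Reach.mono {p q : ℕ} (hpq : p ≤ q) {S : Finset V} (h : Reach H p S) : Reach H q S := by
  induction h with
  | empty => exact .empty
  | step hv _ hb ih => exact .step hv ih (hb.trans hpq)

theorem reach_card (H : Digraph V) (S : Finset V) : Reach H (Fintype.card V) S := by
  induction S using Finset.strongInduction with
  | H S ih =>
    rcases S.eq_empty_or_nonempty with rfl | ⟨v, hv⟩
    · exact .empty
    · exact .step hv (ih _ (Finset.erase_ssubset hv)) (boundary_card_le H S)

/-- The least `p` such that `S` can be built up with boundaries of at most `p` vertices. -/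
noncomputable def width (H : Digraph V) (S : Finset V) : ℕ := sInf {p | Reach H p S}

theorem reach_width (H : Digraph V) (S : Finset V) : Reach H (width H S) S :=
  Nat.sInf_mem (s := {p | Reach H p S}) ⟨_, reach_card H S⟩

theorem width_le {p : ℕ} {S : Finset V} (h : Reach H p S) : width H S ≤ p := Nat.sInf_le h

theorem width_le_card (H : Digraph V) (S : Finset V) : width H S ≤ Fintype.card V :=
  width_le (reach_card H S)

theorem width_empty (H : Digraph V) : width H ∅ = 0 := Nat.le_zero.1 (width_le .empty)

theorem boundary_le_width (H : Digraph V) (S : Finset V) : (boundary H S).card ≤ width H S := by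
  rcases reach_width H S with _ | ⟨_, _, h⟩
  · rw [boundary_empty]; simp
  · exact h

/-- Any way to build `S` ends with some last vertex `u` after building `S.erase u`, so it is best to
choose the last vertex that leaves the smallest width. -/
theorem width_eq_max {S : Finset V} {v : V} (hv : v ∈ S)
    (hmin : ∀ u ∈ S, width H (S.erase v) ≤ width H (S.erase u)) :
    width H S = max (boundary H S).card (width H (S.erase v)) := by
  refine le_antisymm (width_le (.step hv ((reach_width H _).mono (le_max_right _ _)) (le_max_left _ _)))
    (max_le (boundary_le_width H S) ?_)
  rcases reach_width H S with _ | @⟨_, u, hu, h, _⟩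
  · exact absurd hv (Finset.notMem_empty v)
  · exact (hmin u hu).trans (width_le h)

end Width

section Chain
variable {k : ℕ} {H : Digraph (Fin k)}

theorem below_zero : below k 0 = ∅ := by simp [below]

theorem below_of_le {i : ℕ} (h : k ≤ i) : below k i = Finset.univ := by
  ext u; simp [below]; omega

theorem mem_below {i : ℕ} {u : Fin k} : u ∈ below k i ↔ (u : ℕ) < i := by simp [below]

theorem below_succ {i : ℕ} (h : i < k) : below k (i + 1) = insert ⟨i, h⟩ (below k i) := by
  ext u
  simp only [below, Finset.mem_filter, Finset.mem_univ, true_and, Finset.mem_insert, Fin.ext_iff]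
  omega

/-- A successful choice of a last vertex for every set gives an optimal ordering. -/
theorem exists_ordering (c : ℕ → ℤ) (hc : ∀ S : Finset (Fin k), S.Nonempty →
      ∃ v ∈ S, c (mask S) = (v : ℕ) ∧ width H (S.erase v) ≤ width H S) :
    ∃ e : Fin k ≃ Fin k, (∀ i, (boundary H ((below k i).map e.toEmbedding)).card ≤ width H Finset.univ) ∧
      ∀ i : Fin k, c (mask ((below k (i + 1)).map e.toEmbedding)) = (e i : ℕ) := by
  rcases Nat.eq_zero_or_pos k with rfl | hk
  · exact ⟨Equiv.refl _, fun i => by simp [Finset.eq_empty_of_isEmpty],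
      fun i => i.elim0⟩
  have : Nonempty (Fin k) := ⟨⟨0, hk⟩⟩
  choose! v hvS hvc hvw using hc
  let T : ℕ → Finset (Fin k) := fun j => (fun S => S.erase (v S))^[j] Finset.univ
  have hT0 : T 0 = Finset.univ := rfl
  have hTs : ∀ j, T (j + 1) = (T j).erase (v (T j)) := fun j => Function.iterate_succ_apply' _ _ _
  have hTc : ∀ j ≤ k, (T j).card = k - j := by
    intro j
    induction j with
    | zero => intro; simp [hT0]
    | succ j ih =>
      intro hj
      have h1 := ih (by omega)
      rw [hTs, Finset.card_erase_of_mem (hvS _ (by rw [← Finset.card_pos]; omega)), h1]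
      omega
  have hTn : ∀ j < k, (T j).Nonempty := fun j hj => by
    rw [← Finset.card_pos, hTc j hj.le]; omega
  have hTw : ∀ j ≤ k, width H (T j) ≤ width H Finset.univ := by
    intro j
    induction j with
    | zero => intro; exact le_rfl
    | succ j ih =>
      intro hj
      rw [hTs]
      exact (hvw _ (hTn j hj)).trans (ih (by omega))
  have hTm : ∀ j l, T (j + l) ⊆ T j := by
    intro j l
    induction l with
    | zero => exact subset_rfl
    | succ l ih =>
      rw [← add_assoc, hTs]
      exact (Finset.erase_subset _ _).trans ih
  -- The sets `T j` arise from the full set by removing chosen last vertices, so the ordering is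
  -- read backwards: position `i` receives the vertex removed from `T (k - 1 - i)`.
  let f : Fin k → Fin k := fun i => v (T (k - 1 - i))
  have hf : Function.Injective f := by
    have key : ∀ i i' : Fin k, i < i' → f i ≠ f i' := by
      intro i i' h heq
      have h1 : f i ∈ T (k - 1 - i) := hvS _ (hTn _ (by omega))
      have h2 : k - 1 - (i : ℕ) = (k - 1 - i' + 1) + (i' - i - 1) := by
        have := i'.2
        have : (i : ℕ) < i' := h
        omega
      rw [h2] at h1
      have h3 := hTm _ _ h1
      rw [hTs, heq] at h3
      exact absurd h3 (Finset.notMem_erase _ _)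
    intro i i' h
    by_contra hne
    rcases lt_or_gt_of_ne hne with h1 | h1
    · exact key _ _ h1 h
    · exact key _ _ h1 h.symm
  let e : Fin k ≃ Fin k := Equiv.ofBijective f hf.bijective_of_finite
  have he : ∀ i, e i = f i := fun i => rfl
  have hmap : ∀ i ≤ k, (below k i).map e.toEmbedding = T (k - i) := by
    intro i
    induction i with
    | zero =>
      intro _
      have : (T k).card = 0 := by rw [hTc k le_rfl]; omega
      rw [Nat.sub_zero, Finset.card_eq_zero.1 this, below_zero, Finset.map_empty]
    | succ i ih =>
      intro hi
      have h1 : k - i = k - (i + 1) + 1 := by omega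
      have h2 : k - 1 - i = k - (i + 1) := by omega
      rw [below_succ hi, Finset.map_insert, ih (by omega), h1, hTs, Equiv.coe_toEmbedding, he]
      simp only [f]
      rw [h2]
      exact Finset.insert_erase (hvS _ (hTn _ (by omega)))
  refine ⟨e, fun i => ?_, fun i => ?_⟩
  · rcases le_total i k with h | h
    · rw [hmap i h]
      exact (boundary_le_width H _).trans (hTw _ (by omega))
    · rw [below_of_le h, Finset.map_univ_equiv]
      exact boundary_le_width H _
  · rw [hmap _ i.2, he, hvc _ (hTn _ (by omega))]
    simp only [f]
    rw [show k - 1 - (i : ℕ) = k - (i + 1) by omega]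

end Chain

/-! ### Computing an optimal ordering -/

/-- Puts the size of the boundary of the set whose mask is in register 11 into register 14. -/
def boundaryProg : Stmt :=
  .assign 14 (const 0) ;;
  .for 12 1 (.assign 15 (const 0) ;;
    .for 13 1 (.ite (reg 11 / cell 5 (reg 12) % const 2 * (const 1 - reg 11 / cell 5 (reg 13) % const 2) *
        (cell 4 (reg 12 * reg 1 + reg 13) + cell 4 (reg 13 * reg 1 + reg 12)))
      (.assign 15 (const 1)) .skip) ;;
    .assign 14 (reg 14 + reg 15))

/-- Finds, for the set whose mask is in register 11, the best last vertex. -/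
def widthProg : Stmt :=
  boundaryProg ;;
  .assign 16 ((const 0).lt (reg 11) * (reg 1 + const 1)) ;;
  .assign 17 (const 0) ;;
  .for 12 1 (.ite (reg 11 / cell 5 (reg 12) % const 2 * (cell 6 (reg 11 - cell 5 (reg 12))).lt (reg 16))
    (.assign 16 (cell 6 (reg 11 - cell 5 (reg 12))) ;; .assign 17 (reg 12)) .skip) ;;
  .store 7 (reg 11) (reg 17) ;;
  .store 6 (reg 11) (reg 14 + (reg 14).lt (reg 16) * (reg 16 - reg 14))

section Order
variable {w : ℕ} {ω : ℕ → Bool} {B : ℕ} {σ : State} {k : ℕ} {H : Digraph (Fin k)}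

/-- What the computation of the ordering needs to find in the memory. -/
structure OrderEnv (H : Digraph (Fin k)) (σ : State) : Prop where
  hk : σ.reg 1 = k
  pk : σ.reg 8 = (2 ^ k : ℕ)
  pow : ∀ a < k, σ.mem 5 a = (2 ^ a : ℕ)
  adj : ∀ u v, u < k → v < k → σ.mem 4 (u * k + v) = adjInd H u v

theorem OrderEnv.congr {σ τ : State} {R M : List ℕ} {d : Bool} (h : OrderEnv H σ) (hA : Agree R M d σ τ)
    (h1 : 1 ∉ R) (h8 : 8 ∉ R) (h4 : 4 ∉ M) (h5 : 5 ∉ M) : OrderEnv H τ := by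
  constructor
  · rw [hA.reg _ h1, h.hk]
  · rw [hA.reg _ h8, h.pk]
  · rw [hA.mem _ h5]; exact h.pow
  · rw [hA.mem _ h4]; exact h.adj

theorem mask_bit_int (S : Finset (Fin k)) (u : Fin k) :
    (((mask S : ℕ) : ℤ) / ((2 ^ (u : ℕ) : ℕ) : ℤ) % 2) = if u ∈ S then 1 else 0 := by
  have h := mask_bit S u
  rw [← Int.natCast_div, show ((2 : ℤ)) = ((2 : ℕ) : ℤ) by rfl, ← Int.natCast_mod, h]
  split_ifs <;> rfl

theorem boundaryProg_spec (henv : OrderEnv H σ) (S : Finset (Fin k)) (h11 : σ.reg 11 = mask S)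
    (hB : k < 2 ^ (B + 8)) :
    WP w ω B boundaryProg (k * (4 * k + 6) + 3) (fun τ => τ.reg 14 = (boundary H S).card) σ := by
  classical
  have hcap : (1 : ℤ).natAbs < 2 ^ (B + 8) := Nat.one_lt_two_pow (by omega)
  have hcap0 : (0 : ℤ).natAbs < 2 ^ (B + 8) := by simp
  let f : ℕ → ℕ := fun u => if ∃ hu : u < k, (⟨u, hu⟩ : Fin k) ∈ boundary H S then 1 else 0
  have hf : ∑ u ∈ Finset.range k, f u = (boundary H S).card := by
    rw [Finset.sum_range, Finset.card_eq_sum_ones, ← Finset.sum_filter_add_sum_filter_not Finset.univ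
      (fun u : Fin k => u ∈ boundary H S)]
    simp only [f, Fin.is_lt, Fin.eta, exists_true_left]
    rw [Finset.sum_ite_of_true (by simp), Finset.sum_ite_of_false (by simp)]
    simp
  have hfle : ∀ j ≤ k, ∑ u ∈ Finset.range j, f u ≤ k := by
    intro j hj
    calc _ ≤ ∑ u ∈ Finset.range j, 1 := Finset.sum_le_sum fun u _ => by simp only [f]; split_ifs <;> simp
      _ ≤ k := by simpa using hj
  refine WP.le (WP.assign_seq 0 rfl rfl hcap0 (WP.for k (4 * k + 4) (fun j τ =>
    τ.reg 14 = (∑ u ∈ Finset.range j, f u : ℕ)) (by simpa using henv.hk) (by decide) (by decide)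
    ?_ ?_ ?_ ?_)) (le_of_eq (by ring))
  · intro j τ z h; simpa using h
  · simp
  · intro u τ hu hτ hA h12 hI
    have e1 : OrderEnv H (σ.setReg 14 0) :=
      ⟨by simpa using henv.hk, by simpa using henv.pk, henv.pow, henv.adj⟩
    have e : OrderEnv H τ := e1.congr hA (by decide) (by decide) (by decide) (by decide)
    have r11 : τ.reg 11 = mask S := by rw [hA.reg 11 (by decide)]; simpa using h11
    let p : ℕ → ℤ := fun j => if ∃ w : Fin k, (w : ℕ) < j ∧ (⟨u, hu⟩ : Fin k) ∈ S ∧ w ∉ S ∧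
      (H.Adj ⟨u, hu⟩ w ∨ H.Adj w ⟨u, hu⟩) then 1 else 0
    refine WP.le (WP.assign_seq 0 rfl rfl hcap0 (WP.seq_agree (WP.for k 2 (fun j τ => τ.reg 15 = p j)
      (by simpa using e.hk) (by decide) (by decide) ?_ ?_ ?_ fun τ _ _ h => h) ?_ (m' := 1)))
      (le_of_eq (by ring))
    · intro j τ z h; simpa using h
    · simp [p]
    · intro x ρ hx hρ hA' h13 hJ
      have e2 : OrderEnv H (τ.setReg 15 0) :=
        ⟨by simpa using e.hk, by simpa using e.pk, e.pow, e.adj⟩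
      have e3 : OrderEnv H ρ := e2.congr hA' (by decide) (by decide) (by decide) (by decide)
      have s11 : ρ.reg 11 = mask S := by rw [hA'.reg 11 (by decide)]; simpa using r11
      have s12 : ρ.reg 12 = u := by rw [hA'.reg 12 (by decide)]; simpa using h12
      have hcond : (reg 11 / cell 5 (reg 12) % const 2 * (const 1 - reg 11 / cell 5 (reg 13) % const 2) *
          (cell 4 (reg 12 * reg 1 + reg 13) + cell 4 (reg 13 * reg 1 + reg 12))).eval ρ ≠ 0 ↔
          (⟨u, hu⟩ : Fin k) ∈ S ∧ ⟨x, hx⟩ ∉ S ∧ (H.Adj ⟨u, hu⟩ ⟨x, hx⟩ ∨ H.Adj ⟨x, hx⟩ ⟨u, hu⟩) := by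
        simp only [eval_mul, eval_add, eval_sub, eval_div, eval_mod, eval_const, eval_reg, eval_cell,
          s11, s12, h13, e3.hk, Int.toNat_natCast, toNat_mul_add, e3.pow u hu, e3.pow x hx,
          e3.adj u x hu hx, e3.adj x u hx hu]
        rw [mask_bit_int S ⟨u, hu⟩, mask_bit_int S ⟨x, hx⟩, adjInd_fin H ⟨u, hu⟩ ⟨x, hx⟩,
          adjInd_fin H ⟨x, hx⟩ ⟨u, hu⟩]
        by_cases h1 : (⟨u, hu⟩ : Fin k) ∈ S <;> by_cases h2 : (⟨x, hx⟩ : Fin k) ∈ S <;>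
          by_cases h3 : H.Adj ⟨u, hu⟩ ⟨x, hx⟩ <;> by_cases h4 : H.Adj ⟨x, hx⟩ ⟨u, hu⟩ <;>
          simp [h1, h2, h3, h4]
      have hp : p (x + 1) = if (⟨u, hu⟩ : Fin k) ∈ S ∧ ⟨x, hx⟩ ∉ S ∧
          (H.Adj ⟨u, hu⟩ ⟨x, hx⟩ ∨ H.Adj ⟨x, hx⟩ ⟨u, hu⟩) then 1 else p x := by
        simp only [p]
        by_cases h : (⟨u, hu⟩ : Fin k) ∈ S ∧ ⟨x, hx⟩ ∉ S ∧
          (H.Adj ⟨u, hu⟩ ⟨x, hx⟩ ∨ H.Adj ⟨x, hx⟩ ⟨u, hu⟩)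
        · rw [if_pos h, if_pos ⟨⟨x, hx⟩, Nat.lt_succ_self _, h⟩]
        · rw [if_neg h]
          congr 1
          refine propext ⟨fun ⟨v, h1, h2⟩ => ⟨v, lt_of_le_of_ne (Nat.lt_succ_iff.1 h1) fun h3 => h ?_, h2⟩,
            fun ⟨v, h1, h2⟩ => ⟨v, Nat.lt_succ_of_lt h1, h2⟩⟩
          obtain rfl : v = ⟨x, hx⟩ := Fin.ext h3
          exact h2
      refine WP.ite rfl (fun h => ?_) fun h => ?_
      · refine WP.assign 1 rfl rfl hcap ?_
        rw [hp, if_pos (hcond.1 h)]; simp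
      · refine WP.skip ?_
        rw [hp, if_neg (fun h' => hcond.2 h' h), hJ]
    · intro ρ hρ hA' hJ
      have s14 : ρ.reg 14 = (∑ u ∈ Finset.range u, f u : ℕ) := by
        rw [hA'.reg 14 (by decide)]; simpa using hI
      have hpf : p k = (f u : ℕ) := by
        simp only [p, f, mem_boundary, Fin.is_lt, true_and, hu, exists_true_left]
        by_cases h : (⟨u, hu⟩ : Fin k) ∈ S <;> simp [h]
      refine WP.assign (∑ u ∈ Finset.range (u + 1), f u : ℕ) ?_ rfl ?_ ?_
      · simp only [eval_add, eval_reg, s14, hJ, hpf, Finset.sum_range_succ]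
        push_cast; rfl
      · rw [Int.natAbs_natCast]; exact (hfle _ hu).trans_lt hB
      · simp
  · intro τ _ _ h; rw [h, hf]

/-- The recursion `width_eq_max`: a minimum over the last vertex, followed by a maximum with the
size of the boundary. -/
theorem widthProg_spec (henv : OrderEnv H σ) (S : Finset (Fin k)) (h11 : σ.reg 11 = mask S)
    (hB : k + 1 < 2 ^ (B + 8)) (h6 : ∀ v ∈ S, σ.mem 6 (mask (S.erase v)) = width H (S.erase v)) :
    WP w ω B widthProg (k * (4 * k + 11) + 9) (fun τ => ∃ z : ℤ,
      τ.mem 6 = Function.update (σ.mem 6) (mask S) (width H S) ∧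
      τ.mem 7 = Function.update (σ.mem 7) (mask S) z ∧
      (S.Nonempty → ∃ v ∈ S, z = (v : ℕ) ∧ width H (S.erase v) ≤ width H S)) σ := by
  classical
  have ev : ∀ z : ℕ, z < 2 ^ (B + 8) → (z : ℤ).natAbs < 2 ^ (B + 8) := fun z hz => by
    rwa [Int.natAbs_natCast]
  have hcap0 : (0 : ℤ).natAbs < 2 ^ (B + 8) := by simp
  have hwk : ∀ S : Finset (Fin k), width H S ≤ k := fun S => by simpa using width_le_card H S
  refine WP.le (WP.seq_agree (m := k * (4 * k + 6) + 3) (m' := k * 5 + 6)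
    (boundaryProg_spec henv S h11 (by omega)) ?_) (le_of_eq (by ring))
  intro τ hτ hA h14
  have e : OrderEnv H τ := henv.congr hA (by decide) (by decide) (by decide) (by decide)
  have r11 : τ.reg 11 = mask S := by rw [hA.reg 11 (by decide), h11]
  have m6 : τ.mem 6 = σ.mem 6 := hA.mem 6 (by decide)
  have m7 : τ.mem 7 = σ.mem 7 := hA.mem 7 (by decide)
  have hpos : 0 < mask S ↔ S.Nonempty := by
    rw [Nat.pos_iff_ne_zero, Finset.nonempty_iff_ne_empty]
    refine not_congr ⟨fun h => mask_injective (by rw [h]; simp), fun h => by simp [h]⟩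
  -- The start value `k + 1` exceeds every width and acts as infinity. For the empty set no minimum
  -- is taken, and `0` gives the correct maximum.
  let d : ℕ := if S.Nonempty then k + 1 else 0
  refine WP.assign_seq (d : ℤ) ?_ rfl (ev _ ?_) ?_
  · simp only [eval_mul, eval_lt, eval_add, eval_const, eval_reg, r11, e.hk, Nat.cast_pos, hpos, d]
    split_ifs <;> simp
  · simp only [d]; split_ifs <;> omega
  refine WP.assign_seq 0 rfl rfl hcap0 ?_
  refine WP.seq_agree (m := k * 5 + 2) (m' := 2) (WP.for k 3 (fun j ρ => ∃ W : ℕ, ρ.reg 16 = W ∧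
    W ≤ k + 1 ∧ (∀ v ∈ S, (v : ℕ) < j → W ≤ width H (S.erase v)) ∧
    ((W = d ∧ ρ.reg 17 = 0) ∨ ∃ v ∈ S, ρ.reg 17 = (v : ℕ) ∧ W = width H (S.erase v)))
    (by simpa using e.hk) (by decide) (by decide) ?_ ?_ ?_ fun τ _ _ h => h) ?_
  · intro j τ z h; simpa using h
  · refine ⟨d, by simp, ?_, fun _ _ h => by omega, Or.inl ⟨rfl, by simp⟩⟩
    simp only [d]; split_ifs <;> omega
  · intro x ρ hx hρ hA' h12 ⟨W, j1, j2, j3, j4⟩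
    have e2 : OrderEnv H ((τ.setReg 16 (d : ℤ)).setReg 17 0) :=
      ⟨by simpa using e.hk, by simpa using e.pk, e.pow, e.adj⟩
    have e3 : OrderEnv H ρ := e2.congr hA' (by decide) (by decide) (by decide) (by decide)
    have s11 : ρ.reg 11 = mask S := by rw [hA'.reg 11 (by decide)]; simpa using r11
    have n6 : ρ.mem 6 = σ.mem 6 := by rw [hA'.mem 6 (by decide)]; simpa using m6
    have hb := mask_bit_int S ⟨x, hx⟩
    by_cases hxS : (⟨x, hx⟩ : Fin k) ∈ S
    · have hcell : (cell 6 (reg 11 - cell 5 (reg 12))).eval ρ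
          = width H (S.erase ⟨x, hx⟩) := by
        rw [← h6 _ hxS]
        simp only [eval_cell, eval_sub, eval_reg, s11, h12, Int.toNat_natCast, e3.pow x hx, n6]
        congr 1
        rw [← mask_erase hxS]
        push_cast; simp
      have hcond : (reg 11 / cell 5 (reg 12) % const 2 *
          (cell 6 (reg 11 - cell 5 (reg 12))).lt (reg 16)).eval ρ ≠ 0 ↔
          width H (S.erase ⟨x, hx⟩) < W := by
        rw [eval_mul, eval_lt, hcell]
        simp only [eval_mod, eval_div, eval_reg, eval_cell, eval_const, s11, h12, Int.toNat_natCast,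
          e3.pow x hx, hb, if_pos hxS, j1, Nat.cast_lt]
        split_ifs with h <;> simp [h]
      refine WP.ite rfl (fun h => ?_) fun h => ?_
      · have hlt := hcond.1 h
        refine WP.assign_seq _ hcell rfl (ev _ (by have := hwk (S.erase ⟨x, hx⟩); omega)) ?_
        refine WP.assign (x : ℤ) (by simpa using h12) rfl (ev _ (by omega)) ?_
        refine ⟨width H (S.erase ⟨x, hx⟩), by simp, by omega, fun v hv hvx => ?_,
          Or.inr ⟨⟨x, hx⟩, hxS, by simp, rfl⟩⟩
        rcases Nat.lt_succ_iff_lt_or_eq.1 hvx with h1 | h1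
        · have := j3 v hv h1; omega
        · obtain rfl : v = ⟨x, hx⟩ := Fin.ext h1
          exact le_rfl
      · refine WP.le (WP.skip ?_) (by omega)
        refine ⟨W, j1, j2, fun v hv hvx => ?_, j4⟩
        rcases Nat.lt_succ_iff_lt_or_eq.1 hvx with h1 | h1
        · exact j3 v hv h1
        · obtain rfl : v = ⟨x, hx⟩ := Fin.ext h1
          exact not_lt.1 fun h' => hcond.2 h' h
    · refine WP.ite rfl (fun h => absurd ?_ h) fun h => ?_
      · simp only [eval_mul, eval_mod, eval_div, eval_reg, eval_cell, eval_const, s11, h12,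
          Int.toNat_natCast, e3.pow x hx, hb, if_neg hxS, zero_mul]
      · refine WP.le (WP.skip ?_) (by omega)
        refine ⟨W, j1, j2, fun v hv hvx => ?_, j4⟩
        rcases Nat.lt_succ_iff_lt_or_eq.1 hvx with h1 | h1
        · exact j3 v hv h1
        · obtain rfl : v = ⟨x, hx⟩ := Fin.ext h1
          exact absurd hv hxS
  · intro ρ hρ hA' ⟨W, j1, j2, j3, j4⟩
    have s11 : ρ.reg 11 = mask S := by rw [hA'.reg 11 (by decide)]; simpa using r11
    have s14 : ρ.reg 14 = (boundary H S).card := by rw [hA'.reg 14 (by decide)]; simpa using h14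
    have n6 : ρ.mem 6 = σ.mem 6 := by rw [hA'.mem 6 (by decide)]; simpa using m6
    have n7 : ρ.mem 7 = σ.mem 7 := by rw [hA'.mem 7 (by decide)]; simpa using m7
    have hne : S.Nonempty → ∃ v ∈ S, ρ.reg 17 = (v : ℕ) ∧ W = width H (S.erase v) := by
      rintro ⟨v, hv⟩
      rcases j4 with ⟨h, _⟩ | h
      · have h1 := j3 v hv v.2
        have h2 := hwk (S.erase v)
        rw [show d = k + 1 from if_pos ⟨v, hv⟩] at h
        omega
      · exact h
    have hmax : max (boundary H S).card W = width H S := by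
      rcases S.eq_empty_or_nonempty with rfl | h
      · rcases j4 with ⟨h, _⟩ | ⟨v, hv, _⟩
        · simp [h, d, boundary_empty, width_empty]
        · exact absurd hv (Finset.notMem_empty v)
      · obtain ⟨v, hv, _, hW⟩ := hne h
        rw [width_eq_max hv fun u hu => hW ▸ j3 u hu u.2, hW]
    refine WP.store_seq (mask S) (ρ.reg 17) (by simpa using s11) rfl rfl rfl (hρ.1 17) ?_
    refine WP.store (mask S) (width H S : ℕ) (by simpa using s11) ?_ rfl rfl
      (ev _ (by have := hwk S; omega)) ⟨ρ.reg 17, ?_, ?_, ?_⟩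
    · simp only [eval_add, eval_mul, eval_sub, eval_lt, eval_reg, State.setCell_reg, s14, j1, ← hmax,
        Nat.cast_lt, Nat.cast_max]
      split_ifs with h
      · rw [max_eq_right (by exact_mod_cast h.le)]; ring
      · rw [max_eq_left (by exact_mod_cast not_lt.1 h)]; ring
    · simp [n6]
    · simp [n7]
    · intro h
      obtain ⟨v, hv, h17, hW⟩ := hne h
      exact ⟨v, hv, h17, by rw [← hW, ← hmax]; exact le_max_right _ _⟩

end Order

/-- Finds an optimal ordering of the vertices (array 8) and the adjacency matrix of the reordered graph
(array 9). -/
def orderProg : Stmt :=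
  .for 11 8 widthProg ;;
  .assign 11 (reg 8 - const 1) ;;
  .for 12 1 (.assign 17 (cell 7 (reg 11)) ;; .store 8 (reg 1 - const 1 - reg 12) (reg 17) ;;
    .assign 11 (reg 11 - cell 5 (reg 17))) ;;
  .for 12 1 (.for 13 1 (.store 9 (reg 12 * reg 1 + reg 13)
    (cell 4 (cell 8 (reg 12) * reg 1 + cell 8 (reg 13)))))

section Order
variable {w : ℕ} {ω : ℕ → Bool} {B : ℕ} {σ : State} {k : ℕ} {H : Digraph (Fin k)}

/-- Masks are visited in increasing order, so the sets with one vertex less are finished before a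
set is treated. The ordering is then read off backwards from the full set; its boundaries are at
most the width of the full set, which is at most the pathwidth. -/
theorem orderProg_spec (henv : OrderEnv H σ) (hB : k + 1 < 2 ^ (B + 8))
    (h2B : 2 ^ k < 2 ^ (B + 8)) :
    WP w ω B orderProg (2 ^ k * (k * (4 * k + 11) + 11) + k * (3 * k + 9) + 7) (fun τ =>
      ∃ e : Fin k ≃ Fin k, (∀ i, (boundary (relabel H e) (below k i)).card ≤ pathwidth H) ∧
        ∀ u v, u < k → v < k → τ.mem 9 (u * k + v) = adjInd (relabel H e) u v) σ := by
  have ev : ∀ z : ℕ, z < 2 ^ (B + 8) → (z : ℤ).natAbs < 2 ^ (B + 8) := fun z hz => by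
    rwa [Int.natAbs_natCast]
  refine WP.le (WP.seq_agree (m := 2 ^ k * (k * (4 * k + 11) + 9 + 2) + 2)
    (m' := k * (3 * k + 9) + 5) (WP.for (2 ^ k) (k * (4 * k + 11) + 9) (fun U τ =>
    ∀ S : Finset (Fin k), mask S < U → τ.mem 6 (mask S) = width H S ∧ (S.Nonempty →
      ∃ v ∈ S, τ.mem 7 (mask S) = (v : ℕ) ∧ width H (S.erase v) ≤ width H S))
    henv.pk (by decide) (by decide) ?_ ?_ ?_ fun τ _ _ h => h) ?_) (le_of_eq (by ring))
  · intro j τ z h; simpa using h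
  · intro S h; omega
  · intro U τ hU hτ hA h11 hI
    obtain ⟨S, rfl⟩ := exists_mask_eq hU
    have e : OrderEnv H τ := henv.congr hA (by decide) (by decide) (by decide) (by decide)
    refine WP.mono (widthProg_spec e S h11 hB ?_) le_rfl ?_
    · intro v hv
      refine (hI _ ?_).1
      have := mask_erase hv
      have : 0 < 2 ^ (v : ℕ) := by positivity
      omega
    · intro ρ hρ ⟨z, h6, h7, hz⟩ S' hS'
      rw [h6, h7]
      rcases Nat.lt_succ_iff_lt_or_eq.1 hS' with h | h
      · rw [Function.update_of_ne h.ne, Function.update_of_ne h.ne]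
        exact hI S' h
      · obtain rfl := mask_injective h
        rw [Function.update_self, Function.update_self]
        exact ⟨rfl, hz⟩
  intro τ hτ hA hI
  have e : OrderEnv H τ := henv.congr hA (by decide) (by decide) (by decide) (by decide)
  obtain ⟨o, ho, hoc⟩ := exists_ordering (H := H) (τ.mem 7) fun S hS => (hI S (mask_lt S)).2 hS
  have ho' : ∀ i, (boundary (relabel H o) (below k i)).card ≤ pathwidth H := fun i => by
    rw [boundary_relabel]
    exact (ho i).trans (width_le (reach_pathwidth H))
  have huniv := mask_univ (k := k)
  refine WP.le (WP.assign_seq (mask (Finset.univ : Finset (Fin k)) : ℕ) ?_ rfl (ev _ (by omega))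
    (WP.seq_agree (m := k * (3 + 2) + 2) (m' := k * (k * 3 + 2 + 2) + 2)
    (WP.for k 3 (fun j ρ => ρ.reg 11 = (mask ((below k (k - j)).map o.toEmbedding) : ℕ) ∧
      ∀ i : Fin k, k - j ≤ i → ρ.mem 8 i = (o i : ℕ)) ?_ (by decide) (by decide) ?_ ?_ ?_
      fun τ _ _ h => h) ?_)) (le_of_eq (by ring))
  · simp only [eval_sub, eval_reg, eval_const, e.pk, ← huniv]; push_cast; ring
  · simpa using e.hk
  · intro j τ z h; simpa using h
  · refine ⟨?_, fun i hi => absurd i.2 (by omega)⟩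
    rw [Nat.sub_zero, below_of_le le_rfl, Finset.map_univ_equiv]; simp
  · intro j ρ hj hρ hA' h12 ⟨j1, j2⟩
    have e1 : OrderEnv H (τ.setReg 11 (mask (Finset.univ : Finset (Fin k)) : ℕ)) :=
      ⟨by simpa using e.hk, by simpa using e.pk, e.pow, e.adj⟩
    have e2 : OrderEnv H ρ := e1.congr hA' (by decide) (by decide) (by decide) (by decide)
    have m7 : ρ.mem 7 = τ.mem 7 := hA'.mem 7 (by decide)
    have hi : k - 1 - j < k := by omega
    have hpred : k - j = k - 1 - j + 1 := by omega
    have hlt := (o ⟨k - 1 - j, hi⟩).2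
    have h17 := hoc ⟨k - 1 - j, hi⟩
    simp only [← hpred] at h17
    refine WP.assign_seq (o ⟨k - 1 - j, hi⟩ : ℕ) ?_ rfl (ev _ (by omega)) ?_
    · simp only [eval_cell, eval_reg, j1, Int.toNat_natCast, m7, h17]
    refine WP.store_seq (k - 1 - j) (o ⟨k - 1 - j, hi⟩ : ℕ) ?_ (by simp) rfl rfl (ev _ (by omega)) ?_
    · simp [h12, e2.hk]; omega
    have hm : mask ((below k (k - j)).map o.toEmbedding)
        = mask ((below k (k - (j + 1))).map o.toEmbedding) + 2 ^ (o ⟨k - 1 - j, hi⟩ : ℕ) := by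
      rw [hpred, below_succ hi, Finset.map_insert, mask_insert, show k - (j + 1) = k - 1 - j by omega]
      · rfl
      · simp [mem_below]
    refine WP.assign (mask ((below k (k - (j + 1))).map o.toEmbedding) : ℕ) ?_ rfl ?_ ⟨?_, ?_⟩
    · simp [j1, hm, e2.pow _ hlt]
    · have := mask_lt ((below k (k - (j + 1))).map o.toEmbedding)
      exact ev _ (by omega)
    · simp
    · intro i hi'
      simp only [State.setReg_mem, State.setCell_mem, if_true, Function.update_apply]
      split_ifs with h
      · obtain rfl : i = ⟨k - 1 - j, hi⟩ := Fin.ext h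
        rfl
      · exact j2 i (by omega)
  · intro ρ hρ hA' ⟨_, j2⟩
    have e1 : OrderEnv H (τ.setReg 11 (mask (Finset.univ : Finset (Fin k)) : ℕ)) :=
      ⟨by simpa using e.hk, by simpa using e.pk, e.pow, e.adj⟩
    have e2 : OrderEnv H ρ := e1.congr hA' (by decide) (by decide) (by decide) (by decide)
    refine WP.for k (k * 3 + 2) (fun j ξ => ∀ u v, u < j → v < k →
        ξ.mem 9 (u * k + v) = adjInd (relabel H o) u v) e2.hk (by decide) (by decide) ?_ ?_ ?_ ?_
    · intro j τ z h; simpa using h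
    · intro u v hu; omega
    · intro u ξ hu hξ hA2 h12 hJ
      have e3 : OrderEnv H ξ := e2.congr hA2 (by decide) (by decide) (by decide) (by decide)
      refine WP.for k 1 (fun j ζ => ∀ u' v, u' < k → v < k → (u' < u ∨ (u' = u ∧ v < j)) →
        ζ.mem 9 (u' * k + v) = adjInd (relabel H o) u' v) e3.hk (by decide) (by decide) ?_ ?_ ?_ ?_
      · intro j τ z h; simpa using h
      · intro u' v h1 h2 h3; exact hJ u' v (by omega) h2
      · intro v ζ hv hζ hA3 h13 hJ'
        have e4 : OrderEnv H ζ := e3.congr hA3 (by decide) (by decide) (by decide) (by decide)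
        have r12 : ζ.reg 12 = u := by rw [hA3.reg 12 (by decide), h12]
        have m8 : ζ.mem 8 = ρ.mem 8 := by rw [hA3.mem 8 (by decide), hA2.mem 8 (by decide)]
        have c1 := j2 ⟨u, hu⟩ (by simp)
        have c2 := j2 ⟨v, hv⟩ (by simp)
        simp only at c1 c2
        have hadj : adjInd H (o ⟨u, hu⟩) (o ⟨v, hv⟩) = adjInd (relabel H o) u v := by
          rw [adjInd_fin, adjInd_fin (relabel H o) ⟨u, hu⟩ ⟨v, hv⟩]; rfl
        refine WP.store (u * k + v) (adjInd (relabel H o) u v) ?_ ?_ rfl rfl ?_ ?_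
        · simp [r12, h13, e4.hk]
        · simp only [eval_cell, eval_add, eval_mul, eval_reg, r12, h13, e4.hk, m8, Int.toNat_natCast, c1,
            c2, toNat_mul_add, e4.adj _ _ (o ⟨u, hu⟩).2 (o ⟨v, hv⟩).2, hadj]
        · rcases adjInd_eq (relabel H o) u v with h | h <;> rw [h]
          · simp
          · exact ev 1 (by omega)
        · intro u' v' h1 h2 h3
          simp only [State.setCell_mem, if_true, Function.update_apply, mul_add_inj h2 hv]
          split_ifs with h
          · rw [h.1, h.2]
          · refine hJ' u' v' h1 h2 ?_
            rcases h3 with h3 | ⟨h3, h4⟩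
            · exact Or.inl h3
            · exact Or.inr ⟨h3, by omega⟩
      · intro ζ _ _ h u' v h1 h2
        exact h u' v (by omega) h2 (by omega)
    · intro ξ _ _ h; exact ⟨o, ho', h⟩

end Order

/-! ### The random trials -/

/-- Fills array 11 with random signs. -/
def signProg : Stmt :=
  .for 26 24 (.flip 27 ;; .store 11 (reg 26) (const 2 * reg 27 - const 1))

/-- Adds up the results of independent trials in register 23. -/
def trialsProg : Stmt :=
  .assign 23 (const 0) ;;
  .for 25 22 (signProg ;; homProg 10 ;; .assign 23 (reg 23 + reg 54))

section Trials
variable {w : ℕ} {ω : ℕ → Bool} {B : ℕ} {σ : State} {k n : ℕ} {H : Digraph (Fin k)}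
  {tA : ℕ → ℕ → ℤ} {Z : ℕ}

theorem signProg_spec {M : ℕ} (h24 : σ.reg 24 = M) :
    WP w ω B signProg (M * 4 + 2) (fun τ => τ.used = σ.used + M ∧
      ∀ j < M, τ.mem 11 j = bitSign (ω (σ.used + j))) σ := by
  refine WP.for M 2 (fun j τ => τ.used = σ.used + j ∧
      ∀ l < j, τ.mem 11 l = bitSign (ω (σ.used + l))) h24 (by decide) (by decide) ?_ ?_ ?_ ?_
  · intro j τ z h; simpa using h
  · simp
  · intro j τ hj hτ hA h26 ⟨i1, i2⟩
    refine WP.seq (m := 1) (m' := 1) (WP.flip ?_)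
    refine WP.store j (bitSign (ω (σ.used + j))) (by simpa using h26) ?_ rfl rfl ?_ ⟨?_, fun l hl => ?_⟩
    · rw [i1]
      simp only [eval_sub, eval_mul, eval_const, eval_reg, State.flip_reg, if_true, bitSign]
      cases ω (σ.used + j) <;> simp
    · unfold bitSign; split_ifs <;> simp
    · simp [i1]; ring
    · simp only [State.setCell_mem, if_true, Function.update_apply, State.flip_mem]
      split_ifs with h
      · rw [h]
      · exact i2 l (by omega)
  · intro τ _ _ h; exact h

/-- The matrix of random signs of the trial number `t`. -/
noncomputable def trialMatrix (n k : ℕ) (ω : ℕ → Bool) (t x a : ℕ) : ℤ :=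
  if x < n ∧ a < k then bitSign (ω (t * (n * k) + (x * k + a))) else 0

theorem trialMatrix_eq (n k : ℕ) (ω : ℕ → Bool) (t : ℕ) :
    (fun x (a : Fin k) => trialMatrix n k ω t x a) = signRows (trialBits n k ω t) := by
  funext x a
  unfold trialMatrix signRows trialBits
  by_cases h : x < n <;> simp [h]

theorem abs_trialMatrix_le (ω : ℕ → Bool) (t x a : ℕ) : |trialMatrix n k ω t x a| ≤ 1 := by
  unfold trialMatrix bitSign
  split_ifs <;> simp

/-- Trial `t` starts after exactly `t * (n * k)` coins, because the dynamic program draws none, so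
its matrix is that of `trialBits`. Every trial works in fresh memory, beyond the tables of the
previous one. -/
theorem trialsProg_spec {G : Digraph (Fin n)} (hH : ∀ v, ¬ H.Adj v v) (h1 : σ.reg 1 = k)
    (h8 : σ.reg 8 = (2 ^ k : ℕ)) (h9 : σ.reg 9 = Z) (h20 : σ.reg 20 = n) (h24 : σ.reg 24 = (n * k : ℕ))
    (h5 : ∀ a < k, σ.mem 5 a = (2 ^ a : ℕ))
    (hadj : ∀ u v, u < k → v < k → σ.mem 9 (u * k + v) = adjInd H u v)
    (htgt : ∀ x y, x < n → y < n → σ.mem 10 (x * n + y) = adjInd G x y)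
    {T base L : ℕ} (h22 : σ.reg 22 = T) (h30 : σ.reg 30 = base) (hused : σ.used = 0)
    (hn0 : 0 < n) (hn : n < 2 ^ (B + 8)) (hZ : 4 * (4 * n) ^ k ≤ Z)
    (hbase : base + T * ((k + 1) * Z) < 2 ^ (B + 8))
    (hL0 : 0 < L) (hL : ∀ i < k, n ^ rankOf (bdInd H i) k * n * 2 ^ k * 2 ^ k * k * k ≤ L)
    (hLB : T * L ^ k < 2 ^ (B + 8)) (hzero : ∀ j, base ≤ j → σ.mem 13 j = 0) :
    WP w ω B trialsProg
      (T * (n * k * 4 + (k * (k * (6 * k + 9) + L * (k * 7 + 20) + 10) + 5) + 5) + 3) (fun τ =>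
      τ.reg 23 = ∑ t ∈ Finset.range T, detSum H G (signRows (trialBits n k ω t)) ∧
      |τ.reg 23| ≤ ((T * L ^ k : ℕ) : ℤ)) σ := by
  have hcap0 : (0 : ℤ).natAbs < 2 ^ (B + 8) := by simp
  set h := k * (k * (6 * k + 9) + L * (k * 7 + 20) + 10) + 5 with hh
  refine WP.le (WP.assign_seq 0 rfl rfl hcap0 (WP.for T (n * k * 4 + h + 3) (fun t τ =>
    (τ.reg 23 = ∑ t ∈ Finset.range t, detSum H G (signRows (trialBits n k ω t)) ∧
      |τ.reg 23| ≤ ((t * L ^ k : ℕ) : ℤ)) ∧ τ.used = t * (n * k) ∧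
      τ.reg 30 = (base + t * ((k + 1) * Z) : ℕ) ∧ ∀ j, base + t * ((k + 1) * Z) ≤ j → τ.mem 13 j = 0)
    (by simpa using h22) (by decide) (by decide) ?_ ?_ ?_ fun τ _ _ h => h.1)) (le_of_eq (by ring))
  · intro j τ z h; simpa using h
  · simp [hused, h30]; exact hzero
  · intro t τ ht hτ hA h25 ⟨⟨i1, i2⟩, i3, i4, i5⟩
    have r24 : τ.reg 24 = (n * k : ℕ) := by rw [hA.reg 24 (by decide)]; simpa using h24
    refine WP.le (WP.seq_agree (m := n * k * 4 + 2) (m' := h + 1) (signProg_spec r24) ?_)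
      (le_of_eq (by ring))
    intro ρ hρ hA1 ⟨j1, j2⟩
    have hr : ∀ x ∈ [1, 8, 9, 20], ρ.reg x = σ.reg x := by
      intro x hx
      simp only [List.mem_cons, List.not_mem_nil, or_false] at hx
      rcases hx with rfl | rfl | rfl | rfl <;>
      · rw [hA1.reg _ (by decide), hA.reg _ (by decide)]; simp
    have hm : ∀ x ∈ [5, 9, 10], ρ.mem x = σ.mem x := by
      intro x hx
      simp only [List.mem_cons, List.not_mem_nil, or_false] at hx
      rcases hx with rfl | rfl | rfl <;>
      · rw [hA1.mem _ (by decide), hA.mem _ (by decide)]; rfl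
    have e : HomEnv H (adjInd G) (trialMatrix n k ω t) n Z 10 ρ := by
      refine ⟨?_, ?_, ?_, ?_, ?_, ?_, ?_, ?_⟩
      · rw [hr 1 (by simp), h1]
      · rw [hr 8 (by simp), h8]
      · rw [hr 9 (by simp), h9]
      · rw [hr 20 (by simp), h20]
      · rw [hm 5 (by simp)]; exact h5
      · rw [hm 9 (by simp)]; exact hadj
      · rw [hm 10 (by simp)]; exact htgt
      · intro x a hx ha
        have : x * k + a < n * k := by
          calc x * k + a < x * k + k := by omega
            _ = (x + 1) * k := by ring
            _ ≤ n * k := Nat.mul_le_mul_right _ hx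
        rw [j2 _ this, i3, trialMatrix, if_pos ⟨hx, ha⟩]
    have hstep : base + t * ((k + 1) * Z) + (k + 1) * Z = base + (t + 1) * ((k + 1) * Z) := by ring
    have hle : (t + 1) * ((k + 1) * Z) ≤ T * ((k + 1) * Z) := Nat.mul_le_mul_right _ ht
    have hLk : (t + 1) * L ^ k ≤ T * L ^ k := Nat.mul_le_mul_right _ ht
    have hLk' : L ^ k < 2 ^ (B + 8) := by
      have : L ^ k ≤ (t + 1) * L ^ k := Nat.le_mul_of_pos_left _ (by omega)
      omega
    refine WP.seq_agree (m := h) (m' := 1) (homProg_spec (base := base + t * ((k + 1) * Z)) (L := L) e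
      (Or.inr rfl) (adjInd_eq G) (fun x a => abs_trialMatrix_le ω t x a) (fun _ => hn0) hn hZ ?_ ?_ hL0 hL hLk' ?_) ?_
    · omega
    · rw [hA1.reg 30 (by decide), i4]
    · rw [hA1.mem 13 (by decide)]; exact i5
    · intro ξ hξ hA2 ⟨l1, l2, l3, l4⟩
      rw [trialMatrix_eq, table_last hH] at l1
      have r23 : ξ.reg 23 = τ.reg 23 := by rw [hA2.reg 23 (by decide), hA1.reg 23 (by decide)]
      have hb : |τ.reg 23 + ξ.reg 54| ≤ (((t + 1) * L ^ k : ℕ) : ℤ) := by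
        refine (abs_add_le _ _).trans ?_
        push_cast at *
        linarith
      refine WP.assign (τ.reg 23 + ξ.reg 54) (by simp only [eval_add, eval_reg, r23]) rfl ?_ ⟨⟨?_, ?_⟩, ?_, ?_, ?_⟩
      · rw [← Int.natCast_natAbs] at hb
        omega
      · simp [i1, l1, Finset.sum_range_succ]
      · simpa using hb
      · rw [State.setReg_used, hA2.used (by decide), j1, i3]; ring
      · rw [← hstep]; simpa using l3
      · rw [← hstep]; simpa using l4

end Trials

/-! ### The complete algorithm -/

/-- The part of the algorithm that needs no random bits. -/
def setupProg : Stmt :=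
  adjProg 2 3 4 1 ;; constProg ;; orderProg ;; .assign 20 (reg 1) ;; homProg 9 ;;
  .assign 21 (reg 54) ;; .ite (reg 6) (adjProg 0 1 10 0) .skip ;;
  .assign 20 (reg 0) ;; .assign 24 (reg 0 * reg 1) ;;
  .assign 22 (const 200 * (reg 1 + const 1) * (reg 1 + const 2) * (reg 3 * reg 3) / (reg 2 * reg 2)
    + const 1)

/-- The number of trials. -/
def trialCount (k a b : ℕ) : ℕ := 200 * (k + 1) * (k + 2) * (b * b) / (a * a) + 1

/-- A bound on the time of a dynamic program, and on the total weight of its steps for a vertex. -/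
def homCost (k L : ℕ) : ℕ := k * (k * (6 * k + 9) + L * (k * 7 + 20) + 10) + 5

/-- A bound on the time of the deterministic part. -/
def setupCost (k L E : ℕ) : ℕ :=
  (k * (k * 4 + 5) + 2) + (k * 7 + 5) + (2 ^ k * (k * (4 * k + 11) + 11) + k * (3 * k + 9) + 7)
    + homCost k L + E + 6

section Setup
variable {w : ℕ} {ω : ℕ → Bool} {B : ℕ} {σ : State} {k n : ℕ} {H : Digraph (Fin k)} {G : Digraph (Fin n)}
  {LH : Fin k → List (Fin k)} {LG : Fin n → List (Fin n)}

/-- The state before the first trial. -/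
structure Ready (H : Digraph (Fin k)) (G G' : Digraph (Fin n)) (T L : ℕ) (τ : State) : Prop where
  same : ∀ R, detSum H G' R = detSum H G R
  r1 : τ.reg 1 = k
  r8 : τ.reg 8 = (2 ^ k : ℕ)
  r9 : τ.reg 9 = (4 * (4 * n) ^ k : ℕ)
  r10 : τ.reg 10 = k.factorial
  r20 : τ.reg 20 = n
  r21 : τ.reg 21 = Nat.card (RelIso H.Adj H.Adj)
  r22 : τ.reg 22 = T
  r24 : τ.reg 24 = (n * k : ℕ)
  r30 : τ.reg 30 = ((k + 1) * (4 * (4 * n) ^ k) : ℕ)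
  m5 : ∀ a < k, τ.mem 5 a = (2 ^ a : ℕ)
  m9 : ∀ u v, u < k → v < k → τ.mem 9 (u * k + v) = adjInd H u v
  m10 : ∀ x y, x < n → y < n → τ.mem 10 (x * n + y) = adjInd G' x y
  m13 : ∀ j, (k + 1) * (4 * (4 * n) ^ k) ≤ j → τ.mem 13 j = 0
  used : τ.used = 0
  aut_le : Nat.card (RelIso H.Adj H.Adj) ≤ L ^ k

/-- If `H` has no edges, the edgeless graph, described by a zero array, may replace `G`; building
the matrix of `G` could exceed the time bound, which is only linear in `n` for pathwidth 0. -/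
theorem detSum_of_no_edges {H : Digraph (Fin k)} (h : ∀ u v, ¬ H.Adj u v) (G G' : Digraph (Fin n))
    (R : ℕ → Fin k → ℤ) : detSum H G R = detSum H G' R := by
  simp [detSum, h]

/-- The dynamic program runs once with `H` as target and the identity matrix, which yields `|Aut
H|`. The matrix of `G` is built only if `H` has an edge; `E` bounds the cost of this choice. -/
theorem setupProg_spec (hH : ∀ v, ¬ H.Adj v v) (hLH : IsAdjList H LH) (hLG : IsAdjList G LG)
    (hkn : k ≤ n) (hn : 0 < n) {a b L E : ℕ} (h0 : σ.reg 0 = n) (h1 : σ.reg 1 = k) (h2 : σ.reg 2 = a)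
    (h3 : σ.reg 3 = b) (hr : ∀ x, 4 ≤ x → σ.reg x = 0) (m0 : σ.mem 0 = degArray LG)
    (m1 : σ.mem 1 = nbrArray LG) (m2 : σ.mem 2 = degArray LH) (m3 : σ.mem 3 = nbrArray LH)
    (hm : ∀ x i, 4 ≤ x → σ.mem x i = 0) (hused : σ.used = 0) (hL0 : 0 < L)
    (hL : ∀ H' : Digraph (Fin k), (∀ i, (boundary H' (below k i)).card ≤ pathwidth H) →
      ∀ i < k, n ^ rankOf (bdInd H' i) k * n * 2 ^ k * 2 ^ k * k * k ≤ L)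
    (hLB : L ^ k < 2 ^ (B + 8)) (hE : 1 ≤ E) (hE' : ∀ u v, H.Adj u v → n * (n * 4 + 5) + 2 ≤ E)
    (hZB : (k + 1) * (4 * (4 * n) ^ k) < 2 ^ (B + 8)) (hfB : k.factorial < 2 ^ (B + 8))
    (hnk : n * (k + 1) < 2 ^ (B + 8)) (hT : trialCount k a b < 2 ^ (B + 8)) :
    WP w ω B setupProg (setupCost k L E) (fun τ => ∃ e : Fin k ≃ Fin k,
      (∀ i, (boundary (relabel H e) (below k i)).card ≤ pathwidth H) ∧
      ∃ G', Ready (relabel H e) G G' (trialCount k a b) L τ) σ := by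
  have ev : ∀ z : ℕ, z < 2 ^ (B + 8) → (z : ℤ).natAbs < 2 ^ (B + 8) := fun z hz => by
    rwa [Int.natAbs_natCast]
  set Z := 4 * (4 * n) ^ k with hZ
  have hZk : Z ≤ (k + 1) * Z := Nat.le_mul_of_pos_left _ (by omega)
  have hn1 : n ≤ n * (k + 1) := Nat.le_mul_of_pos_right _ (by omega)
  have hk1 : k + 1 ≤ n * (k + 1) := Nat.le_mul_of_pos_left _ hn
  have h2k : 2 ^ k ≤ (4 * n) ^ k := Nat.pow_le_pow_left (by omega) k
  unfold setupCost
  refine WP.le (WP.seq_agree (m := k * (k * 4 + 5) + 2)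
    (m' := (k * 7 + 5) + (2 ^ k * (k * (4 * k + 11) + 11) + k * (3 * k + 9) + 7) + homCost k L + E + 6)
    (adjProg_spec hLH (by omega) (by omega) (by omega) (by omega) h1 m2 m3 fun i => hm 4 i le_rfl) ?_)
    (le_of_eq (by ring))
  intro τ hτ hA ⟨i1, i2⟩
  have t0 : τ.reg 0 = n := by rw [hA.reg 0 (by decide), h0]
  have t1 : τ.reg 1 = k := by rw [hA.reg 1 (by decide), h1]
  refine WP.le (WP.seq_agree (m := k * 7 + 5)
    (m' := (2 ^ k * (k * (4 * k + 11) + 11) + k * (3 * k + 9) + 7) + homCost k L + E + 6)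
    (constProg_spec t0 t1 hn (fun i => by rw [hA.mem 11 (by decide), hm 11 i (by omega)]) (by omega) hfB) ?_)
    (le_of_eq (by ring))
  intro τ₂ hτ₂ hA₂ ⟨c1, c2, c3, c4, c5⟩
  have e : OrderEnv H τ₂ := ⟨by rw [hA₂.reg 1 (by decide), t1], c2, c1,
    by rw [hA₂.mem 4 (by decide)]; exact i1⟩
  refine WP.le (WP.seq_agree (m := 2 ^ k * (k * (4 * k + 11) + 11) + k * (3 * k + 9) + 7)
    (m' := homCost k L + E + 6) (orderProg_spec e (by omega) (by omega)) ?_) (le_of_eq (by ring))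
  intro τ₃ hτ₃ hA₃ ⟨o, ho, hadj⟩
  have hbd := hL _ ho
  refine WP.assign_seq (k : ℤ) (by rw [eval_reg, hA₃.reg 1 (by decide), e.hk]) rfl (ev _ (by omega)) ?_
  have hR : ∀ x a, x < k → a < k → τ₃.mem 11 (x * k + a) = if x = a then 1 else 0 := by
    rw [hA₃.mem 11 (by decide)]; exact c5
  refine WP.seq_agree (m := homCost k L) (m' := E + 5) (homProg_spec (H := relabel H o)
    (tA := adjInd (relabel H o)) (A := fun x a => if x = a then 1 else 0) (N := k) (Z := Z) (base := 0)
    (L := L) ?_ (Or.inl rfl) (adjInd_eq _) ?_ (fun h => h) (by omega) ?_ ?_ ?_ hL0 ?_ hLB ?_) ?_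
  · refine ⟨?_, ?_, ?_, ?_, ?_, ?_, ?_, ?_⟩
    · rw [State.setReg_reg, if_neg (by decide), hA₃.reg 1 (by decide), e.hk]
    · rw [State.setReg_reg, if_neg (by decide), hA₃.reg 8 (by decide), c2]
    · rw [State.setReg_reg, if_neg (by decide), hA₃.reg 9 (by decide), c3]
    · simp
    · rw [State.setReg_mem, hA₃.mem 5 (by decide)]; exact c1
    · exact hadj
    · exact hadj
    · exact hR
  · intro x a; split_ifs <;> simp
  · exact Nat.mul_le_mul_left 4 (Nat.pow_le_pow_left (by omega) k)
  · omega
  · rw [State.setReg_reg, if_neg (by decide), hA₃.reg 30 (by decide), hA₂.reg 30 (by decide),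
      hA.reg 30 (by decide), hr 30 (by omega)]; rfl
  · intro i hi
    -- Since `k ≤ n`, the bound for maps to `G` also covers the run with the target `H`.
    refine le_trans ?_ (hbd i hi)
    gcongr
  · intro j _
    rw [State.setReg_mem, hA₃.mem 13 (by decide), hA₂.mem 13 (by decide), hA.mem 13 (by decide),
      hm 13 j (by omega)]
  intro τ₄ hτ₄ hA₄ ⟨d1, d2, d3, d4⟩
  have hH' : ∀ v, ¬ (relabel H o).Adj v v := fun v => hH (o v)
  rw [table_last hH', detSum_single _ _ (fun x a => by simp [Fin.ext_iff])] at d1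
  rw [zero_add] at d3 d4
  have haut : Nat.card (RelIso (relabel H o).Adj (relabel H o).Adj) ≤ L ^ k := by
    rw [d1, Nat.abs_cast] at d2
    exact_mod_cast d2
  refine WP.assign_seq (Nat.card (RelIso (relabel H o).Adj (relabel H o).Adj) : ℤ) (by rw [eval_reg, d1]) rfl
    (ev _ (haut.trans_lt hLB)) ?_
  have hreg : ∀ x ∈ [0, 1, 2, 3], τ₄.reg x = σ.reg x := by
    intro x hx
    simp only [List.mem_cons, List.not_mem_nil, or_false] at hx
    rcases hx with rfl | rfl | rfl | rfl <;>
    rw [hA₄.reg _ (by decide), State.setReg_reg, if_neg (by decide), hA₃.reg _ (by decide),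
      hA₂.reg _ (by decide), hA.reg _ (by decide)]
  have hmem : ∀ x ∈ [0, 1, 10], τ₄.mem x = σ.mem x := by
    intro x hx
    simp only [List.mem_cons, List.not_mem_nil, or_false] at hx
    rcases hx with rfl | rfl | rfl <;>
    rw [hA₄.mem _ (by decide), State.setReg_mem, hA₃.mem _ (by decide),
      hA₂.mem _ (by decide), hA.mem _ (by decide)]
  have h6 : τ₄.reg 6 = τ.reg 6 := by
    rw [hA₄.reg _ (by decide), State.setReg_reg, if_neg (by decide), hA₃.reg _ (by decide),
      hA₂.reg _ (by decide)]
  have hu : τ₄.used = 0 := by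
    rw [hA₄.used (by decide), State.setReg_used, hA₃.used (by decide), hA₂.used (by decide),
      hA.used (by decide), hused]
  have f8 : τ₄.reg 8 = (2 ^ k : ℕ) := by
    rw [hA₄.reg _ (by decide), State.setReg_reg, if_neg (by decide), hA₃.reg _ (by decide), c2]
  have f9 : τ₄.reg 9 = Z := by
    rw [hA₄.reg _ (by decide), State.setReg_reg, if_neg (by decide), hA₃.reg _ (by decide), c3]
  have f10 : τ₄.reg 10 = k.factorial := by
    rw [hA₄.reg _ (by decide), State.setReg_reg, if_neg (by decide), hA₃.reg _ (by decide), c4]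
  have f5 : ∀ a < k, τ₄.mem 5 a = (2 ^ a : ℕ) := by
    rw [hA₄.mem _ (by decide), State.setReg_mem, hA₃.mem _ (by decide)]; exact c1
  have f9' : ∀ u v, u < k → v < k → τ₄.mem 9 (u * k + v) = adjInd (relabel H o) u v := by
    rw [hA₄.mem _ (by decide), State.setReg_mem]; exact hadj
  refine WP.seq_agree (m := E + 1) (m' := 3) (Q' := fun ρ => ∃ G' : Digraph (Fin n),
      (∀ R, detSum (relabel H o) G' R = detSum (relabel H o) G R) ∧
      ∀ x y, x < n → y < n → ρ.mem 10 (x * n + y) = adjInd G' x y) (WP.ite rfl (fun h => ?_) fun h => ?_) ?_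
  · obtain ⟨u, v, huv⟩ : ∃ u v, H.Adj u v := by
      rcases i2 with ⟨h', _⟩ | ⟨_, h'⟩
      · refine absurd ?_ h
        rw [eval_reg, State.setReg_reg, if_neg (by decide), h6, h', hr 6 (by omega)]
      · exact h'
    refine WP.mono (adjProg_spec hLG (by omega) (by omega) (by omega) (by omega) ?_ ?_ ?_ ?_) (hE' u v huv)
      fun ρ _ hρ => ⟨G, fun _ => rfl, hρ.1⟩
    · rw [State.setReg_reg, if_neg (by decide), hreg 0 (by simp), h0]
    · rw [State.setReg_mem, hmem 0 (by simp), m0]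
    · rw [State.setReg_mem, hmem 1 (by simp), m1]
    · intro i
      rw [State.setReg_mem, hmem 10 (by simp), hm 10 i (by omega)]
  · have hno : ∀ u v, ¬ H.Adj u v := by
      rcases i2 with ⟨_, h'⟩ | ⟨h', _⟩
      · exact h'
      · rw [eval_reg, State.setReg_reg, if_neg (by decide), h6, h'] at h
        exact absurd h one_ne_zero
    refine WP.le (WP.skip ⟨⟨fun _ _ => False⟩, fun R => detSum_of_no_edges (H := relabel H o)
      (fun u v => hno (o u) (o v)) _ _ R, ?_⟩) hE
    intro x y hx hy
    rw [State.setReg_mem, hmem 10 (by simp), hm 10 _ (by omega), adjInd, if_neg (by simp)]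
  intro τ₅ hτ₅ hA₅ ⟨G', hG, hG'⟩
  have hreg' : ∀ x ∈ [0, 1, 2, 3, 8, 9, 10, 30], τ₅.reg x = τ₄.reg x := by
    intro x hx
    simp only [List.mem_cons, List.not_mem_nil, or_false] at hx
    rcases hx with rfl | rfl | rfl | rfl | rfl | rfl | rfl | rfl <;>
    rw [hA₅.reg _ (by decide), State.setReg_reg, if_neg (by decide)]
  have g0 : τ₅.reg 0 = n := by rw [hreg' 0 (by simp), hreg 0 (by simp), h0]
  have g1 : τ₅.reg 1 = k := by rw [hreg' 1 (by simp), hreg 1 (by simp), h1]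
  have g2 : τ₅.reg 2 = a := by rw [hreg' 2 (by simp), hreg 2 (by simp), h2]
  have g3 : τ₅.reg 3 = b := by rw [hreg' 3 (by simp), hreg 3 (by simp), h3]
  refine WP.assign_seq (n : ℤ) (by simpa using g0) rfl (ev _ (by omega)) ?_
  refine WP.assign_seq (n * k : ℕ) (by simp [g0, g1]) rfl (ev _ (by rw [mul_add] at hnk; omega)) ?_
  refine WP.assign (trialCount k a b : ℕ) (by simp [g1, g2, g3, trialCount]) rfl (ev _ hT)
    ⟨o, ho, G', hG, ?_, ?_, ?_, ?_, ?_, ?_, ?_, ?_, ?_, ?_, ?_, ?_, ?_, ?_, haut⟩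
  · simpa using g1
  · simpa [f8] using hreg' 8 (by simp)
  · simpa [f9, hZ] using hreg' 9 (by simp)
  · simpa [f10] using hreg' 10 (by simp)
  · simp
  · simp [hA₅.reg 21 (by decide)]
  · simp
  · simp
  · simpa [d3, hZ] using hreg' 30 (by simp)
  · simpa [hA₅.mem 5 (by decide)] using f5
  · simpa [hA₅.mem 9 (by decide)] using f9'
  · simpa using hG'
  · simpa [hA₅.mem 13 (by decide)] using d4
  · simpa [hA₅.used (by decide)] using hu

end Setup

/-- This makes the ordering found by the deterministic part the same for all outcomes, so that the
probability can be computed for a fixed relabelled graph. -/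
theorem Exec.of_det {w : ℕ} {ω ω' : ℕ → Bool} {s : Stmt} {σ τ : State} {t : ℕ}
    (h : Exec w ω s σ τ t) (hs : s.det = true) : Exec w ω' s σ τ t := by
  induction h with
  | skip σ => exact .skip σ
  | assign σ x e => exact .assign σ x e
  | store σ a i e => exact .store σ a i e
  | flip σ x => simp [Stmt.det] at hs
  | seq _ _ ih1 ih2 =>
    simp only [Stmt.det, Bool.and_eq_true] at hs
    exact .seq (ih1 hs.1) (ih2 hs.2)
  | iteTrue hb _ ih =>
    simp only [Stmt.det, Bool.and_eq_true] at hs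
    exact .iteTrue hb (ih hs.1)
  | iteFalse hb _ ih =>
    simp only [Stmt.det, Bool.and_eq_true] at hs
    exact .iteFalse hb (ih hs.2)
  | whileTrue hb _ _ ih1 ih2 =>
    exact .whileTrue hb (ih1 hs) (ih2 hs)
  | whileFalse hb => exact .whileFalse hb

/-- The estimate that is computed from the random trials. -/
noncomputable def estimate {k n : ℕ} (H : Digraph (Fin k)) (G : Digraph (Fin n)) (T : ℕ) (ω : ℕ → Bool) : ℤ :=
  (2 * ∑ t ∈ Finset.range T, detSum H G (signRows (trialBits n k ω t))
      + ((T * k.factorial * Nat.card (RelIso H.Adj H.Adj) : ℕ) : ℤ))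
    / (2 * ((T * k.factorial * Nat.card (RelIso H.Adj H.Adj) : ℕ) : ℤ))

/-- The part of the algorithm that uses random bits. -/
def randomProg : Stmt :=
  trialsProg ;; .assign 28 (reg 22 * reg 10 * reg 21) ;;
  .assign 0 ((const 2 * reg 23 + reg 28) / (const 2 * reg 28))

/-- The algorithm. -/
def mainProg : Stmt :=
  .ite ((reg 0).lt (reg 1)) (.assign 0 (const 0)) (setupProg ;; randomProg)

/-- A bound on the time of the part that uses random bits. -/
def randomCost (n k L T : ℕ) : ℕ := T * (n * k * 4 + homCost k L + 5) + 5

section Main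
variable {w : ℕ} {ω : ℕ → Bool} {B : ℕ} {σ : State} {k n : ℕ} {H : Digraph (Fin k)} {G : Digraph (Fin n)}
  {LH : Fin k → List (Fin k)} {LG : Fin n → List (Fin n)}

theorem randomProg_spec {G' : Digraph (Fin n)} {T L : ℕ} (hR : Ready H G G' T L σ)
    (hH : ∀ v, ¬ H.Adj v v) (hn : 0 < n) (hL0 : 0 < L)
    (hL : ∀ i < k, n ^ rankOf (bdInd H i) k * n * 2 ^ k * 2 ^ k * k * k ≤ L)
    (hnk : n * (k + 1) < 2 ^ (B + 8)) (hZB : (T + 1) * ((k + 1) * (4 * (4 * n) ^ k)) < 2 ^ (B + 8))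
    (hLB : T * L ^ k * (k.factorial + 2) < 2 ^ (B + 8)) :
    WP w ω B randomProg (randomCost n k L T) (fun τ => τ.reg 0 = estimate H G T ω) σ := by
  have hn1 : n ≤ n * (k + 1) := Nat.le_mul_of_pos_right _ (by omega)
  have hTL : T * L ^ k < 2 ^ (B + 8) := (Nat.le_mul_of_pos_right _ (by omega)).trans_lt hLB
  rw [randomCost, homCost]
  refine WP.le (WP.seq_agree (m' := 2) (trialsProg_spec (G := G') (B := B) (ω := ω) hH hR.r1 hR.r8 hR.r9 hR.r20 hR.r24
    hR.m5 hR.m9 hR.m10 hR.r22 hR.r30 hR.used hn (by omega) le_rfl (by linarith) hL0 hL hTL hR.m13) ?_)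
    (le_of_eq (by ring))
  intro τ hτ hA ⟨i1, i2⟩
  simp only [hR.same] at i1
  set aut := Nat.card (RelIso H.Adj H.Adj) with haut
  have s22 : τ.reg 22 = T := by rw [hA.reg 22 (by decide), hR.r22]
  have s10 : τ.reg 10 = k.factorial := by rw [hA.reg 10 (by decide), hR.r10]
  have s21 : τ.reg 21 = aut := by rw [hA.reg 21 (by decide), hR.r21]
  have hD : T * k.factorial * aut ≤ T * L ^ k * k.factorial := by
    have := Nat.mul_le_mul_left (T * k.factorial) hR.aut_le
    linarith
  have hLB' : T * L ^ k * k.factorial + 2 * (T * L ^ k) < 2 ^ (B + 8) := by linarith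
  refine WP.assign_seq (T * k.factorial * aut : ℕ) (by simp [s22, s10, s21]) rfl
    (by rw [Int.natAbs_natCast]; omega) ?_
  refine WP.assign (estimate H G T ω) ?_ rfl ?_ (by simp)
  · simp only [eval_div, eval_add, eval_mul, eval_const, eval_reg, State.setReg_reg, Nat.reduceEqDiff,
      if_true, if_false, i1, estimate, haut]
  -- The numerator is at most `2 * T * L^k + T * k! * L^k`, hence the factor `k! + 2` in the
  -- hypothesis. The doubled denominator is never stored.
  · rw [estimate, ← i1]
    refine (Int.natAbs_ediv_le_natAbs _ _).trans_lt ?_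
    rw [← Int.natCast_natAbs] at i2
    have := hR.aut_le
    rw [← haut]
    omega

theorem mainProg_spec (hH : ∀ v, ¬ H.Adj v v) (hLH : IsAdjList H LH) (hLG : IsAdjList G LG)
    (hkn : k ≤ n) (hn : 0 < n) {a b L E : ℕ} (h0 : σ.reg 0 = n) (h1 : σ.reg 1 = k) (h2 : σ.reg 2 = a)
    (h3 : σ.reg 3 = b) (hr : ∀ x, 4 ≤ x → σ.reg x = 0) (m0 : σ.mem 0 = degArray LG)
    (m1 : σ.mem 1 = nbrArray LG) (m2 : σ.mem 2 = degArray LH) (m3 : σ.mem 3 = nbrArray LH)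
    (hm : ∀ x i, 4 ≤ x → σ.mem x i = 0) (hused : σ.used = 0) (hL0 : 0 < L)
    (hL : ∀ H' : Digraph (Fin k), (∀ i, (boundary H' (below k i)).card ≤ pathwidth H) →
      ∀ i < k, n ^ rankOf (bdInd H' i) k * n * 2 ^ k * 2 ^ k * k * k ≤ L)
    (hE : 1 ≤ E) (hE' : ∀ u v, H.Adj u v → n * (n * 4 + 5) + 2 ≤ E)
    (hnk : n * (k + 1) < 2 ^ (B + 8)) (hT : trialCount k a b < 2 ^ (B + 8))
    (hZB : (trialCount k a b + 1) * ((k + 1) * (4 * (4 * n) ^ k)) < 2 ^ (B + 8))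
    (hLB : trialCount k a b * L ^ k * (k.factorial + 2) < 2 ^ (B + 8)) (hσ : Bdd B σ) :
    ∃ e : Fin k ≃ Fin k, ∀ ω, ∃ τ t, Exec w ω mainProg σ τ t ∧
      τ.reg 0 = estimate (relabel H e) G (trialCount k a b) ω ∧
      t ≤ (setupCost k L E + randomCost n k L (trialCount k a b) + 1) * unitCost w B := by
  have hT0 : 0 < trialCount k a b := Nat.succ_pos _
  have hLk : 0 < L ^ k := by positivity
  set T := trialCount k a b
  have hfB : k.factorial < 2 ^ (B + 8) := by
    have : k.factorial + 2 ≤ T * L ^ k * (k.factorial + 2) := Nat.le_mul_of_pos_left _ (by positivity)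
    omega
  have hLB' : L ^ k < 2 ^ (B + 8) := by
    refine lt_of_le_of_lt ?_ hLB
    rw [mul_comm T, mul_assoc]
    exact Nat.le_mul_of_pos_right _ (by positivity)
  have hZB' : (k + 1) * (4 * (4 * n) ^ k) < 2 ^ (B + 8) :=
    (Nat.le_mul_of_pos_left _ (by omega)).trans_lt hZB
  -- The ordering is fixed by a run with arbitrary coins, before `ω` is introduced.
  obtain ⟨τ, t, x1, x2, ⟨e, he, G', hG'⟩, x3⟩ := setupProg_spec (w := w) (ω := fun _ => false) hH hLH hLG hkn
    hn h0 h1 h2 h3 hr m0 m1 m2 m3 hm hused hL0 hL hLB' hE hE' hZB' hfB hnk hT hσ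
  refine ⟨e, fun ω => ?_⟩
  have hmain : WP w ω B mainProg (setupCost k L E + randomCost n k L T + 1)
      (fun ρ => ρ.reg 0 = estimate (relabel H e) G T ω) σ := by
    refine WP.ite rfl (fun h => absurd ?_ h) fun h => WP.seq fun _ => ?_
    · simp [h0, h1, hkn]
    · exact ⟨τ, t, x1.of_det (by decide), x2, randomProg_spec hG' (fun v => hH (e v)) hn hL0 (hL _ he)
        hnk hZB hLB, x3⟩
  obtain ⟨ρ, t', y1, _, y2, y3⟩ := hmain hσ
  exact ⟨ρ, t', y1, y2, y3⟩

theorem mainProg_spec_of_lt (hkn : n < k) (h0 : σ.reg 0 = n) (h1 : σ.reg 1 = k) (hσ : Bdd B σ)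
    (ω : ℕ → Bool) : ∃ τ t, Exec w ω mainProg σ τ t ∧ τ.reg 0 = 0 ∧ t ≤ 2 * unitCost w B := by
  have hmain : WP w ω B mainProg 2 (fun ρ => ρ.reg 0 = 0) σ := by
    refine WP.ite rfl (fun h => ?_) fun h => absurd h ?_
    · exact WP.assign 0 rfl rfl (by simp) (by simp)
    · simp [h0, h1, hkn]
  obtain ⟨ρ, t', y1, _, y2, y3⟩ := hmain hσ
  exact ⟨ρ, t', y1, y2, y3⟩

end Main

/-! ### Accuracy of the output -/

instance : MeasureTheory.IsProbabilityMeasure coinMeasure := by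
  unfold coinMeasure; infer_instance

/-- Rounding a good approximation of an integer to the nearest integer does little harm. -/
theorem abs_round_sub_le {X D : ℤ} {S : ℕ} {δ : ℝ} (hD : 0 < D)
    (h : |(X : ℝ) - D * S| ≤ δ * (D * S)) :
    |(((2 * X + D) / (2 * D) : ℤ) : ℝ) - S| ≤ 2 * δ * S := by
  have hD' : (0 : ℝ) < D := by exact_mod_cast hD
  have h1 := Int.ediv_mul_le (2 * X + D) (b := 2 * D) (by omega)
  have h2 := Int.lt_ediv_add_one_mul_self (2 * X + D) (b := 2 * D) (by omega)
  set r := (2 * X + D) / (2 * D) with hr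
  have h1' : (r : ℝ) * (2 * D) ≤ 2 * X + D := by exact_mod_cast h1
  have h2' : (2 * X + D : ℝ) < (r + 1) * (2 * D) := by exact_mod_cast h2
  obtain ⟨h3, h4⟩ := abs_le.1 h
  have h5 : (r : ℝ) - S ≤ δ * S + 1 / 2 := by
    by_contra hc
    push Not at hc
    nlinarith
  have h6 : -(δ * S + 1 / 2) ≤ (r : ℝ) - S := by
    by_contra hc
    push Not at hc
    nlinarith
  -- Rounding adds an error of at most `1/2`. Either this is at most `δ * S`, or the total error is
  -- below 1 and the integer `r` equals `S`.
  rcases le_or_gt (1 / 2) (δ * S) with h7 | h7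
  · rw [abs_le]; constructor <;> linarith
  · have h8 : r = S := by
      have h9 : ((r - S : ℤ) : ℝ) < 1 := by push_cast; linarith
      have h10 : (-1 : ℝ) < ((r - S : ℤ) : ℝ) := by push_cast; linarith
      have h11 : r - S < 1 := by exact_mod_cast h9
      have h12 : -1 < r - S := by exact_mod_cast h10
      omega
    have h13 : 0 ≤ δ * (D * S) := (abs_nonneg _).trans h
    rw [h8]
    simp only [Int.cast_natCast, sub_self, abs_zero]
    have : 0 ≤ (δ * S) * D := by linarith
    have := nonneg_of_mul_nonneg_left this hD'
    linarith

/-- The concentration is used with `ε / 2`, which turns 50 into 200 and leaves room for the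
rounding. -/
theorem estimate_concentration {k n : ℕ} (H : Digraph (Fin k)) (G : Digraph (Fin n)) (hn : 0 < n)
    {T : ℕ} (hT0 : 0 < T) {ε : ℝ} (hε : 0 < ε) (hT : 200 * ((k + 1) * (k + 2)) ≤ ε ^ 2 * T) :
    99 / 100 ≤ coinMeasure {ω | (1 - ε) * (subCount H G : ℝ) ≤ (estimate H G T ω : ℝ) ∧
      (estimate H G T ω : ℝ) ≤ (1 + ε) * (subCount H G : ℝ)} := by
  refine (detSum_concentration H G hn (half_pos hε) (T := T) ?_).trans
    (MeasureTheory.measure_mono fun ω hω => ?_)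
  · have : (ε / 2) ^ 2 * T = ε ^ 2 * T / 4 := by ring
    rw [this]; linarith
  · have haut := card_relIso_pos H
    have hD : 0 < ((T * k.factorial * Nat.card (RelIso H.Adj H.Adj) : ℕ) : ℤ) := by
      have := k.factorial_pos
      positivity
    have hω' : |((∑ t : Fin T, detSum H G (signRows (trialBits n k ω t)) : ℤ) : ℝ)
        - T * (k.factorial * Nat.card (InjHom H G))|
        ≤ ε / 2 * (T * (k.factorial * Nat.card (InjHom H G))) := hω
    have heq : (T : ℝ) * (k.factorial * Nat.card (InjHom H G))
        = (((T * k.factorial * Nat.card (RelIso H.Adj H.Adj) : ℕ) : ℤ) : ℝ) * subCount H G := by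
      rw [card_injHom]; push_cast; ring
    rw [heq, ← Finset.sum_range (fun t => detSum H G (signRows (trialBits n k ω t)))] at hω'
    have h := abs_round_sub_le hD hω'
    rw [← estimate, abs_le] at h
    refine ⟨?_, ?_⟩ <;> linarith [h.1, h.2]

theorem pathwidth_le {k : ℕ} (H : Digraph (Fin k)) : pathwidth H ≤ k := by
  refine Nat.sInf_le ⟨⟨0, fun _ => Finset.univ, fun v => ⟨0, Finset.mem_univ _⟩,
      fun _ _ _ _ _ _ _ _ => Finset.mem_univ _,
      fun _ _ _ => ⟨0, Finset.mem_univ _, Finset.mem_univ _⟩⟩, fun i => ?_⟩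
  simp

/-! ### Numerical bounds for lengths and running times -/

section Bounds
variable {k n : ℕ}

/-- The total weight of the steps of the dynamic program for one vertex. -/
def levelWeight (n k q : ℕ) : ℕ := n ^ (q + 1) * 4 ^ k * (k * k + 1)

/-- Codes, images, pairs of masks and pairs of columns contribute `n^q`, `n`, `4^k` and `k^2`. The
`+ 1` in `levelWeight` keeps it positive for `k = 0`. -/
theorem level_le (hn : 0 < n) {H : Digraph (Fin k)} {q : ℕ}
    (hq : ∀ i, (boundary H (below k i)).card ≤ q) (i : ℕ) :
    n ^ rankOf (bdInd H i) k * n * 2 ^ k * 2 ^ k * k * k ≤ levelWeight n k q := by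
  have h1 : n ^ rankOf (bdInd H i) k ≤ n ^ q := Nat.pow_le_pow_right hn (by rw [rankOf_bdInd]; exact hq i)
  have h2 : (4 : ℕ) ^ k = 2 ^ k * 2 ^ k := by rw [show (4 : ℕ) = 2 * 2 by rfl, mul_pow]
  calc n ^ rankOf (bdInd H i) k * n * 2 ^ k * 2 ^ k * k * k
      ≤ n ^ q * n * 2 ^ k * 2 ^ k * k * k := by gcongr
    _ = n ^ (q + 1) * 4 ^ k * (k * k) := by rw [h2]; ring
    _ ≤ levelWeight n k q := Nat.mul_le_mul_left _ (Nat.le_succ _)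

/-- The length of the numbers in the algorithm. -/
def sizeBound (w k : ℕ) : ℕ := 16 * w * (k + 1) ^ 2

/-- The bound on the lengths is a multiple of `w`, so numbers occupy at most `(16 + 9 + 1) * (k +
1)^2` words for every `w`. The constant is `20000 * 26^2 + 1`. -/
theorem unitCost_sizeBound_le {w : ℕ} (hw : 0 < w) (k : ℕ) :
    unitCost w (sizeBound w k) ≤ 13520001 * (k + 1) ^ 4 := by
  have h1 : wordBound w (sizeBound w k) ≤ 26 * (k + 1) ^ 2 := by
    unfold wordBound sizeBound
    have : 1 ≤ (k + 1) ^ 2 := Nat.one_le_pow _ _ (by omega)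
    calc (16 * w * (k + 1) ^ 2 + 9) / w + 1 ≤ (w * (16 * (k + 1) ^ 2 + 9)) / w + 1 := by
          gcongr
          nlinarith
      _ = 16 * (k + 1) ^ 2 + 9 + 1 := by rw [Nat.mul_div_cancel_left _ hw]
      _ ≤ 26 * (k + 1) ^ 2 := by omega
  unfold unitCost
  calc 1 + 20000 * wordBound w (sizeBound w k) ^ 2 ≤ 1 + 20000 * (26 * (k + 1) ^ 2) ^ 2 := by gcongr
    _ = 1 + 13520000 * (k + 1) ^ 4 := by ring
    _ ≤ 13520001 * (k + 1) ^ 4 := by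
      have : 1 ≤ (k + 1) ^ 4 := Nat.one_le_pow _ _ (by omega)
      omega

theorem trialCount_le {w a b : ℕ} (hk : k + 1 ≤ 2 ^ w) (hb : b ≤ 2 ^ w) (hb0 : 0 < b) :
    trialCount k a b + 1 ≤ 2 ^ (4 * w + 9) := by
  have h1 : 200 * (k + 1) * (k + 2) * (b * b) / (a * a) ≤ 200 * (k + 1) * (k + 2) * (b * b) :=
    Nat.div_le_self _ _
  have h3 : k + 2 ≤ 2 * 2 ^ w := by omega
  have h4 : 1 * 2 * (1 * 1) ≤ (k + 1) * (k + 2) * (b * b) := by gcongr <;> omega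
  calc trialCount k a b + 1 ≤ 256 * ((k + 1) * (k + 2) * (b * b)) := by
        unfold trialCount
        nlinarith
    _ ≤ 256 * (2 ^ w * (2 * 2 ^ w) * (2 ^ w * 2 ^ w)) := by gcongr
    _ = 2 ^ (4 * w + 9) := by
      rw [show (256 : ℕ) = 2 ^ 8 by rfl, pow_add, show 4 * w = w + w + w + w by ring]
      simp only [pow_add]; ring

theorem tables_le {w a b : ℕ} (hk : k + 1 ≤ 2 ^ w) (hw : 0 < w) (hb : b ≤ 2 ^ w) (hb0 : 0 < b)
    (hn : n ≤ 2 ^ w) : (trialCount k a b + 1) * ((k + 1) * (4 * (4 * n) ^ k)) ≤ 2 ^ sizeBound w k := by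
  calc (trialCount k a b + 1) * ((k + 1) * (4 * (4 * n) ^ k))
      ≤ 2 ^ (4 * w + 9) * (2 ^ w * (2 ^ 2 * (2 ^ 2 * 2 ^ w) ^ k)) := by
        gcongr
        · exact trialCount_le hk hb hb0
        · norm_num
        · norm_num
    _ = 2 ^ (4 * w + 9 + (w + (2 + (2 + w) * k))) := by
      simp only [← pow_add, ← pow_mul]
    _ ≤ 2 ^ sizeBound w k := by
      refine Nat.pow_le_pow_right (by omega) ?_
      unfold sizeBound
      nlinarith [Nat.zero_le (w * k), Nat.zero_le (w * k * k), Nat.mul_le_mul_right k hw]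

/-- A level weight has `O(w * (k + 1))` bits, and its `k`-th power dominates; this is why stored
numbers need `O(w * (k + 1)^2)` bits. -/
theorem values_le {w a b q : ℕ} (hk : k + 1 ≤ 2 ^ w) (hw : 0 < w) (hb : b ≤ 2 ^ w) (hb0 : 0 < b)
    (hn : n ≤ 2 ^ w) (hq : q ≤ k) :
    trialCount k a b * levelWeight n k q ^ k * (k.factorial + 2) ≤ 2 ^ sizeBound w k := by
  have hL : levelWeight n k q ≤ 2 ^ (w * (k + 1) + 2 * k + 2 * w) := by
    calc levelWeight n k q ≤ (2 ^ w) ^ (k + 1) * (2 ^ 2) ^ k * (2 ^ w * 2 ^ w) := by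
          unfold levelWeight
          gcongr ?_ * ?_ * ?_
          · exact (Nat.pow_le_pow_left hn _).trans (Nat.pow_le_pow_right (by positivity) (by omega))
          · norm_num
          · exact (by nlinarith : k * k + 1 ≤ (k + 1) * (k + 1)).trans (Nat.mul_le_mul hk hk)
      _ = 2 ^ (w * (k + 1) + 2 * k + 2 * w) := by
        simp only [← pow_add, ← pow_mul]; congr 1; ring
  have hf : k.factorial + 2 ≤ 2 ^ (w * k + 2) := by
    have h1 : k.factorial ≤ (2 ^ w) ^ k := k.factorial_le_pow.trans (Nat.pow_le_pow_left (by omega) k)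
    have h2 := k.factorial_pos
    rw [← pow_mul] at h1
    rw [pow_add]
    omega
  calc trialCount k a b * levelWeight n k q ^ k * (k.factorial + 2)
      ≤ 2 ^ (4 * w + 9) * (2 ^ (w * (k + 1) + 2 * k + 2 * w)) ^ k * 2 ^ (w * k + 2) := by
        gcongr
        exact (Nat.le_succ _).trans (trialCount_le hk hb hb0)
    _ = 2 ^ (4 * w + 9 + (w * (k + 1) + 2 * k + 2 * w) * k + (w * k + 2)) := by
      simp only [← pow_add, ← pow_mul]
    _ ≤ 2 ^ sizeBound w k := by
      refine Nat.pow_le_pow_right (by omega) ?_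
      unfold sizeBound
      nlinarith [Nat.zero_le (w * k), Nat.zero_le (w * k * k), Nat.mul_le_mul_right k hw,
        Nat.mul_le_mul_right (k * k) hw]

theorem homCost_le {M : ℕ} (hM : 0 < M) : homCost k (M * (k * k + 1)) ≤ 44 * M * (k + 1) ^ 4 := by
  unfold homCost
  -- With `M = m + 1` both sides become polynomials with natural coefficients.
  obtain ⟨m, rfl⟩ := Nat.exists_eq_add_of_lt hM
  ring_nf
  nlinarith [Nat.zero_le (m * k), Nat.zero_le (m * k ^ 2), Nat.zero_le (m * k ^ 3), Nat.zero_le (m * k ^ 4),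
    Nat.zero_le (k ^ 2), Nat.zero_le (k ^ 3), Nat.zero_le (k ^ 4), Nat.zero_le m]

/-- The search for the ordering runs through `2^k` sets, which `M` absorbs; so the time is dominated
by the dynamic program. -/
theorem setupCost_le {M E : ℕ} (hM : 2 ^ k ≤ M) (hE : E ≤ 11 * M) :
    setupCost k (M * (k * k + 1)) E ≤ 113 * M * (k + 1) ^ 4 := by
  have hM0 : 0 < M := lt_of_lt_of_le (by positivity) hM
  have h1 := homCost_le (k := k) hM0
  have h2 := Nat.mul_le_mul_right (k * (4 * k + 11) + 11) hM
  unfold setupCost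
  have h3 : (k * (k * 4 + 5) + 2) + (k * 7 + 5) + (M * (k * (4 * k + 11) + 11) + k * (3 * k + 9) + 7)
      + 11 * M + 6 ≤ 69 * M * (k + 1) ^ 4 := by
    obtain ⟨m, rfl⟩ := Nat.exists_eq_add_of_lt hM0
    ring_nf
    nlinarith [Nat.zero_le (m * k), Nat.zero_le (m * k ^ 2), Nat.zero_le (m * k ^ 3),
      Nat.zero_le (m * k ^ 4), Nat.zero_le (k ^ 2), Nat.zero_le (k ^ 3), Nat.zero_le (k ^ 4), Nat.zero_le m]
  linarith

theorem randomCost_le {M T : ℕ} (hM : n ≤ M) (hn : 0 < n) (hT : 0 < T) :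
    randomCost n k (M * (k * k + 1)) T ≤ 58 * T * M * (k + 1) ^ 4 := by
  have hM0 : 0 < M := by omega
  have h1 := homCost_le (k := k) hM0
  unfold randomCost
  have h2 : n * k * 4 + 5 ≤ 9 * M * (k + 1) ^ 4 := by
    have h3 : n * k ≤ M * k := Nat.mul_le_mul_right _ hM
    have h4 : k + 1 ≤ (k + 1) ^ 4 := Nat.le_self_pow (by omega) _
    have h5 : M * (k + 1) ≤ M * (k + 1) ^ 4 := Nat.mul_le_mul_left _ h4
    nlinarith
  have h6 : 1 ≤ M * (k + 1) ^ 4 := Nat.mul_pos hM0 (by positivity)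
  have h7 : T * (n * k * 4 + homCost k (M * (k * k + 1)) + 5) ≤ T * (53 * M * (k + 1) ^ 4) :=
    Nat.mul_le_mul_left _ (by linarith)
  have h8 : T * 1 ≤ T * (M * (k + 1) ^ 4) := Nat.mul_le_mul_left _ h6
  nlinarith

end Bounds

theorem natAbs_degArray_le {m : ℕ} {G : Digraph (Fin m)} {L : Fin m → List (Fin m)} (hL : IsAdjList G L)
    (i : ℕ) : (degArray L i).natAbs ≤ m := by
  unfold degArray
  split_ifs with h
  · simpa using length_adjList_le hL ⟨i, h⟩
  · simp

theorem natAbs_nbrArray_le {m : ℕ} (L : Fin m → List (Fin m)) (i : ℕ) : (nbrArray L i).natAbs ≤ m := by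
  unfold nbrArray
  split_ifs with h
  · rw [Int.natAbs_natCast]
    rcases lt_or_ge (i % m) ((L ⟨i / m, h⟩).map Fin.val).length with h1 | h1
    · rw [List.getD_eq_getElem _ _ h1, List.getElem_map]
      exact (Fin.is_lt _).le
    · rw [List.getD_eq_default _ _ h1]; omega
  · simp

theorem bdd_inputState {k n : ℕ} {H : Digraph (Fin k)} {G : Digraph (Fin n)} {LH : Fin k → List (Fin k)}
    {LG : Fin n → List (Fin n)} (hLH : IsAdjList H LH) (hLG : IsAdjList G LG) {ε : ℚ} (hε : 0 < ε) {B : ℕ}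
    (hn : n < 2 ^ (B + 8)) (hk : k < 2 ^ (B + 8)) (hnum : ε.num < 2 ^ (B + 8)) (hden : ε.den < 2 ^ (B + 8)) :
    Bdd B (inputState LH LG ε) := by
  have hnum' : ε.num.natAbs < 2 ^ (B + 8) := by
    have : (0 : ℤ) < ε.num := Rat.num_pos.2 hε
    zify
    rwa [abs_of_pos this]
  refine ⟨fun x => ?_, fun a i => ?_⟩
  · rcases x with _ | _ | _ | _ | x <;> simp [inputState, hn, hk, hnum', hden]
  · rcases a with _ | _ | _ | _ | a
    · exact (natAbs_degArray_le hLG i).trans_lt hn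
    · exact (natAbs_nbrArray_le LG i).trans_lt hn
    · exact (natAbs_degArray_le hLH i).trans_lt hk
    · exact (natAbs_nbrArray_le LH i).trans_lt hk
    · simp [inputState]

/-- The `+ 1` in the number of trials rounds the quotient up, as the concentration needs. In the
upper bound this single trial is paid for by the maximum with 1. -/
theorem trialCount_bounds {ε : ℚ} (hε : 0 < ε) (k : ℕ) :
    (200 * ((k + 1) * (k + 2)) : ℝ) ≤ (ε : ℝ) ^ 2 * trialCount k ε.num.toNat ε.den ∧
    (trialCount k ε.num.toNat ε.den : ℝ) ≤ 402 * ((k : ℝ) + 1) ^ 2 * max 1 ((1 / (ε : ℝ)) ^ 2) := by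
  have hnum : 0 < ε.num := Rat.num_pos.2 hε
  obtain ⟨a, ha⟩ : ∃ a : ℕ, ε.num = a := ⟨ε.num.toNat, by omega⟩
  have ha0 : 0 < a := by omega
  have hb0 : 0 < ε.den := ε.den_pos
  set b := ε.den with hb
  have hεr : (ε : ℝ) = a / b := by rw [Rat.cast_def, ha]; simp [hb]
  rw [ha, Int.toNat_natCast, hεr]
  have ha' : (0 : ℝ) < a := by exact_mod_cast ha0
  have hb' : (0 : ℝ) < b := by exact_mod_cast hb0
  unfold trialCount
  set X := 200 * (k + 1) * (k + 2) * (b * b) with hX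
  have h1 : X < a * a * (X / (a * a) + 1) := Nat.lt_mul_div_succ X (by positivity)
  have h1' : (X : ℝ) < a * a * ((X / (a * a) + 1 : ℕ) : ℝ) := by exact_mod_cast h1
  have h2 : ((X / (a * a) : ℕ) : ℝ) ≤ X / (a * a) := by
    have := Nat.cast_div_le (m := X) (n := a * a) (α := ℝ)
    push_cast at this ⊢
    exact this
  have hXr : (X : ℝ) = 200 * (k + 1) * (k + 2) * (b * b) := by rw [hX]; push_cast; ring
  constructor
  · rw [div_pow, div_mul_eq_mul_div, le_div_iff₀ (by positivity)]
    rw [hXr] at h1'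
    nlinarith
  · have h3 : (X : ℝ) / (a * a) = 200 * (k + 1) * (k + 2) * (1 / ((a : ℝ) / b)) ^ 2 := by
      rw [hXr]; field_simp
    set m := max 1 ((1 / ((a : ℝ) / b)) ^ 2) with hm
    have h4 : (1 : ℝ) ≤ m := le_max_left _ _
    have h5 : (1 / ((a : ℝ) / b)) ^ 2 ≤ m := le_max_right _ _
    have h6 : (k : ℝ) + 2 ≤ 2 * (k + 1) := by have := k.cast_nonneg (α := ℝ); linarith
    have h7 : (1 : ℝ) ≤ ((k : ℝ) + 1) ^ 2 := by
      have := k.cast_nonneg (α := ℝ); nlinarith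
    calc ((X / (a * a) + 1 : ℕ) : ℝ) ≤ 200 * (k + 1) * (k + 2) * m + 1 := by
          push_cast
          rw [h3] at h2
          have : (200 * (k + 1) * (k + 2) : ℝ) * (1 / ((a : ℝ) / b)) ^ 2 ≤ 200 * (k + 1) * (k + 2) * m := by
            gcongr
          linarith
      _ ≤ 200 * (k + 1) * (2 * (k + 1)) * m + ((k : ℝ) + 1) ^ 2 * m := by
          gcongr
          exact one_le_mul_of_one_le_of_one_le h7 h4
      _ ≤ 402 * ((k : ℝ) + 1) ^ 2 * m := by
          have : 0 ≤ ((k : ℝ) + 1) ^ 2 * m := by positivity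
          nlinarith

theorem levelWeight_pos {n : ℕ} (hn : 0 < n) (k q : ℕ) : 0 < levelWeight n k q := by
  unfold levelWeight
  positivity

theorem two_mul_le_sizeBound (w k : ℕ) : w + w ≤ sizeBound w k := by
  have : 1 ≤ (k + 1) ^ 2 := Nat.one_le_pow _ _ (by omega)
  calc w + w ≤ 16 * w * 1 := by omega
    _ ≤ sizeBound w k := Nat.mul_le_mul_left _ this

theorem le_sizeBound {w : ℕ} (hw : 0 < w) (k : ℕ) : k ≤ sizeBound w k := by
  have : k + 1 ≤ (k + 1) ^ 2 := Nat.le_self_pow (by omega) _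
  calc k ≤ 1 * (k + 1) ^ 2 := by omega
    _ ≤ sizeBound w k := Nat.mul_le_mul_right _ (by omega)

theorem totalCost_le {k n M L E T : ℕ} (hL : L = M * (k * k + 1)) (hn : 0 < n) (hnM : n ≤ M)
    (h2M : 2 ^ k ≤ M) (hE : E ≤ 11 * M) (hT : 0 < T) :
    setupCost k L E + randomCost n k L T + 1 ≤ 172 * T * M * (k + 1) ^ 4 := by
  subst hL
  have h4 := setupCost_le h2M hE
  have h5 := randomCost_le (k := k) hnM hn hT
  have h6 : M * (k + 1) ^ 4 ≤ T * (M * (k + 1) ^ 4) := Nat.le_mul_of_pos_left _ hT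
  have h7 : 1 ≤ M * (k + 1) ^ 4 := Nat.mul_pos (by omega) (by positivity)
  linarith

/-- The bound on the time, in terms of the parameters of the problem. -/
theorem time_le {k n q w t C : ℕ} (hw : 0 < w) (hC : 1000000000000 ≤ C) {T : ℕ} {m : ℝ}
    (hm : 1 ≤ m) (hT : (T : ℝ) ≤ 402 * ((k : ℝ) + 1) ^ 2 * m)
    (ht : t ≤ (172 * T * (n ^ (q + 1) * 4 ^ k) * (k + 1) ^ 4) * unitCost w (sizeBound w k)) :
    (t : ℝ) ≤ m * 4 ^ k * (n : ℝ) ^ (q + 1) * ((C : ℝ) * ((k : ℝ) + 1) ^ C) := by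
  have h1 : t ≤ (172 * T * (n ^ (q + 1) * 4 ^ k) * (k + 1) ^ 4) * (13520001 * (k + 1) ^ 4) :=
    ht.trans (Nat.mul_le_mul_left _ (unitCost_sizeBound_le hw k))
  have h2 : (t : ℝ) ≤ (172 * T * ((n : ℝ) ^ (q + 1) * 4 ^ k) * (k + 1) ^ 4) * (13520001 * (k + 1) ^ 4) := by
    exact_mod_cast h1
  have hk1 : (1 : ℝ) ≤ (k : ℝ) + 1 := by have := k.cast_nonneg (α := ℝ); linarith
  have hC' : (1000000000000 : ℝ) ≤ C := by exact_mod_cast hC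
  calc (t : ℝ) ≤ (172 * T * ((n : ℝ) ^ (q + 1) * 4 ^ k) * (k + 1) ^ 4) * (13520001 * (k + 1) ^ 4) := h2
    _ ≤ (172 * (402 * ((k : ℝ) + 1) ^ 2 * m) * ((n : ℝ) ^ (q + 1) * 4 ^ k) * (k + 1) ^ 4)
        * (13520001 * (k + 1) ^ 4) := by gcongr
    -- The constant is `172 * 402 * 13520001`; the exponent 10 collects 2 from the number of trials
    -- and 4 each from the step count and the cost of a step.
    _ = m * 4 ^ k * (n : ℝ) ^ (q + 1) * (934826949144 * ((k : ℝ) + 1) ^ 10) := by ring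
    _ ≤ m * 4 ^ k * (n : ℝ) ^ (q + 1) * ((C : ℝ) * ((k : ℝ) + 1) ^ C) := by
      have h10 : ((k : ℝ) + 1) ^ 10 ≤ ((k : ℝ) + 1) ^ C := pow_le_pow_right₀ hk1 (by omega)
      gcongr
      linarith

theorem mainProg_correct {k n : ℕ} {H : Digraph (Fin k)} {G : Digraph (Fin n)} {LH : Fin k → List (Fin k)}
    {LG : Fin n → List (Fin n)} {ε : ℚ} {w C : ℕ} (hC : 1000000000000 ≤ C) (hn : 0 < n)
    (hH : ∀ v : Fin k, ¬ H.Adj v v) (hLH : IsAdjList H LH) (hLG : IsAdjList G LG) (hε : 0 < ε)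
    (hnw : n < 2 ^ w) (hnum : ε.num < 2 ^ w) (hden : ε.den < 2 ^ w) :
    ∃ N : (ℕ → Bool) → ℤ,
      (∀ ω : ℕ → Bool, ∃ t : ℕ, Outputs mainProg w ω (inputState LH LG ε) (N ω) t ∧
        (t : ℝ) ≤ max 1 ((1 / (ε : ℝ)) ^ 2) * 4 ^ k *
          (n : ℝ) ^ (pathwidth H + 1) * ((C : ℝ) * ((k : ℝ) + 1) ^ C)) ∧
      99 / 100 ≤ coinMeasure {ω : ℕ → Bool |
        (1 - (ε : ℝ)) * (subCount H G : ℝ) ≤ (N ω : ℝ) ∧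
        (N ω : ℝ) ≤ (1 + (ε : ℝ)) * (subCount H G : ℝ)} := by
  have hw : 0 < w := by
    rcases Nat.eq_zero_or_pos w with rfl | h
    · simp at hnw; omega
    · exact h
  set B := sizeBound w k with hB
  have hwB : w + w ≤ B := two_mul_le_sizeBound w k
  have hpw : 2 ^ w ≤ 2 ^ (B + 8) := Nat.pow_le_pow_right (by omega) (by omega)
  have hBB : 2 ^ B < 2 ^ (B + 8) := Nat.pow_lt_pow_right (by omega) (by omega)
  have hkB : k < 2 ^ (B + 8) := by
    have h1 : k ≤ B := le_sizeBound hw k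
    have h2 : B + 8 < 2 ^ (B + 8) := Nat.lt_two_pow_self
    omega
  have hσ : Bdd B (inputState LH LG ε) := bdd_inputState hLH hLG hε (by omega) hkB
    (hnum.trans_le (by exact_mod_cast hpw)) (by omega)
  have hm : 1 ≤ max 1 ((1 / (ε : ℝ)) ^ 2) := le_max_left _ _
  obtain ⟨hT1, hT2⟩ := trialCount_bounds hε k
  -- If `n < k`, there are no subgraphs, and the program stops after one comparison. Otherwise `k ≤
  -- n < 2 ^ w`, so `k` fits into a word as well.
  rcases lt_or_ge n k with hkn | hkn
  · refine ⟨fun _ => 0, fun ω => ?_, ?_⟩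
    · obtain ⟨τ, t, h1, h2, h3⟩ := mainProg_spec_of_lt (w := w) hkn rfl rfl hσ ω
      refine ⟨t, ⟨τ, h1, h2⟩, time_le hw hC (T := 1) hm ?_ (h3.trans (Nat.mul_le_mul_right _ ?_))⟩
      · have := k.cast_nonneg (α := ℝ)
        push_cast
        nlinarith
      · have : 0 < n ^ (pathwidth H + 1) * 4 ^ k * (k + 1) ^ 4 := by positivity
        linarith
    · rw [subCount_eq_zero H G (by simpa using hkn)]
      simp only [Nat.cast_zero, mul_zero, Int.cast_zero, le_refl, and_self, Set.ofPred_true,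
        MeasureTheory.measure_univ]
      exact ENNReal.div_le_of_le_mul (by norm_num)
  have hnum0 : 0 < ε.num := Rat.num_pos.2 hε
  obtain ⟨a, ha⟩ : ∃ a : ℕ, ε.num = a := ⟨ε.num.toNat, by omega⟩
  rw [ha, Int.toNat_natCast] at hT1 hT2
  set q := pathwidth H with hq
  have hqk : q ≤ k := pathwidth_le H
  have hk1 : k + 1 ≤ 2 ^ w := by omega
  set M := n ^ (q + 1) * 4 ^ k with hM
  have h4k : 0 < 4 ^ k := by positivity
  have hnM : n ≤ M := (Nat.le_self_pow (by omega) n).trans (Nat.le_mul_of_pos_right _ h4k)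
  have h2M : 2 ^ k ≤ M := (Nat.pow_le_pow_left (by omega) k).trans
    (Nat.le_mul_of_pos_left _ (by positivity))
  -- If `H` has an edge, its pathwidth is at least 1 and `4 * n^2 + 5 * n + 2 ≤ 11 * n^2` is within
  -- the time bound; if not, the lists of `G` are not read and one step suffices.
  obtain ⟨E, hE1, hE2, hE3⟩ : ∃ E, 1 ≤ E ∧ (∀ u v, H.Adj u v → n * (n * 4 + 5) + 2 ≤ E) ∧ E ≤ 11 * M := by
    by_cases h : ∃ u v, H.Adj u v
    · obtain ⟨u, v, huv⟩ := h
      have h1 : 1 ≤ q := one_le_pathwidth (fun h => by subst h; exact hH u huv) huv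
      refine ⟨n * (n * 4 + 5) + 2, by omega, fun _ _ _ => le_rfl, ?_⟩
      have h2 : n ^ 2 ≤ M := (Nat.pow_le_pow_right hn (by omega)).trans (Nat.le_mul_of_pos_right _ h4k)
      have h3 : n ≤ n ^ 2 := Nat.le_self_pow (by omega) n
      have h4 : n * (n * 4 + 5) + 2 = 4 * n ^ 2 + 5 * n + 2 := by ring
      omega
    · exact ⟨1, le_rfl, fun u v huv => absurd ⟨u, v, huv⟩ h, by omega⟩
  have hnk : n * (k + 1) < 2 ^ (B + 8) := by
    have h1 : n * (k + 1) ≤ 2 ^ (w + w) := by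
      rw [pow_add]; exact Nat.mul_le_mul hnw.le hk1
    have h2 : 2 ^ (w + w) ≤ 2 ^ B := Nat.pow_le_pow_right (by omega) hwB
    omega
  have hZB := (tables_le (k := k) (n := n) (a := a) hk1 hw hden.le ε.den_pos hnw.le).trans_lt hBB
  have hLB := (values_le (a := a) hk1 hw hden.le ε.den_pos hnw.le hqk).trans_lt hBB
  have hTB : trialCount k a ε.den < 2 ^ (B + 8) := by
    refine lt_of_le_of_lt ((Nat.le_succ _).trans ?_) hZB
    exact Nat.le_mul_of_pos_right _ (by positivity)
  obtain ⟨e, he⟩ := mainProg_spec (w := w) (B := B) (L := levelWeight n k q) (E := E) (a := a) (b := ε.den)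
    (σ := inputState LH LG ε) hH hLH hLG hkn hn rfl rfl ha rfl
    (fun x hx => by obtain ⟨y, rfl⟩ := Nat.exists_eq_add_of_le' hx; rfl) rfl rfl rfl rfl
    (fun x i hx => by obtain ⟨y, rfl⟩ := Nat.exists_eq_add_of_le' hx; rfl) rfl
    (levelWeight_pos hn k q) (fun H' hH' i _ => level_le hn hH' i) hE1 hE2 hnk hTB hZB hLB hσ
  set T := trialCount k a ε.den with hT
  have hT0 : 0 < T := Nat.succ_pos _
  refine ⟨fun ω => estimate (relabel H e) G T ω, fun ω => ?_, ?_⟩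
  · obtain ⟨τ, t, h1, h2, h3⟩ := he ω
    refine ⟨t, ⟨τ, h1, h2⟩, time_le hw hC hm hT2 (h3.trans (Nat.mul_le_mul_right _
      (totalCost_le rfl hn hnM h2M hE3 hT0)))⟩
  · rw [← subCount_relabel H e]
    exact estimate_concentration (relabel H e) G hn hT0 (by exact_mod_cast hε) hT1

end SubgraphCounting

theorem theorem1 :
    ∃ (P : SubgraphCounting.Stmt) (C : ℕ),
      ∀ (k n : ℕ) (H : Digraph (Fin k)) (G : Digraph (Fin n))
        (LH : Fin k → List (Fin k)) (LG : Fin n → List (Fin n)) (ε : ℚ) (w : ℕ),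
        0 < n → (∀ v : Fin k, ¬ H.Adj v v) →
        SubgraphCounting.IsAdjList H LH → SubgraphCounting.IsAdjList G LG →
        0 < ε → n < 2 ^ w → ε.num < 2 ^ w → ε.den < 2 ^ w →
        ∃ N : (ℕ → Bool) → ℤ,
          (∀ ω : ℕ → Bool, ∃ t : ℕ,
            SubgraphCounting.Outputs P w ω (SubgraphCounting.inputState LH LG ε) (N ω) t ∧
            (t : ℝ) ≤ max 1 ((1 / (ε : ℝ)) ^ 2) * 4 ^ k *
              (n : ℝ) ^ (SubgraphCounting.pathwidth H + 1) * ((C : ℝ) * ((k : ℝ) + 1) ^ C)) ∧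
          99 / 100 ≤ SubgraphCounting.coinMeasure
            {ω : ℕ → Bool |
              (1 - (ε : ℝ)) * (SubgraphCounting.subCount H G : ℝ) ≤ (N ω : ℝ) ∧
              (N ω : ℝ) ≤ (1 + (ε : ℝ)) * (SubgraphCounting.subCount H G : ℝ)} := by
  -- The same constant is factor and exponent; it exceeds the factor 934826949144 and the exponent
  -- 10 of `time_le`.
  obtain ⟨C, hC⟩ : ∃ C : ℕ, 1000000000000 ≤ C := ⟨1000000000000, le_rfl⟩
  exact ⟨SubgraphCounting.mainProg, C, fun k n H G LH LG ε w hn hH hLH hLG hε hnw hnum hden =>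
    SubgraphCounting.mainProg_correct hC hn hH hLH hLG hε hnw hnum hden⟩
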